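/- Let $p,n\ge 1$ be integers and let $(\mathbf x_i)_{i\in\mathbb Z}$ be the $p$-dimensional linear process $\mathbf x_i=\boldsymbol\mu+\sum_{m=0}^\infty A_m\boldsymbol\xi_{i-m}$ (almost sure limit of the partial sums), where $\boldsymbol\mu\in\mathbb R^p$, the $A_m$ are real $p\times p$ matrices and $\boldsymbol\xi_i=(\xi_{i,1},\dots,\xi_{i,p})^\top$, with $(\xi_{i,j})$ i.i.d. random variables of mean zero and variance one. Assume, for constants $\beta>1/2$, $\beta\notin\{3/4,1\}$, and $C_0,C_\xi\in(0,\infty)$, that (i) for every $m\ge 0$ each row of $A_m$ has Euclidean norm at most $C_0(1\vee m)^{-\beta}$; (ii) $(\mathbb E|\xi_{1,1}|^q)^{1/q}\le C_\xi q^{1/2}$ for all $q\ge 1$. Let the covariance matrix $\Sigma=\mathrm{cov}(\mathbf x_i)$ be invertible, $\mathbf b\in\mathbb R^p$ and $\boldsymbol\theta=\Sigma^{-1}\mathbf b$. Let $\hat{\mathbf b}$ be an estimator of $\mathbf b$ with $\mathbb P(|\hat{\mathbf b}-\mathbf b|_\infty>c_br_b)\le 2p^{-C_b}$, where $c_b>0$,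 $r_b\ge 0$, $C_b\in(0,\infty]$ (and $p^{-\infty}:=0$; if $\mathbf b$ is observed one may take $\hat{\mathbf b}=\mathbf b$, $r_b=0$, $C_b=\infty$). Let $\hat S_n=n^{-1}\sum_{i=1}^n(\mathbf x_i-\mathbf c)(\mathbf x_i-\mathbf c)^\top$ with either $\mathbf c=\boldsymbol\mu$ (mean known) or $\mathbf c=n^{-1}\sum_{i=1}^n\mathbf x_i$ (mean unknown). For $\lambda\ge 0$ let $$\hat{\boldsymbol\theta}=\hat{\boldsymbol\theta}(\lambda)\in\operatorname{argmin}_{\boldsymbol\eta\in\mathbb R^p}\{|\boldsymbol\eta|_1:\ |\hat S_n\boldsymbol\eta-\hat{\mathbf b}|_\infty\le\lambda\}.$$ Write $|\cdot|_w$ for the $\ell^w$ norm on $\mathbb R^p$, $|M|_{L^1}=\max_k\sum_j|m_{jk}|$, $D(u)=\sum_{j=1}^p(|\theta_j|\wedge u)$, and $$J_{n,p,\beta}=\begin{cases}(\log p/n)^{1/2},&\beta>1,\\ (\log p/n)^{1/2}\vee(\log p/n^{2\beta-1}),&3/4<\beta<1,\\ \log p/n^{2\beta-1},&1/2<\beta<3/4.\end{cases}$$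 Then there are constants $C_1>1$ and $C_2>0$ depending only on $\beta$, $C_0$ and $C_\xi$ such that, for every $\lambda\ge c_br_b+C_1|\boldsymbol\theta|_1J_{n,p,\beta}$, with probability at least $1-2p^{-C_b}-2p^{-C_2}$ the minimization problem has a solution and every solution $\hat{\boldsymbol\theta}$ satisfies $$|\hat{\boldsymbol\theta}-\boldsymbol\theta|_w\le\big[6D(5|\Sigma^{-1}|_{L^1}\lambda)\big]^{1/w}\,(2|\Sigma^{-1}|_{L^1}\lambda)^{1-1/w}\qquad\text{for all }w\in[1,\infty].$$ In particular, let $0\le r<1$, $\nu\ge0$, and suppose $\max_j|\theta_j|\le\nu$ and $\sum_j|\theta_j|^r\le M_p$ (with $0^0:=0$), i.e. $\boldsymbol\theta\in\mathcal G_r(\nu,M_p)$. Then, with the choice $\lambda=c_br_b+C_1\nu^{1-r}M_pJ_{n,p,\beta}$, for every $w\in[1,\infty]$, with probability at least $1-2p^{-C_b}-2p^{-C_2}$ a solution exists and every solution satisfies $$|\hat{\boldsymbol\theta}-\boldsymbol\theta|_w\le C_3\,M_p^{1/w}\big[|\Sigma^{-1}|_{L^1}(M_pJ_{n,p,\beta}+r_b)\big]^{1-r/w},$$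 where $C_3>0$ depends only on $r$, $\nu$, $w$, $C_1$ and $c_b$. -/

import Mathlib

open MeasureTheory ProbabilityTheory Filter Topology
open scoped ENNReal Matrix

noncomputable section

/-- The `ℓ^w` norm `|v|_w` of a vector of `ℝ^p`, for `w ∈ [1, ∞]` (`|v|_∞` is the largest
absolute value of an entry). -/
def vecNorm {p : ℕ} (w : ℝ≥0∞) (v : Fin p → ℝ) : ℝ := ‖WithLp.toLp w v‖

/-- `|M|_{L^1} = max_k ∑_j |m_{jk}|`, the largest absolute column sum. -/
def matL1Norm {p : ℕ} (M : Matrix (Fin p) (Fin p) ℝ) : ℝ := ⨆ k, ∑ j, |M j k|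

/-- `p ^ (-C)` for `C ∈ [0, ∞]`, with `p ^ (-∞) = 0`. -/
def negPow (p : ℕ) (C : ℝ≥0∞) : ℝ := if C = ∞ then 0 else (p : ℝ) ^ (-C.toReal)

/-- The array `(ξ_{i,j})` consists of i.i.d. random variables with mean zero, unit variance and
`‖ξ_{i,j}‖_q ≤ Cξ q^{1/2}` for all real `q ≥ 1`. -/
structure IsSubGaussianInnovation {Ω : Type*} [MeasurableSpace Ω] {p : ℕ} (P : Measure Ω)
    (Cξ : ℝ) (ξ : ℤ → Fin p → Ω → ℝ) : Prop where
  measurable : ∀ i j, Measurable (ξ i j)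
  indep : iIndepFun (fun (a : ℤ × Fin p) => ξ a.1 a.2) P
  identDistrib : ∀ i j i' j', IdentDistrib (ξ i j) (ξ i' j') P P
  mean_zero : ∀ i j, ∫ ω, ξ i j ω ∂P = 0
  variance_one : ∀ i j, variance (ξ i j) P = 1
  moment_le : ∀ i j, ∀ q : ℝ, 1 ≤ q →
    eLpNorm (ξ i j) (ENNReal.ofReal q) P ≤ ENNReal.ofReal (Cξ * q ^ (1 / 2 : ℝ))

/-- `x_i = μ + ∑_{m ≥ 0} A_m ξ_{i-m}` for all `i ∈ ℤ`, the series being the almost sure limit of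
its partial sums (it need not converge absolutely under long-range dependence). -/
def IsVectorLinearProcess {Ω : Type*} [MeasurableSpace Ω] {p : ℕ} (P : Measure Ω)
    (μ : Fin p → ℝ) (A : ℕ → Matrix (Fin p) (Fin p) ℝ) (ξ : ℤ → Fin p → Ω → ℝ)
    (x : ℤ → Ω → Fin p → ℝ) : Prop :=
  ∀ i : ℤ, ∀ᵐ ω ∂P,
    Tendsto (fun N : ℕ => μ + ∑ m ∈ Finset.range N, A m *ᵥ (fun j => ξ (i - (m : ℤ)) j ω))
      atTop (𝓝 (x i ω))

/-- The decay condition `max_j |A_{m,j·}| ≤ C₀ (1 ∨ m)^{-β}` for all `m ≥ 0`, where `|A_{m,j·}|`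
is the Euclidean norm of the `j`-th row. -/
def CoeffDecay {p : ℕ} (C₀ β : ℝ) (A : ℕ → Matrix (Fin p) (Fin p) ℝ) : Prop :=
  ∀ m j, Real.sqrt (∑ k, (A m j k) ^ 2) ≤ C₀ * (max 1 (m : ℝ)) ^ (-β)

/-- The covariance matrix of a random vector. -/
def covMatrix {Ω : Type*} [MeasurableSpace Ω] {p : ℕ} (P : Measure Ω) (X : Ω → Fin p → ℝ) :
    Matrix (Fin p) (Fin p) ℝ :=
  Matrix.of fun j k => covariance (fun ω => X ω j) (fun ω => X ω k) P

/-- The sample mean of `y_1, …, y_n`. -/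
def sampleMean {p : ℕ} (n : ℕ) (y : ℤ → Fin p → ℝ) : Fin p → ℝ :=
  (n : ℝ)⁻¹ • ∑ i ∈ Finset.Icc (1 : ℤ) n, y i

/-- `n⁻¹ ∑_{i=1}^n (y_i - c)(y_i - c)ᵀ`: the sample covariance matrix with centre `c`, which is the
true mean if that is known and the sample mean otherwise. -/
def sampleCov {p : ℕ} (n : ℕ) (c : Fin p → ℝ) (y : ℤ → Fin p → ℝ) :
    Matrix (Fin p) (Fin p) ℝ :=
  (n : ℝ)⁻¹ • ∑ i ∈ Finset.Icc (1 : ℤ) n, Matrix.vecMulVec (y i - c) (y i - c)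

/-- The constraint set `{η : |S η - b|_∞ ≤ lam}`. -/
def dantzigFeasible {p : ℕ} (S : Matrix (Fin p) (Fin p) ℝ) (b : Fin p → ℝ) (lam : ℝ) :
    Set (Fin p → ℝ) :=
  {η | vecNorm ∞ (S *ᵥ η - b) ≤ lam}

/-- The set `argmin {|η|_1 : |S η - b|_∞ ≤ lam}` of all values of the estimator. -/
def dantzigArgmin {p : ℕ} (S : Matrix (Fin p) (Fin p) ℝ) (b : Fin p → ℝ) (lam : ℝ) :
    Set (Fin p → ℝ) :=
  {η | η ∈ dantzigFeasible S b lam ∧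
    ∀ ζ ∈ dantzigFeasible S b lam, vecNorm 1 η ≤ vecNorm 1 ζ}

/-- The smallness measure `D(u) = ∑_j (|θ_j| ∧ u)`. -/
def smallness {p : ℕ} (θ : Fin p → ℝ) (u : ℝ) : ℝ := ∑ j, min |θ j| u

/-- The class `G_r(ν, M)` of vectors with `max_j |η_j| ≤ ν` and `∑_j |η_j|^r ≤ M`; for `r = 0` the
sum is the number of nonzero entries. -/
def sparseClass {p : ℕ} (r ν M : ℝ) : Set (Fin p → ℝ) :=
  {η | (∀ j, |η j| ≤ ν) ∧ ∑ j, (if η j = 0 then 0 else |η j| ^ r) ≤ M}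

/-- The rate `J_{n,p,β}`, for `β > 1`, `3/4 < β < 1` and `1/2 < β < 3/4` respectively. -/
def rateJ (n p : ℕ) (β : ℝ) : ℝ :=
  if 1 < β then Real.sqrt (Real.log p / n)
  else if 3 / 4 < β then
    max (Real.sqrt (Real.log p / n)) (Real.log p / (n : ℝ) ^ (2 * β - 1))
  else Real.log p / (n : ℝ) ^ (2 * β - 1)

/-- With probability at least `q` the property `E` holds: there is a measurable event of
probability at least `q` on which it holds. -/
def HoldsWithProbAtLeast {Ω : Type*} [MeasurableSpace Ω] (P : Measure Ω) (q : ℝ)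
    (E : Ω → Prop) : Prop :=
  ∃ G : Set Ω, MeasurableSet G ∧ (∀ ω ∈ G, E ω) ∧ q ≤ P.real G

end

noncomputable section

/-! The proof has a deterministic half and a probabilistic half.

Deterministic half. Suppose every entry of the sample covariance is within `ε` of `Sig`, the sup
error of `bhat` is at most `ρ`, and `ρ + ε |θ|₁ ≤ lam`. Then `θ` is feasible, so every minimizer has
`|θhat|₁ ≤ |θ|₁`, and therefore `Sig (θhat - θ)` is at most `2 lam` in sup norm. Applying `Sig⁻¹`
gives a sup error of at most `2κ`, where `κ = |Sig⁻¹|_{L¹} lam`. A coordinatewise comparison turns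
this into an `ℓ¹` error of at most `6 D(5κ)` (`vecNorm_one_sub_le_smallness`), and interpolation
covers the other norms.

Probabilistic half. By polarization, entrywise concentration reduces to sums of squares of the
scalar linear processes `x_j ± x_k`; an unknown mean only adds squared sample means. Truncated at a
finite order, such a process is a finite linear image of independent innovations, and a
Hanson–Wright bound (`lintegral_exp_norm_sq_le`) controls its Laplace transform. That bound is
proved by adding one innovation at a time and updating a resolvent by a rank-one term. Its two
inputs, an operator norm and a Frobenius norm, are read from the Gram matrix over time. The entries
of this matrix are bounded, uniformly in the truncation, by autocorrelations `g(h)` of the weights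
`(1 ∨ m)^{-β}`, and Fatou's lemma removes the truncation.

The regimes of `rateJ` come from `g`: it is summable for `β > 1`; for `β < 1` it is of order at most
`h^{1-2β}`, whose square is summable exactly when `β > 3/4`. `exists_scale` picks the Laplace
parameter, and a union bound over the pairs of coordinates finishes the concentration.

This needs `rateJ ≤ 1`. When `rateJ > 1`, `lam` is so large that `0` is feasible; the estimator is
then `0` and the bounds hold trivially (`dantzigArgmin_error_of_large`). -/

/-! ### Laplace transforms of a single sub-Gaussian variable -/

theorem Real.exp_le_one_add_add_sq_mul_exp_abs (x : ℝ) :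
    Real.exp x ≤ 1 + x + x ^ 2 * Real.exp |x| := by
  have h0 : 1 ≤ Real.exp |x| := Real.one_le_exp (abs_nonneg x)
  rcases le_or_gt |x| 1 with h | h
  · have h1 := (abs_le.1 (Real.abs_exp_sub_one_sub_id_le h)).2
    nlinarith [sq_nonneg x]
  · have hx2 : 1 ≤ x ^ 2 := by rw [← sq_abs]; nlinarith
    rcases le_total 0 x with hx | hx
    · rw [abs_of_nonneg hx] at *
      nlinarith [Real.exp_pos x]
    · have h2 : Real.exp x ≤ 1 := Real.exp_le_one_iff.2 hx
      rw [abs_of_nonpos hx] at *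
      nlinarith [mul_le_mul hx2 h0 zero_le_one (sq_nonneg x)]

theorem integral_exp_mul_le_of_sq_mul_exp {Ω : Type*} [MeasurableSpace Ω] {P : Measure Ω}
    [IsProbabilityMeasure P] {W f : Ω → ℝ} {k : ℝ} (hW : Integrable W P) (hW0 : ∫ ω, W ω ∂P = 0)
    (hf : Integrable f P) (hfk : ∫ ω, f ω ∂P ≤ k)
    (hWf : ∀ ω, W ω ^ 2 * Real.exp |W ω| ≤ f ω) {t : ℝ} (ht : |t| ≤ 1) :
    ∫⁻ ω, ENNReal.ofReal (Real.exp (t * W ω)) ∂P ≤ ENNReal.ofReal (Real.exp (k * t ^ 2)) := by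
  have hpt : ∀ ω, Real.exp (t * W ω) ≤ 1 + t * W ω + t ^ 2 * f ω := by
    intro ω
    refine (Real.exp_le_one_add_add_sq_mul_exp_abs _).trans ?_
    have h1 : |t * W ω| ≤ |W ω| := by
      rw [abs_mul]; exact mul_le_of_le_one_left (abs_nonneg _) ht
    have h2 : (t * W ω) ^ 2 * Real.exp |t * W ω| ≤ t ^ 2 * f ω := by
      calc (t * W ω) ^ 2 * Real.exp |t * W ω| ≤ (t * W ω) ^ 2 * Real.exp |W ω| := by gcongr
        _ = t ^ 2 * (W ω ^ 2 * Real.exp |W ω|) := by ring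
        _ ≤ t ^ 2 * f ω := by gcongr; exact hWf ω
    linarith
  have hint : Integrable (fun ω => 1 + t * W ω + t ^ 2 * f ω) P :=
    ((integrable_const _).add (hW.const_mul t)).add (hf.const_mul _)
  calc ∫⁻ ω, ENNReal.ofReal (Real.exp (t * W ω)) ∂P
      ≤ ∫⁻ ω, ENNReal.ofReal (1 + t * W ω + t ^ 2 * f ω) ∂P :=
        lintegral_mono fun ω => ENNReal.ofReal_le_ofReal (hpt ω)
    _ = ENNReal.ofReal (∫ ω, (1 + t * W ω + t ^ 2 * f ω) ∂P) :=
        (ofReal_integral_eq_lintegral_ofReal hint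
          (ae_of_all _ fun ω => (Real.exp_pos _).le.trans (hpt ω))).symm
    _ ≤ _ := by
        apply ENNReal.ofReal_le_ofReal
        have h1 : Integrable (fun ω => 1 + t * W ω) P := (integrable_const _).add (hW.const_mul t)
        rw [integral_add h1 (hf.const_mul _),
          integral_add (integrable_const _) (hW.const_mul t), integral_const_mul,
          integral_const_mul, hW0]
        simp only [integral_const, probReal_univ, smul_eq_mul, mul_one, mul_zero, add_zero]
        have := Real.add_one_le_exp (k * t ^ 2)
        nlinarith [mul_le_mul_of_nonneg_left hfk (sq_nonneg t)]

/-- In the exponential series the moment bound at `q = 2k` and `k^k / k! ≤ e^k` make the `k`-th term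
at most `(2 e Cξ² c)^k ≤ 2^{-k}`. -/
theorem lintegral_exp_mul_sq_le_two {Ω : Type*} [MeasurableSpace Ω] {P : Measure Ω}
    [IsProbabilityMeasure P] {Cξ c : ℝ} {X : Ω → ℝ} (hC : 0 < Cξ) (hX : Measurable X)
    (hmom : ∀ q : ℝ, 1 ≤ q →
      eLpNorm X (ENNReal.ofReal q) P ≤ ENNReal.ofReal (Cξ * q ^ (1 / 2 : ℝ)))
    (hc : 0 ≤ c) (hc' : 4 * Real.exp 1 * Cξ ^ 2 * c ≤ 1) :
    ∫⁻ ω, ENNReal.ofReal (Real.exp (c * X ω ^ 2)) ∂P ≤ 2 := by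
  have hser : ∀ ω, ENNReal.ofReal (Real.exp (c * X ω ^ 2)) =
      ∑' k : ℕ, ENNReal.ofReal ((c * X ω ^ 2) ^ k / k.factorial) := by
    intro ω
    rw [← ENNReal.ofReal_tsum_of_nonneg (fun k => by positivity)
      (Real.summable_pow_div_factorial _), Real.exp_eq_exp_ℝ, NormedSpace.exp_eq_tsum_div]
  simp_rw [hser]
  rw [lintegral_tsum (fun k => (by fun_prop))]
  have hterm : ∀ k : ℕ, ∫⁻ ω, ENNReal.ofReal ((c * X ω ^ 2) ^ k / k.factorial) ∂P ≤
      ENNReal.ofReal ((1 / 2 : ℝ) ^ k) := by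
    intro k
    rcases Nat.eq_zero_or_pos k with rfl | hk
    · simp
    have hk1 : (1 : ℝ) ≤ k := by exact_mod_cast hk
    have h1 := hmom (2 * k) (by linarith)
    rw [eLpNorm_eq_lintegral_rpow_enorm_toReal (ENNReal.ofReal_pos.2 (by positivity)).ne'
      ENNReal.ofReal_ne_top,
      ENNReal.toReal_ofReal (by positivity)] at h1
    have h2 := ENNReal.rpow_le_rpow h1 (z := 2 * k) (by positivity)
    rw [← ENNReal.rpow_mul, one_div_mul_cancel (by positivity), ENNReal.rpow_one,
      ENNReal.ofReal_rpow_of_nonneg (by positivity) (by positivity)] at h2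
    have h3 : (Cξ * (2 * (k : ℝ)) ^ (1 / 2 : ℝ)) ^ (2 * (k : ℝ)) = (Cξ ^ 2 * (2 * k)) ^ k := by
      rw [← Real.sqrt_eq_rpow, show (2 * (k : ℝ)) = ((2 * k : ℕ) : ℝ) by push_cast; ring,
        Real.rpow_natCast, pow_mul, mul_pow, Real.sq_sqrt (by positivity)]
    rw [h3] at h2
    have h4 : ∀ ω, ENNReal.ofReal ((c * X ω ^ 2) ^ k / k.factorial) =
        ENNReal.ofReal (c ^ k / k.factorial) * ‖X ω‖ₑ ^ (2 * (k : ℝ)) := by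
      intro ω
      rw [show (2 * (k : ℝ)) = ((2 * k : ℕ) : ℝ) by push_cast; ring, ENNReal.rpow_natCast,
        Real.enorm_eq_ofReal_abs, ← ENNReal.ofReal_pow (abs_nonneg _),
        ← ENNReal.ofReal_mul (by positivity), pow_mul, sq_abs]
      congr 1; rw [mul_pow]; ring
    simp_rw [h4]
    rw [lintegral_const_mul _ (by fun_prop)]
    calc _ ≤ ENNReal.ofReal (c ^ k / k.factorial) * ENNReal.ofReal ((Cξ ^ 2 * (2 * k)) ^ k) := by
          gcongr
      _ = ENNReal.ofReal ((2 * Cξ ^ 2 * c) ^ k * ((k : ℝ) ^ k / k.factorial)) := by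
          rw [← ENNReal.ofReal_mul (by positivity)]
          congr 1; rw [mul_pow, mul_pow, mul_pow, mul_pow]; ring
      _ ≤ ENNReal.ofReal ((2 * Cξ ^ 2 * c) ^ k * Real.exp 1 ^ k) := by
          gcongr
          have := Real.pow_div_factorial_le_exp (k : ℝ) (by positivity) k
          rwa [← Real.exp_nat_mul, mul_one]
      _ ≤ _ := by
          rw [← mul_pow]
          gcongr
          linarith
  calc _ ≤ ∑' k : ℕ, ENNReal.ofReal ((1 / 2 : ℝ) ^ k) := ENNReal.tsum_le_tsum hterm
    _ = 2 := by
      rw [← ENNReal.ofReal_tsum_of_nonneg (fun k => by positivity) summable_geometric_two,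
        tsum_geometric_two]
      simp

/-- The joint sub-Gaussian and sub-exponential bound on the Laplace transform of `(X, X²)`. -/
def QuadExpBound {Ω : Type*} [MeasurableSpace Ω] (P : Measure Ω) (K : ℝ) (X : Ω → ℝ) : Prop :=
  ∀ b u : ℝ, K * |b| ≤ 1 → ∫⁻ ω, ENNReal.ofReal (Real.exp (b * X ω ^ 2 + 2 * u * X ω)) ∂P ≤
    ENNReal.ofReal (Real.exp (b + K * (b ^ 2 + u ^ 2)))

/-- The linear and the centred quadratic parts are bounded separately and then recombined by `xy ≤
(x² + y²)/2`, which doubles both exponents. -/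
theorem quadExpBound_of_exp_sq {Ω : Type*} [MeasurableSpace Ω] {P : Measure Ω}
    [IsProbabilityMeasure P] {c : ℝ} {X : Ω → ℝ} (hX : Measurable X)
    (hc : 0 < c) (hc1 : c ≤ 1) (hexp : ∫⁻ ω, ENNReal.ofReal (Real.exp (c * X ω ^ 2)) ∂P ≤ 2)
    (hmean : ∫ ω, X ω ∂P = 0) (hsq : ∫ ω, X ω ^ 2 ∂P = 1) :
    QuadExpBound P (96 / c ^ 2) X := by
  set f : Ω → ℝ := fun ω => Real.exp (c * X ω ^ 2) with hf
  have hfm : Measurable f := by fun_prop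
  have hfi : Integrable f P := by
    refine ⟨hfm.aestronglyMeasurable, ?_⟩
    rw [hasFiniteIntegral_iff_ofReal (ae_of_all _ fun ω => (Real.exp_pos _).le)]
    exact hexp.trans_lt (by simp)
  have hf2 : ∫ ω, f ω ∂P ≤ 2 := by
    rw [integral_eq_lintegral_of_nonneg_ae (ae_of_all _ fun ω => (Real.exp_pos _).le)
      hfm.aestronglyMeasurable]
    exact ENNReal.toReal_le_of_le_ofReal (by norm_num) (by simpa using hexp)
  have he3 : Real.exp 1 ≤ 3 := Real.exp_one_lt_three.le
  have hX2i : Integrable (fun ω => X ω ^ 2) P := by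
    refine (hfi.const_mul c⁻¹).mono' (by fun_prop) (ae_of_all _ fun ω => ?_)
    rw [Real.norm_of_nonneg (sq_nonneg _), inv_mul_eq_div, le_div_iff₀ hc]
    have := Real.add_one_le_exp (c * X ω ^ 2)
    simp only [hf]; linarith
  have hXi : Integrable X P := by
    refine ((integrable_const (1 : ℝ)).add hX2i).mono' (by fun_prop) (ae_of_all _ fun ω => ?_)
    rw [Real.norm_eq_abs]
    simp only [Pi.add_apply]
    nlinarith [sq_nonneg (|X ω| - 1), sq_abs (X ω)]
  have hsqe : ∀ W : ℝ, W ^ 2 * Real.exp |W| ≤ 2 * Real.exp (2 * |W|) := by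
    intro W
    have h1 := Real.quadratic_le_exp_of_nonneg (abs_nonneg W)
    have h2 : W ^ 2 ≤ 2 * Real.exp |W| := by rw [← sq_abs]; nlinarith [abs_nonneg W]
    calc _ ≤ 2 * Real.exp |W| * Real.exp |W| := by gcongr
      _ = _ := by rw [mul_assoc, ← Real.exp_add]; ring_nf
  have hlin : ∀ u : ℝ, ∫⁻ ω, ENNReal.ofReal (Real.exp (u * X ω)) ∂P ≤
      ENNReal.ofReal (Real.exp (12 * u ^ 2 / c)) := by
    intro u
    -- For small `u` the second-order expansion applies to `√c X`; the majorant is `6 f` because `2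
    -- e ≤ 6`, and `k = 12` because `∫ f ≤ 2`. For large `u`, Young's inequality `uX ≤ u²/(4c) +
    -- cX²` suffices, since the leftover constant is absorbed by `u²/c ≥ 1`.
    rcases le_or_gt |u| (Real.sqrt c) with hu | hu
    · have hs : 0 < Real.sqrt c := Real.sqrt_pos.2 hc
      have := integral_exp_mul_le_of_sq_mul_exp (P := P) (W := fun ω => Real.sqrt c * X ω)
        (f := fun ω => 6 * f ω) (k := 12) (t := u / Real.sqrt c) (hXi.const_mul _)
        (by rw [integral_const_mul, hmean, mul_zero]) (hfi.const_mul _)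
        (by rw [integral_const_mul]; linarith)
        (by
          intro ω
          refine (hsqe _).trans ?_
          have h1 : 2 * |Real.sqrt c * X ω| ≤ 1 + c * X ω ^ 2 := by
            have : |Real.sqrt c * X ω| ^ 2 = c * X ω ^ 2 := by
              rw [sq_abs, mul_pow, Real.sq_sqrt hc.le]
            nlinarith [sq_nonneg (|Real.sqrt c * X ω| - 1)]
          have h2 := Real.exp_le_exp.2 h1
          rw [Real.exp_add] at h2
          have : 0 < f ω := Real.exp_pos _
          simp only [hf] at *
          nlinarith)
        (by rw [abs_div, abs_of_pos hs, div_le_one hs]; exact hu)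
      convert this using 4
      · field_simp
      · rw [div_pow, Real.sq_sqrt hc.le]; ring
    · have hu2 : c ≤ u ^ 2 := by
        rw [← sq_abs, ← Real.sq_sqrt hc.le]
        exact pow_le_pow_left₀ (Real.sqrt_nonneg _) hu.le 2
      calc _ ≤ ∫⁻ ω, ENNReal.ofReal (Real.exp (u ^ 2 / (4 * c))) * ENNReal.ofReal (f ω) ∂P := by
            refine lintegral_mono fun ω => ?_
            rw [← ENNReal.ofReal_mul (Real.exp_pos _).le, hf, ← Real.exp_add]
            apply ENNReal.ofReal_le_ofReal
            rw [Real.exp_le_exp, ← sub_nonneg]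
            have : u ^ 2 / (4 * c) + c * X ω ^ 2 - u * X ω = (u - 2 * c * X ω) ^ 2 / (4 * c) := by
              field_simp; ring
            rw [this]; positivity
        _ = ENNReal.ofReal (Real.exp (u ^ 2 / (4 * c))) * ∫⁻ ω, ENNReal.ofReal (f ω) ∂P := by
            rw [lintegral_const_mul _ (by fun_prop)]
        _ ≤ ENNReal.ofReal (Real.exp (u ^ 2 / (4 * c))) * ENNReal.ofReal (Real.exp 1) := by
            gcongr
            refine hexp.trans ?_
            rw [← ENNReal.ofReal_ofNat]
            apply ENNReal.ofReal_le_ofReal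
            have := Real.add_one_le_exp 1
            linarith
        _ ≤ _ := by
            rw [← ENNReal.ofReal_mul (Real.exp_pos _).le, ← Real.exp_add]
            apply ENNReal.ofReal_le_ofReal
            rw [Real.exp_le_exp]
            have h1 : 1 ≤ u ^ 2 / c := by rwa [le_div_iff₀ hc, one_mul]
            have h2 : u ^ 2 / (4 * c) = (u ^ 2 / c) / 4 := by field_simp
            have h3 : 12 * u ^ 2 / c = 12 * (u ^ 2 / c) := by ring
            rw [h2, h3]; linarith
  have hquad : ∀ b : ℝ, |b| ≤ c / 2 →
      ∫⁻ ω, ENNReal.ofReal (Real.exp (b * (X ω ^ 2 - 1))) ∂P ≤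
      ENNReal.ofReal (Real.exp (48 * b ^ 2 / c ^ 2)) := by
    intro b hb
    have := integral_exp_mul_le_of_sq_mul_exp (P := P) (W := fun ω => c / 2 * (X ω ^ 2 - 1))
      (f := fun ω => 6 * f ω) (k := 12) (t := 2 * b / c)
      ((hX2i.sub (integrable_const 1)).const_mul _)
      (by rw [integral_const_mul, integral_sub hX2i (integrable_const 1), hsq]; simp)
      (hfi.const_mul _) (by rw [integral_const_mul]; linarith)
      (by
        intro ω
        refine (hsqe _).trans ?_
        have h1 : 2 * |c / 2 * (X ω ^ 2 - 1)| ≤ 1 + c * X ω ^ 2 := by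
          rw [abs_mul, abs_of_pos (half_pos hc)]
          have : |X ω ^ 2 - 1| ≤ X ω ^ 2 + 1 := abs_le.2 ⟨by nlinarith, by nlinarith⟩
          nlinarith
        have h2 := Real.exp_le_exp.2 h1
        rw [Real.exp_add] at h2
        have : 0 < f ω := Real.exp_pos _
        simp only [hf] at *
        nlinarith)
      (by rw [abs_div, abs_of_pos hc, abs_mul, abs_two, div_le_one hc]; linarith)
    convert this using 4
    · field_simp
    · field_simp; ring
  intro b u hb
  have hcc : c ^ 2 ≤ c := by nlinarith
  have hb' : |b| ≤ c / 4 := by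
    rw [div_mul_eq_mul_div, div_le_one (by positivity)] at hb
    linarith [abs_nonneg b]
  -- The exponents in `hquad (2 * b)` and `hlin (4 * u)` are `2α` and `2δ`. The weights `exp (-2α)`
  -- and `exp (-2δ)` below normalize the two halves, so that each contributes exactly one half after
  -- integration.
  set α : ℝ := 96 * b ^ 2 / c ^ 2
  set δ : ℝ := 96 * u ^ 2 / c
  have h1 := hquad (2 * b) (by rw [abs_mul, abs_two]; linarith)
  have h2 := hlin (4 * u)
  have key : ∀ ω, ENNReal.ofReal (Real.exp (b * X ω ^ 2 + 2 * u * X ω)) ≤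
      ENNReal.ofReal (Real.exp (b + α + δ) * Real.exp (-(2 * α)) / 2) *
        ENNReal.ofReal (Real.exp (2 * b * (X ω ^ 2 - 1))) +
      ENNReal.ofReal (Real.exp (b + α + δ) * Real.exp (-(2 * δ)) / 2) *
        ENNReal.ofReal (Real.exp (4 * u * X ω)) := by
    intro ω
    rw [← ENNReal.ofReal_mul (by positivity), ← ENNReal.ofReal_mul (by positivity),
      ← ENNReal.ofReal_add (by positivity) (by positivity)]
    apply ENNReal.ofReal_le_ofReal
    have e1 : Real.exp (b * X ω ^ 2 + 2 * u * X ω) = Real.exp (b + α + δ) *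
        (Real.exp (b * (X ω ^ 2 - 1) - α) * Real.exp (2 * u * X ω - δ)) := by
      rw [← Real.exp_add, ← Real.exp_add]; ring_nf
    have e2 : Real.exp (-(2 * α)) * Real.exp (2 * b * (X ω ^ 2 - 1)) =
        Real.exp (b * (X ω ^ 2 - 1) - α) ^ 2 := by
      rw [← Real.exp_add, ← Real.exp_nat_mul]; congr 1; push_cast; ring
    have e3 : Real.exp (-(2 * δ)) * Real.exp (4 * u * X ω) =
        Real.exp (2 * u * X ω - δ) ^ 2 := by
      rw [← Real.exp_add, ← Real.exp_nat_mul]; congr 1; push_cast; ring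
    have e4 : ∀ a x y z w : ℝ, a * x / 2 * y + a * z / 2 * w = a * ((x * y + z * w) / 2) := by
      intros; ring
    rw [e4, e1, e2, e3]
    gcongr
    nlinarith [sq_nonneg (Real.exp (b * (X ω ^ 2 - 1) - α) - Real.exp (2 * u * X ω - δ))]
  calc _ ≤ _ := lintegral_mono key
    _ ≤ ENNReal.ofReal (Real.exp (b + α + δ) * Real.exp (-(2 * α)) / 2) *
        ENNReal.ofReal (Real.exp (2 * α)) +
      ENNReal.ofReal (Real.exp (b + α + δ) * Real.exp (-(2 * δ)) / 2) *
        ENNReal.ofReal (Real.exp (2 * δ)) := by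
        rw [lintegral_add_left (by fun_prop), lintegral_const_mul _ (by fun_prop),
          lintegral_const_mul _ (by fun_prop)]
        gcongr
        · refine h1.trans (le_of_eq ?_)
          congr 2; simp only [α]; ring
        · refine h2.trans (le_of_eq ?_)
          congr 2; simp only [δ]; ring
    _ = ENNReal.ofReal (Real.exp (b + α + δ)) := by
        rw [← ENNReal.ofReal_mul (by positivity), ← ENNReal.ofReal_mul (by positivity),
          ← ENNReal.ofReal_add (by positivity) (by positivity)]
        congr 1
        rw [Real.exp_neg, Real.exp_neg]
        field_simp; ring
    _ ≤ _ := by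
        apply ENNReal.ofReal_le_ofReal
        rw [Real.exp_le_exp]
        have : δ ≤ 96 / c ^ 2 * u ^ 2 := by
          rw [div_mul_eq_mul_div]
          simp only [δ]
          gcongr
        have h4 : α = 96 / c ^ 2 * b ^ 2 := by simp only [α]; ring
        rw [h4]; linarith

theorem exists_quadExpBound {Cξ : ℝ} (hC : 0 < Cξ) : ∃ K : ℝ, 1 ≤ K ∧
    ∀ (Ω : Type*) [MeasurableSpace Ω] (P : Measure Ω) [IsProbabilityMeasure P] (X : Ω → ℝ),
      Measurable X → ∫ ω, X ω ∂P = 0 → variance X P = 1 →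
      (∀ q : ℝ, 1 ≤ q →
        eLpNorm X (ENNReal.ofReal q) P ≤ ENNReal.ofReal (Cξ * q ^ (1 / 2 : ℝ))) →
      QuadExpBound P K X := by
  set c : ℝ := min 1 (1 / (4 * Real.exp 1 * Cξ ^ 2))
  have hc : 0 < c := lt_min one_pos (by positivity)
  have hc1 : c ≤ 1 := min_le_left _ _
  refine ⟨96 / c ^ 2, ?_, fun Ω _ P _ X hX hm hv hq => ?_⟩
  · rw [le_div_iff₀ (by positivity)]; nlinarith
  · refine quadExpBound_of_exp_sq hX hc hc1
      (lintegral_exp_mul_sq_le_two hC hX hq hc.le ?_) hm ?_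
    · have : c ≤ 1 / (4 * Real.exp 1 * Cξ ^ 2) := min_le_right _ _
      rwa [le_div_iff₀ (by positivity), mul_comm] at this
    · rwa [variance_of_integral_eq_zero hX.aemeasurable hm] at hv

/-! ### Conditioning on one innovation -/

theorem ProbabilityTheory.IndepFun.lintegral_eq_lintegral_lintegral {Ω α β : Type*}
    [MeasurableSpace Ω] [MeasurableSpace α] [MeasurableSpace β] {P : Measure Ω}
    [IsProbabilityMeasure P] {X : Ω → α} {Y : Ω → β} (hX : Measurable X) (hY : Measurable Y)
    (h : IndepFun X Y P) {F : α × β → ℝ≥0∞} (hF : Measurable F) :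
    ∫⁻ ω, F (X ω, Y ω) ∂P = ∫⁻ ω, ∫⁻ ω', F (X ω, Y ω') ∂P ∂P := by
  have h1 : ∫⁻ ω, F (X ω, Y ω) ∂P = ∫⁻ z, F z ∂(P.map fun ω => (X ω, Y ω)) :=
    (lintegral_map hF (hX.prodMk hY)).symm
  have : IsProbabilityMeasure (P.map Y) := Measure.isProbabilityMeasure_map hY.aemeasurable
  rw [h1, h.map_prod_eq_prod_map_map hX.aemeasurable hY.aemeasurable,
    lintegral_prod _ hF.aemeasurable, lintegral_map hF.lintegral_prod_right' hX]
  refine lintegral_congr fun ω => ?_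
  exact lintegral_map (f := fun y => F (X ω, y)) (hF.comp measurable_prodMk_left) hY

theorem ProbabilityTheory.iIndepFun.indepFun_sum_smul {Ω ι E : Type*} [MeasurableSpace Ω]
    [NormedAddCommGroup E] [NormedSpace ℝ E] [MeasurableSpace E] [BorelSpace E]
    [SecondCountableTopology E] {P : Measure Ω} {ξ : ι → Ω → ℝ} (hind : iIndepFun ξ P)
    (hm : ∀ α, Measurable (ξ α)) (z : ι → E) {S : Finset ι} {a : ι} (ha : a ∉ S) :
    IndepFun (ξ a) (fun ω => ∑ α ∈ S, ξ α ω • z α) P := by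
  classical
  have h := hind.indepFun_finset {a} S (by simpa using ha) hm
  have hφ : Measurable fun f : (({a} : Finset ι) → ℝ) => f ⟨a, Finset.mem_singleton_self a⟩ :=
    measurable_pi_apply _
  have h' := h.comp (φ := fun f : (({a} : Finset ι) → ℝ) => f ⟨a, Finset.mem_singleton_self a⟩)
    (ψ := fun f : (S → ℝ) => ∑ α : S, f α • z α) hφ (by fun_prop)
  convert h' using 1
  · rfl
  · funext ω
    exact (Finset.sum_coe_sort S fun α => ξ α ω • z α).symm

/-! ### A Hanson–Wright bound by rank-one resolvent updates -/

section Resolvent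

variable {ι E : Type*} [NormedAddCommGroup E] [InnerProductSpace ℝ E]

open scoped InnerProductSpace

/-- For `T = ∑ z_α ⊗ z_α` this is `T² ≤ τ T`, obtained by Cauchy–Schwarz without spectral theory. -/
theorem norm_sq_sum_inner_smul_le {S : Finset ι} {z : ι → E} {τ : ℝ}
    (hz : ∀ v : E, ∑ α ∈ S, ⟪z α, v⟫_ℝ ^ 2 ≤ τ * ‖v‖ ^ 2) (w : E) :
    ‖∑ α ∈ S, ⟪z α, w⟫_ℝ • z α‖ ^ 2 ≤ τ * ∑ α ∈ S, ⟪z α, w⟫_ℝ ^ 2 := by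
  set g := ∑ α ∈ S, ⟪z α, w⟫_ℝ • z α with hg
  have h1 : ‖g‖ ^ 2 = ∑ α ∈ S, ⟪z α, w⟫_ℝ * ⟪z α, g⟫_ℝ := by
    rw [← real_inner_self_eq_norm_sq]
    nth_rewrite 1 [hg]
    rw [sum_inner]
    simp [real_inner_smul_left]
  have h2 := Finset.sum_mul_sq_le_sq_mul_sq S (fun α => ⟪z α, w⟫_ℝ) (fun α => ⟪z α, g⟫_ℝ)
  rw [← h1] at h2
  rcases eq_or_ne g 0 with h0 | h0
  · rw [h0] at h1 ⊢
    have hzw := hz w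
    have hq : 0 ≤ ∑ α ∈ S, ⟪z α, w⟫_ℝ ^ 2 := Finset.sum_nonneg fun _ _ => sq_nonneg _
    rcases eq_or_lt_of_le hq with hq0 | hq0
    · rw [← hq0]; simp
    · have : 0 ≤ τ := by
        by_contra hneg
        nlinarith [sq_nonneg ‖w‖]
      simpa using mul_nonneg this hq
  · have hpos : 0 < ‖g‖ ^ 2 := by positivity
    have h3 : (‖g‖ ^ 2) ^ 2 ≤ (∑ α ∈ S, ⟪z α, w⟫_ℝ ^ 2) * (τ * ‖g‖ ^ 2) :=
      h2.trans (mul_le_mul_of_nonneg_left (hz g) (Finset.sum_nonneg fun _ _ => sq_nonneg _))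
    nlinarith

/-- Here `w = (1 - κT)⁻¹ x`. The smallness of `|κ| τ` lets the error terms in `w = x + κTw` be
absorbed on the left, both in norm and in the form `⟨·, T ·⟩`; the second bound is first order in
`κ` and yields the Frobenius term of the final estimate. -/
theorem inner_resolvent_bounds {S : Finset ι} {z : ι → E} {τ κ : ℝ} (hτ : 0 ≤ τ)
    (hz : ∀ v : E, ∑ α ∈ S, ⟪z α, v⟫_ℝ ^ 2 ≤ τ * ‖v‖ ^ 2) (hκ : |κ| * τ ≤ 1 / 4) {x w : E}
    (hw : w = x + κ • ∑ α ∈ S, ⟪z α, w⟫_ℝ • z α) :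
    |⟪x, w⟫_ℝ| ≤ 2 * ‖x‖ ^ 2 ∧
      |⟪x, w⟫_ℝ - ‖x‖ ^ 2| ≤ |κ| * (2 * ∑ α ∈ S, ⟪z α, x⟫_ℝ ^ 2) := by
  set g := ∑ α ∈ S, ⟪z α, w⟫_ℝ • z α with hg
  have hκ2 : κ ^ 2 * τ ^ 2 ≤ 1 / 16 := by
    have : (|κ| * τ) ^ 2 ≤ (1 / 4) ^ 2 := pow_le_pow_left₀ (by positivity) hκ 2
    rw [mul_pow, sq_abs] at this; linarith
  have hgw : ‖g‖ ^ 2 ≤ τ * ∑ α ∈ S, ⟪z α, w⟫_ℝ ^ 2 := norm_sq_sum_inner_smul_le hz w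
  have hqw := hz w
  have hqg := hz g
  set qw := ∑ α ∈ S, ⟪z α, w⟫_ℝ ^ 2
  set qx := ∑ α ∈ S, ⟪z α, x⟫_ℝ ^ 2
  set qg := ∑ α ∈ S, ⟪z α, g⟫_ℝ ^ 2
  have hqw0 : 0 ≤ qw := Finset.sum_nonneg fun _ _ => sq_nonneg _
  have h1 : qw ≤ 2 * qx + 2 * κ ^ 2 * qg := by
    simp only [qw, qx, qg, Finset.mul_sum, ← Finset.sum_add_distrib]
    refine Finset.sum_le_sum fun α _ => ?_
    have : ⟪z α, w⟫_ℝ = ⟪z α, x⟫_ℝ + κ * ⟪z α, g⟫_ℝ := by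
      conv_lhs => rw [hw]
      rw [inner_add_right, real_inner_smul_right]
    rw [this]
    nlinarith [sq_nonneg (⟪z α, x⟫_ℝ - κ * ⟪z α, g⟫_ℝ)]
  have h2 : κ ^ 2 * qg ≤ 1 / 16 * qw := by
    calc κ ^ 2 * qg ≤ κ ^ 2 * (τ * (τ * qw)) := by gcongr; exact hqg.trans (by gcongr)
      _ = κ ^ 2 * τ ^ 2 * qw := by ring
      _ ≤ _ := by gcongr
  have h3 : ‖w‖ ^ 2 ≤ 2 * ‖x‖ ^ 2 + 2 * κ ^ 2 * ‖g‖ ^ 2 := by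
    have e1 : ‖w‖ ≤ ‖x‖ + |κ| * ‖g‖ := by
      conv_lhs => rw [hw]
      refine (norm_add_le _ _).trans ?_
      rw [norm_smul, Real.norm_eq_abs]
    calc ‖w‖ ^ 2 ≤ (‖x‖ + |κ| * ‖g‖) ^ 2 := by gcongr
      _ ≤ _ := by
        rw [← sq_abs κ]
        nlinarith [sq_nonneg (‖x‖ - |κ| * ‖g‖)]
  have h4 : κ ^ 2 * ‖g‖ ^ 2 ≤ 1 / 16 * ‖w‖ ^ 2 := by
    calc κ ^ 2 * ‖g‖ ^ 2 ≤ κ ^ 2 * (τ * (τ * ‖w‖ ^ 2)) := by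
          gcongr; exact hgw.trans (by gcongr)
      _ = κ ^ 2 * τ ^ 2 * ‖w‖ ^ 2 := by ring
      _ ≤ _ := by gcongr
  refine ⟨?_, ?_⟩
  · have := abs_real_inner_le_norm x w
    nlinarith [sq_nonneg (‖x‖ - ‖w‖)]
  · have e1 : ⟪x, w⟫_ℝ - ‖x‖ ^ 2 = κ * ∑ α ∈ S, ⟪z α, w⟫_ℝ * ⟪z α, x⟫_ℝ := by
      conv_lhs => rw [hw]
      rw [inner_add_right, real_inner_self_eq_norm_sq, real_inner_smul_right, hg, inner_sum]
      simp only [real_inner_smul_right, real_inner_comm x, add_sub_cancel_left]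
    rw [e1, abs_mul]
    gcongr
    calc |∑ α ∈ S, ⟪z α, w⟫_ℝ * ⟪z α, x⟫_ℝ| ≤ ∑ α ∈ S, |⟪z α, w⟫_ℝ * ⟪z α, x⟫_ℝ| :=
          Finset.abs_sum_le_sum_abs _ _
      _ ≤ ∑ α ∈ S, (⟪z α, w⟫_ℝ ^ 2 + ⟪z α, x⟫_ℝ ^ 2) / 2 := by
          refine Finset.sum_le_sum fun α _ => ?_
          rw [abs_mul]
          nlinarith [sq_nonneg (|⟪z α, w⟫_ℝ| - |⟪z α, x⟫_ℝ|), sq_abs ⟪z α, w⟫_ℝ,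
            sq_abs ⟪z α, x⟫_ℝ]
      _ = (qw + qx) / 2 := by rw [← Finset.sum_div, Finset.sum_add_distrib]
      _ ≤ _ := by linarith

variable [MeasurableSpace E] [BorelSpace E] [SecondCountableTopology E]
  {Ω : Type*} [MeasurableSpace Ω] {P : Measure Ω} [IsProbabilityMeasure P]

/-- The shift `v` is what makes the induction close. Conditionally on `ξ_a` the remaining sum is
shifted by `v + ξ_a z_a`, so the inductive bound becomes the exponential of a quadratic polynomial
in `ξ_a`, to which `QuadExpBound` applies. `R` plays the role of `(1 - 2Ks T_S)⁻¹`, with `T_S = ∑_{α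
∈ S} z_α ⊗ z_α`. -/
theorem exists_resolvent_lintegral_exp_norm_sq_le {ξ : ι → Ω → ℝ} {K s τ : ℝ} (hK : 0 < K)
    (hm : ∀ α, Measurable (ξ α)) (hind : iIndepFun ξ P) (hq : ∀ α, QuadExpBound P K (ξ α))
    (z : ι → E) (hτ : 0 ≤ τ) (hs : 8 * K * |s| * τ ≤ 1) (S : Finset ι)
    (hz : ∀ v : E, ∑ α ∈ S, ⟪z α, v⟫_ℝ ^ 2 ≤ τ * ‖v‖ ^ 2) :
    ∃ R : E →ₗ[ℝ] E, (∀ u v, ⟪R u, v⟫_ℝ = ⟪u, R v⟫_ℝ) ∧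
      (∀ v, R v = v + (2 * K * s) • ∑ α ∈ S, ⟪z α, R v⟫_ℝ • z α) ∧
      ∀ v, ∫⁻ ω, ENNReal.ofReal (Real.exp (s * ‖v + ∑ α ∈ S, ξ α ω • z α‖ ^ 2)) ∂P ≤
        ENNReal.ofReal (Real.exp (s * ∑ α ∈ S, ‖z α‖ ^ 2 +
          4 * K * s ^ 2 * ∑ α ∈ S, ∑ β ∈ S, ⟪z α, z β⟫_ℝ ^ 2 + s * ⟪v, R v⟫_ℝ)) := by
  classical
  induction S using Finset.induction_on with
  | empty => exact ⟨LinearMap.id, by simp, by simp, by simp⟩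
  | insert a S ha ih =>
    have hz' : ∀ v : E, ⟪z a, v⟫_ℝ ^ 2 + ∑ α ∈ S, ⟪z α, v⟫_ℝ ^ 2 ≤ τ * ‖v‖ ^ 2 := by
      intro v; have := hz v; rwa [Finset.sum_insert ha] at this
    have hzS : ∀ v : E, ∑ α ∈ S, ⟪z α, v⟫_ℝ ^ 2 ≤ τ * ‖v‖ ^ 2 := fun v => by
      nlinarith [hz' v, sq_nonneg ⟪z a, v⟫_ℝ]
    obtain ⟨R, hsym, hres, hbd⟩ := ih hzS
    set w := R (z a) with hw
    set b := s * ⟪z a, w⟫_ℝ with hb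
    -- Testing `hz'` at `z a` itself gives `‖z a‖⁴ ≤ τ ‖z a‖²`.
    have hzτ : ‖z a‖ ^ 2 ≤ τ := by
      rcases eq_or_ne (z a) 0 with h0 | h0
      · rw [h0]; simpa using hτ
      · have h1 := hz' (z a)
        rw [real_inner_self_eq_norm_sq] at h1
        have h2 : 0 ≤ ∑ α ∈ S, ⟪z α, z a⟫_ℝ ^ 2 := Finset.sum_nonneg fun _ _ => sq_nonneg _
        have h3 : 0 < ‖z a‖ ^ 2 := by positivity
        nlinarith
    obtain ⟨hb1, hb2⟩ := inner_resolvent_bounds (κ := 2 * K * s) hτ hzS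
      (by rw [abs_mul, abs_of_pos (by positivity : 0 < 2 * K)]; linarith) (hres (z a))
    rw [← hw] at hb1 hb2
    set q := ∑ α ∈ S, ⟪z α, z a⟫_ℝ ^ 2 with hqdef
    have hbabs : |b| ≤ 2 * |s| * ‖z a‖ ^ 2 := by
      rw [hb, abs_mul]; nlinarith [abs_nonneg s]
    have hKb : K * |b| ≤ 1 / 4 := by
      have : K * (2 * |s| * ‖z a‖ ^ 2) ≤ K * (2 * |s| * τ) := by gcongr
      nlinarith [mul_le_mul_of_nonneg_left hbabs hK.le]
    have hKb' := abs_le.1 (show |K * b| ≤ 1 / 4 by rwa [abs_mul, abs_of_pos hK])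
    have hden : 0 < 1 - 2 * K * b := by nlinarith
    -- Sherman–Morrison: adding `z_a ⊗ z_a` to `T_S` changes the resolvent by `c w ⊗ w`, and `2Ks
    -- ⟨z_a, w⟩ = 2Kb`.
    set c := 2 * K * s / (1 - 2 * K * b) with hc
    have hcb : c * (1 - 2 * K * b) = 2 * K * s := by rw [hc]; field_simp
    set R' : E →ₗ[ℝ] E := R + c • ((innerₗ E w).smulRight w) with hR'
    have hR'v : ∀ v, R' v = R v + (c * ⟪w, v⟫_ℝ) • w := by
      intro v; simp [hR', smul_smul]
    refine ⟨R', ?_, ?_, ?_⟩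
    · intro u v
      rw [hR'v, hR'v, inner_add_left, inner_add_right, hsym, real_inner_smul_left,
        real_inner_smul_right, real_inner_comm w u]
      ring
    · intro v
      have e1 : ⟪z a, R' v⟫_ℝ = ⟪w, v⟫_ℝ + c * ⟪w, v⟫_ℝ * ⟪z a, w⟫_ℝ := by
        rw [hR'v, inner_add_right, real_inner_smul_right, ← hsym]
      have e2 : ∑ α ∈ S, ⟪z α, R' v⟫_ℝ • z α =
          ∑ α ∈ S, ⟪z α, R v⟫_ℝ • z α + (c * ⟪w, v⟫_ℝ) • ∑ α ∈ S, ⟪z α, w⟫_ℝ • z α := by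
        rw [Finset.smul_sum, ← Finset.sum_add_distrib]
        refine Finset.sum_congr rfl fun α _ => ?_
        rw [hR'v, inner_add_right, real_inner_smul_right, add_smul, mul_smul]
      rw [Finset.sum_insert ha, e1, e2]
      have hv := hres v
      have hwz := hres (z a)
      rw [← hw] at hwz
      set g := ∑ α ∈ S, ⟪z α, R v⟫_ℝ • z α
      set gw := ∑ α ∈ S, ⟪z α, w⟫_ℝ • z α
      have e3 : R' v = v + (2 * K * s) • g + (c * ⟪w, v⟫_ℝ) • (z a + (2 * K * s) • gw) := by
        rw [hR'v, ← hwz, ← hv]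
      have e4 : 2 * K * s * (⟪w, v⟫_ℝ + c * ⟪w, v⟫_ℝ * ⟪z a, w⟫_ℝ) = c * ⟪w, v⟫_ℝ := by
        rw [hb] at hcb; linear_combination (-⟪w, v⟫_ℝ) * hcb
      rw [e3, smul_add, smul_add, smul_add, smul_smul, smul_smul, smul_smul, e4,
        mul_comm (2 * K * s) (c * _)]
      abel
    · intro v
      set u := s * ⟪v, w⟫_ℝ with hu
      set A := s * ∑ α ∈ S, ‖z α‖ ^ 2 +
          4 * K * s ^ 2 * ∑ α ∈ S, ∑ β ∈ S, ⟪z α, z β⟫_ℝ ^ 2 with hA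
      have hmY : Measurable fun ω => ∑ α ∈ S, ξ α ω • z α := by fun_prop
      have hF : Measurable fun p : ℝ × E =>
          ENNReal.ofReal (Real.exp (s * ‖v + p.1 • z a + p.2‖ ^ 2)) := by fun_prop
      calc ∫⁻ ω, ENNReal.ofReal
              (Real.exp (s * ‖v + ∑ α ∈ insert a S, ξ α ω • z α‖ ^ 2)) ∂P
          = ∫⁻ ω, (fun p : ℝ × E => ENNReal.ofReal
              (Real.exp (s * ‖v + p.1 • z a + p.2‖ ^ 2)))
                (ξ a ω, ∑ α ∈ S, ξ α ω • z α) ∂P := by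
            refine lintegral_congr fun ω => ?_
            simp only [Finset.sum_insert ha, add_assoc]
        _ = ∫⁻ ω, ∫⁻ ω', ENNReal.ofReal (Real.exp (s * ‖v + ξ a ω • z a +
              ∑ α ∈ S, ξ α ω' • z α‖ ^ 2)) ∂P ∂P :=
            (hind.indepFun_sum_smul hm z ha).lintegral_eq_lintegral_lintegral (hm a) hmY hF
        _ ≤ ∫⁻ ω, ENNReal.ofReal (Real.exp (A + s * ⟪v, R v⟫_ℝ)) *
              ENNReal.ofReal (Real.exp (b * ξ a ω ^ 2 + 2 * u * ξ a ω)) ∂P := by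
            refine lintegral_mono fun ω => (hbd _).trans (le_of_eq ?_)
            rw [← ENNReal.ofReal_mul (Real.exp_pos _).le, ← Real.exp_add]
            congr 2
            rw [map_add, map_smul, inner_add_left, inner_add_right, inner_add_right,
              real_inner_smul_left, real_inner_smul_left, real_inner_smul_right,
              real_inner_smul_right, ← hw, hb, hu, ← hsym (z a) v, ← hw, real_inner_comm v w]
            ring
        _ = ENNReal.ofReal (Real.exp (A + s * ⟪v, R v⟫_ℝ)) *
              ∫⁻ ω, ENNReal.ofReal (Real.exp (b * ξ a ω ^ 2 + 2 * u * ξ a ω)) ∂P := by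
            have := hm a
            rw [lintegral_const_mul _ (by fun_prop)]
        _ ≤ ENNReal.ofReal (Real.exp (A + s * ⟪v, R v⟫_ℝ)) *
              ENNReal.ofReal (Real.exp (b + K * (b ^ 2 + u ^ 2))) := by
            gcongr
            exact hq a b u (by linarith)
        _ ≤ _ := by
            rw [← ENNReal.ofReal_mul (Real.exp_pos _).le, ← Real.exp_add]
            apply ENNReal.ofReal_le_ofReal
            rw [Real.exp_le_exp]
            have f1 : s * ⟪v, R' v⟫_ℝ = s * ⟪v, R v⟫_ℝ + 2 * K / (1 - 2 * K * b) * u ^ 2 := by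
              rw [hR'v, inner_add_right, real_inner_smul_right, hc, hu, real_inner_comm w v]
              ring
            -- The factor 2 in the resolvent parameter `2Ks` is needed for negative `s`: then `b`
            -- may be negative and the denominator exceeds 1, but it stays below 2.
            have f2 : K * u ^ 2 ≤ 2 * K / (1 - 2 * K * b) * u ^ 2 := by
              gcongr
              rw [le_div_iff₀ hden]
              nlinarith
            have f3 : ∑ α ∈ insert a S, ∑ β ∈ insert a S, ⟪z α, z β⟫_ℝ ^ 2 =
                ∑ α ∈ S, ∑ β ∈ S, ⟪z α, z β⟫_ℝ ^ 2 + 2 * q + ‖z a‖ ^ 4 := by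
              simp only [Finset.sum_insert ha, Finset.sum_add_distrib]
              rw [real_inner_self_eq_norm_sq, hqdef]
              have : ∑ β ∈ S, ⟪z a, z β⟫_ℝ ^ 2 = ∑ β ∈ S, ⟪z β, z a⟫_ℝ ^ 2 :=
                Finset.sum_congr rfl fun β _ => by rw [real_inner_comm]
              rw [this]; ring
            -- The increment of the trace is `‖z a‖²` and that of the Frobenius sum is `2q + ‖z
            -- a‖⁴`. The terms `b` and `K b²` use one `q` and the `‖z a‖⁴`; the second `q` is slack.
            have f4 : b ≤ s * ‖z a‖ ^ 2 + 4 * K * s ^ 2 * q := by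
              have g1 : s * (⟪z a, w⟫_ℝ - ‖z a‖ ^ 2) ≤ |s| * (|2 * K * s| * (2 * q)) := by
                refine (le_abs_self _).trans ?_
                rw [abs_mul]; gcongr
              rw [abs_mul, abs_of_pos (by positivity : 0 < 2 * K)] at g1
              have g2 : |s| * (2 * K * |s| * (2 * q)) = 4 * K * s ^ 2 * q := by
                rw [← sq_abs s]; ring
              rw [g2] at g1
              rw [hb]; linarith
            have f5 : K * b ^ 2 ≤ 4 * K * s ^ 2 * ‖z a‖ ^ 4 := by
              have : b ^ 2 ≤ (2 * |s| * ‖z a‖ ^ 2) ^ 2 := by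
                rw [← sq_abs b]; gcongr
              calc K * b ^ 2 ≤ K * (2 * |s| * ‖z a‖ ^ 2) ^ 2 := by gcongr
                _ = 4 * K * |s| ^ 2 * ‖z a‖ ^ 4 := by ring
                _ = _ := by rw [sq_abs]
            have f6 : 0 ≤ 4 * K * s ^ 2 * q := by
              have : 0 ≤ q := Finset.sum_nonneg fun _ _ => sq_nonneg _
              positivity
            rw [f1, f3, Finset.sum_insert ha, hA]
            nlinarith

/-- A Hanson–Wright type bound on the Laplace transform of `‖∑ ξ_α z_α‖²`. -/
theorem lintegral_exp_norm_sq_le {ξ : ι → Ω → ℝ} {K s τ : ℝ} (hK : 0 < K)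
    (hm : ∀ α, Measurable (ξ α)) (hind : iIndepFun ξ P) (hq : ∀ α, QuadExpBound P K (ξ α))
    (z : ι → E) (hτ : 0 ≤ τ) (hs : 8 * K * |s| * τ ≤ 1) (S : Finset ι)
    (hz : ∀ v : E, ∑ α ∈ S, ⟪z α, v⟫_ℝ ^ 2 ≤ τ * ‖v‖ ^ 2) :
    ∫⁻ ω, ENNReal.ofReal (Real.exp (s * ‖∑ α ∈ S, ξ α ω • z α‖ ^ 2)) ∂P ≤
      ENNReal.ofReal (Real.exp (s * ∑ α ∈ S, ‖z α‖ ^ 2 +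
        4 * K * s ^ 2 * ∑ α ∈ S, ∑ β ∈ S, ⟪z α, z β⟫_ℝ ^ 2)) := by
  obtain ⟨R, -, -, h⟩ := exists_resolvent_lintegral_exp_norm_sq_le hK hm hind hq z hτ hs S hz
  simpa using h 0

end Resolvent

theorem lintegral_exp_sum_le {ι Ω : Type*} [MeasurableSpace Ω] {P : Measure Ω}
    [IsProbabilityMeasure P] {ξ : ι → Ω → ℝ} {K : ℝ} (hK : 0 < K)
    (hm : ∀ α, Measurable (ξ α)) (hind : iIndepFun ξ P) (hq : ∀ α, QuadExpBound P K (ξ α))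
    (c : ι → ℝ) (u : ℝ) (S : Finset ι) :
    ∫⁻ ω, ENNReal.ofReal (Real.exp (u * ∑ α ∈ S, ξ α ω * c α)) ∂P ≤
      ENNReal.ofReal (Real.exp (K * u ^ 2 * ∑ α ∈ S, c α ^ 2)) := by
  classical
  induction S using Finset.induction_on with
  | empty => simp
  | insert a S ha ih =>
    have hI := hind.indepFun_sum_smul hm c ha
    have hma := hm a
    calc _ = ∫⁻ ω, (fun p : ℝ × ℝ => ENNReal.ofReal (Real.exp (u * (p.1 * c a + p.2))))
            (ξ a ω, ∑ α ∈ S, ξ α ω • c α) ∂P := by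
          refine lintegral_congr fun ω => ?_
          simp only [Finset.sum_insert ha, smul_eq_mul]
      _ = ∫⁻ ω, ∫⁻ ω', ENNReal.ofReal
            (Real.exp (u * (ξ a ω * c a + ∑ α ∈ S, ξ α ω' • c α))) ∂P ∂P :=
          hI.lintegral_eq_lintegral_lintegral (F := fun p : ℝ × ℝ => ENNReal.ofReal
            (Real.exp (u * (p.1 * c a + p.2)))) (hm a) (by fun_prop) (by fun_prop)
      _ ≤ ∫⁻ ω, ENNReal.ofReal (Real.exp (0 * ξ a ω ^ 2 + 2 * (u * c a / 2) * ξ a ω)) *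
            ENNReal.ofReal (Real.exp (K * u ^ 2 * ∑ α ∈ S, c α ^ 2)) ∂P := by
          refine lintegral_mono fun ω => ?_
          have : ∀ ω', ENNReal.ofReal
              (Real.exp (u * (ξ a ω * c a + ∑ α ∈ S, ξ α ω' • c α))) =
              ENNReal.ofReal (Real.exp (0 * ξ a ω ^ 2 + 2 * (u * c a / 2) * ξ a ω)) *
                ENNReal.ofReal (Real.exp (u * ∑ α ∈ S, ξ α ω' * c α)) := by
            intro ω'
            rw [← ENNReal.ofReal_mul (Real.exp_pos _).le, ← Real.exp_add]
            simp only [smul_eq_mul]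
            ring_nf
          simp_rw [this]
          rw [lintegral_const_mul _ (by fun_prop)]
          gcongr
      _ = (∫⁻ ω, ENNReal.ofReal (Real.exp (0 * ξ a ω ^ 2 + 2 * (u * c a / 2) * ξ a ω)) ∂P) *
            ENNReal.ofReal (Real.exp (K * u ^ 2 * ∑ α ∈ S, c α ^ 2)) := by
          rw [lintegral_mul_const _ (by fun_prop)]
      _ ≤ ENNReal.ofReal (Real.exp (0 + K * (0 ^ 2 + (u * c a / 2) ^ 2))) *
            ENNReal.ofReal (Real.exp (K * u ^ 2 * ∑ α ∈ S, c α ^ 2)) := by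
          gcongr
          exact hq a 0 _ (by simp)
      _ ≤ _ := by
          rw [← ENNReal.ofReal_mul (Real.exp_pos _).le, ← Real.exp_add]
          apply ENNReal.ofReal_le_ofReal
          rw [Real.exp_le_exp, Finset.sum_insert ha]
          nlinarith [mul_nonneg hK.le (sq_nonneg (u * c a))]

/-! ### From coefficient vectors to the Gram matrix over time -/

section Gram

variable {ι I : Type*} [Fintype I]

theorem sum_sq_sum_mul_eq_gram (S : Finset ι) (z : ι → I → ℝ) (v : I → ℝ) :
    ∑ α ∈ S, (∑ i, z α i * v i) ^ 2 =
      ∑ i, ∑ i', (∑ α ∈ S, z α i * z α i') * (v i * v i') := by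
  simp_rw [sq, Finset.sum_mul_sum, Finset.sum_mul]
  rw [Finset.sum_comm]
  refine Finset.sum_congr rfl fun i _ => ?_
  rw [Finset.sum_comm]
  refine Finset.sum_congr rfl fun i' _ => Finset.sum_congr rfl fun α _ => ?_
  ring

theorem sum_sum_sq_eq_gram_sq (S : Finset ι) (z : ι → I → ℝ) :
    ∑ β ∈ S, ∑ α ∈ S, (∑ i, z α i * z β i) ^ 2 =
      ∑ i, ∑ i', (∑ α ∈ S, z α i * z α i') ^ 2 := by
  simp_rw [sum_sq_sum_mul_eq_gram S z]
  rw [Finset.sum_comm]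
  refine Finset.sum_congr rfl fun i _ => ?_
  rw [Finset.sum_comm]
  refine Finset.sum_congr rfl fun i' _ => ?_
  rw [← Finset.mul_sum, sq]

/-- Schur's test: by `2|ab| ≤ a² + b²` the largest absolute row sum dominates the quadratic form of
a symmetric matrix. -/
theorem gram_form_le {Γ : I → I → ℝ} {τ : ℝ} (hsymm : ∀ i i', Γ i i' = Γ i' i)
    (hrow : ∀ i, ∑ i', |Γ i i'| ≤ τ) (v : I → ℝ) :
    ∑ i, ∑ i', Γ i i' * (v i * v i') ≤ τ * ∑ i, v i ^ 2 := by
  have h1 : ∑ i, ∑ i', Γ i i' * (v i * v i') ≤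
      ∑ i, ∑ i', (|Γ i i'| * v i ^ 2 / 2 + |Γ i' i| * v i' ^ 2 / 2) := by
    refine Finset.sum_le_sum fun i _ => Finset.sum_le_sum fun i' _ => ?_
    rw [← hsymm i i']
    have e1 : Γ i i' * (v i * v i') ≤ |Γ i i'| * |v i * v i'| := by
      rw [← abs_mul]; exact le_abs_self _
    have e2 : |v i * v i'| ≤ (v i ^ 2 + v i' ^ 2) / 2 := by
      rw [abs_mul]
      nlinarith [sq_nonneg (|v i| - |v i'|), sq_abs (v i), sq_abs (v i')]
    nlinarith [mul_le_mul_of_nonneg_left e2 (abs_nonneg (Γ i i'))]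
  refine h1.trans ?_
  simp_rw [Finset.sum_add_distrib]
  rw [Finset.sum_comm (f := fun i i' => |Γ i' i| * v i' ^ 2 / 2)]
  rw [← Finset.sum_add_distrib, Finset.mul_sum]
  refine Finset.sum_le_sum fun i _ => ?_
  rw [← Finset.sum_div, ← Finset.sum_mul]
  nlinarith [mul_le_mul_of_nonneg_right (hrow i) (sq_nonneg (v i))]

variable {Ω : Type*} [MeasurableSpace Ω] {P : Measure Ω} [IsProbabilityMeasure P]
  {ξ : ι → Ω → ℝ} {K s τ : ℝ}

theorem lintegral_exp_sum_sq_le (hK : 0 < K)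
    (hm : ∀ α, Measurable (ξ α)) (hind : iIndepFun ξ P) (hq : ∀ α, QuadExpBound P K (ξ α))
    (hτ : 0 ≤ τ) (hs : 8 * K * |s| * τ ≤ 1) (S : Finset ι) (z : ι → I → ℝ)
    (hrow : ∀ i, ∑ i', |∑ α ∈ S, z α i * z α i'| ≤ τ) :
    ∫⁻ ω, ENNReal.ofReal (Real.exp (s * ∑ i, (∑ α ∈ S, z α i * ξ α ω) ^ 2)) ∂P ≤
      ENNReal.ofReal (Real.exp (s * ∑ i, ∑ α ∈ S, z α i ^ 2 +
        4 * K * s ^ 2 * ∑ i, ∑ i', (∑ α ∈ S, z α i * z α i') ^ 2)) := by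
  have hinner : ∀ α (v : EuclideanSpace ℝ I), inner ℝ (WithLp.toLp 2 (z α)) v =
      ∑ i, z α i * v i := by
    intro α v; simp [PiLp.inner_apply, mul_comm]
  have h := lintegral_exp_norm_sq_le (E := EuclideanSpace ℝ I) hK hm hind hq
    (fun α => WithLp.toLp 2 (z α)) hτ hs S (by
      intro v
      simp_rw [hinner]
      rw [sum_sq_sum_mul_eq_gram, EuclideanSpace.real_norm_sq_eq]
      exact gram_form_le (fun i i' => Finset.sum_congr rfl fun α _ => mul_comm _ _) hrow _)
  simp_rw [EuclideanSpace.real_norm_sq_eq, hinner] at h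
  rw [Finset.sum_comm (f := fun α β => (∑ i, z α i * z β i) ^ 2), sum_sum_sq_eq_gram_sq,
    Finset.sum_comm (s := S)] at h
  convert h using 6 with ω
  refine Finset.sum_congr rfl fun i _ => ?_
  simp [mul_comm]

/-- This serves the sample mean. The total is one linear form in the innovations, whose variance
proxy is the quadratic form of the Gram matrix at the all-ones vector, hence at most `|I| τ`; the
Hanson–Wright bound is used in dimension one. -/
theorem lintegral_exp_sq_sum_le (hK : 0 < K)
    (hm : ∀ α, Measurable (ξ α)) (hind : iIndepFun ξ P) (hq : ∀ α, QuadExpBound P K (ξ α))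
    (hs0 : 0 ≤ s) (hτ : 0 ≤ τ) (hs : 8 * K * s * (Fintype.card I * τ) ≤ 1)
    (S : Finset ι) (z : ι → I → ℝ)
    (hrow : ∀ i, ∑ i', |∑ α ∈ S, z α i * z α i'| ≤ τ) :
    ∫⁻ ω, ENNReal.ofReal (Real.exp (s * (∑ i, ∑ α ∈ S, z α i * ξ α ω) ^ 2)) ∂P ≤
      ENNReal.ofReal (Real.exp (1 / K)) := by
  set c : ι → ℝ := fun α => ∑ i, z α i with hc
  set V := Fintype.card I * τ with hV
  have hcV : ∑ α ∈ S, c α ^ 2 ≤ V := by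
    have h1 := sum_sq_sum_mul_eq_gram S z (fun _ => 1)
    have h2 := gram_form_le (Γ := fun i i' => ∑ α ∈ S, z α i * z α i')
      (fun i i' => Finset.sum_congr rfl fun α _ => mul_comm _ _) hrow (fun _ => 1)
    rw [← h1] at h2
    simp only [mul_one, one_pow, Finset.sum_const, Finset.card_univ, nsmul_eq_mul] at h2
    rw [hV, mul_comm]; exact h2
  have hV0 : 0 ≤ V := by positivity
  have h := lintegral_exp_norm_sq_le (E := ℝ) hK hm hind hq c (τ := V) (s := s) hV0
    (by rwa [abs_of_nonneg hs0]) S (by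
      intro v
      have : ∀ α, inner ℝ (c α) v ^ 2 = c α ^ 2 * ‖v‖ ^ 2 := by
        intro α; rw [Real.norm_eq_abs, sq_abs]; simp; ring
      simp_rw [this, ← Finset.sum_mul]
      gcongr)
  have e1 : ∀ ω, (∑ i, ∑ α ∈ S, z α i * ξ α ω) ^ 2 = ‖∑ α ∈ S, ξ α ω • c α‖ ^ 2 := by
    intro ω
    rw [Real.norm_eq_abs, sq_abs, Finset.sum_comm]
    congr 1
    refine Finset.sum_congr rfl fun α _ => ?_
    rw [smul_eq_mul, hc, Finset.mul_sum]
    exact Finset.sum_congr rfl fun i _ => mul_comm _ _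
  simp_rw [e1]
  refine h.trans (ENNReal.ofReal_le_ofReal (Real.exp_le_exp.2 ?_))
  have e2 : ∑ α ∈ S, ‖c α‖ ^ 2 ≤ V := by simpa using hcV
  have e3 : ∑ α ∈ S, ∑ β ∈ S, inner ℝ (c α) (c β) ^ 2 ≤ V ^ 2 := by
    have : ∀ α β, inner ℝ (c α) (c β) ^ 2 = c α ^ 2 * c β ^ 2 := by
      intro α β; simp; ring
    simp_rw [this]
    rw [← Finset.sum_mul_sum, ← sq]
    exact pow_le_pow_left₀ (Finset.sum_nonneg fun _ _ => sq_nonneg _) hcV 2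
  have e4 : s * V ≤ 1 / (8 * K) := by rw [le_div_iff₀ (by positivity)]; linarith
  calc _ ≤ s * V + 4 * K * s ^ 2 * V ^ 2 := by gcongr
    _ = s * V + 4 * K * (s * V) ^ 2 := by ring
    _ ≤ 1 / (8 * K) + 4 * K * (1 / (8 * K)) ^ 2 := by gcongr
    _ = (3 / 16) * (1 / K) := by field_simp; norm_num
    _ ≤ _ := by
      have : 0 < 1 / K := by positivity
      linarith

end Gram

/-! ### Linear processes as limits of finite truncations -/

/-- Fatou's lemma: almost sure convergence is enough, so no `L²` theory of the series is needed. -/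
theorem lintegral_exp_le_of_tendsto {Ω : Type*} [MeasurableSpace Ω] {P : Measure Ω}
    {f : ℕ → Ω → ℝ} {F : Ω → ℝ} {c : ℕ → ℝ} {C : ℝ} (hf : ∀ N, Measurable (f N))
    (hlim : ∀ᵐ ω ∂P, Tendsto (fun N => f N ω) atTop (𝓝 (F ω))) (hc : Tendsto c atTop (𝓝 C))
    (hle : ∀ N, ∫⁻ ω, ENNReal.ofReal (Real.exp (f N ω)) ∂P ≤ ENNReal.ofReal (Real.exp (c N))) :
    ∫⁻ ω, ENNReal.ofReal (Real.exp (F ω)) ∂P ≤ ENNReal.ofReal (Real.exp C) := by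
  have hcont : Continuous fun x : ℝ => ENNReal.ofReal (Real.exp x) :=
    ENNReal.continuous_ofReal.comp Real.continuous_exp
  calc ∫⁻ ω, ENNReal.ofReal (Real.exp (F ω)) ∂P
      = ∫⁻ ω, liminf (fun N => ENNReal.ofReal (Real.exp (f N ω))) atTop ∂P := by
        refine lintegral_congr_ae ?_
        filter_upwards [hlim] with ω hω
        exact ((hcont.tendsto _).comp hω).liminf_eq.symm
    _ ≤ liminf (fun N => ∫⁻ ω, ENNReal.ofReal (Real.exp (f N ω)) ∂P) atTop :=
        lintegral_liminf_le fun N => by have := hf N; fun_prop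
    _ ≤ liminf (fun N => ENNReal.ofReal (Real.exp (c N))) atTop :=
        liminf_le_liminf (Eventually.of_forall hle)
    _ = _ := ((hcont.tendsto _).comp hc).liminf_eq

/-- The lag `h` autocorrelation `∑_m w_m w_{m+h}` of a sequence of weights. -/
def autocorr (w : ℕ → ℝ) (h : ℕ) : ℝ := ∑' m, w m * w (m + h)

theorem summable_autocorr {w : ℕ → ℝ} (hw : Summable fun m => w m ^ 2) (h : ℕ) :
    Summable fun m => w m * w (m + h) := by
  have h2 : Summable fun m => w (m + h) ^ 2 := (summable_nat_add_iff h).2 hw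
  refine Summable.of_norm_bounded (hw.add h2) fun m => ?_
  rw [Real.norm_eq_abs, abs_mul]
  nlinarith [sq_nonneg (|w m| - |w (m + h)|), sq_abs (w m), sq_abs (w (m + h)),
    sq_nonneg (w m), sq_nonneg (w (m + h))]

theorem autocorr_nonneg {w : ℕ → ℝ} (hw0 : ∀ m, 0 ≤ w m) (h : ℕ) : 0 ≤ autocorr w h :=
  tsum_nonneg fun m => mul_nonneg (hw0 m) (hw0 _)

section Truncation

variable {κ : Type*} [Fintype κ]

/-- The coefficient sequence truncated at order `N` and extended by zero to the integers. -/
def truncCoeff (a : ℕ → κ → ℝ) (N : ℕ) (d : ℤ) (k : κ) : ℝ :=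
  if 0 ≤ d ∧ d < N then a d.toNat k else 0

/-- The innovation times that enter the order `N` truncations at the times in `I`. -/
def innovTimes (I : Finset ℤ) (N : ℕ) : Finset ℤ :=
  Finset.image₂ (fun i (m : ℕ) => i - m) I (Finset.range N)

theorem sum_innovTimes_truncCoeff (a : ℕ → κ → ℝ) {I : Finset ℤ} {N : ℕ} {i : ℤ} (hi : i ∈ I)
    (F : ℤ → κ → ℝ) :
    ∑ t ∈ innovTimes I N, ∑ k, truncCoeff a N (i - t) k * F t k =
      ∑ m ∈ Finset.range N, ∑ k, a m k * F (i - m) k := by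
  have h1 : ∀ t ∈ innovTimes I N, ∑ k, truncCoeff a N (i - t) k * F t k =
      if 0 ≤ i - t ∧ i - t < N then ∑ k, a (i - t).toNat k * F t k else 0 := by
    intro t _
    split_ifs with h
    · simp only [truncCoeff, if_pos h]
    · simp only [truncCoeff, if_neg h, zero_mul, Finset.sum_const_zero]
  rw [Finset.sum_congr rfl h1, ← Finset.sum_filter]
  refine Finset.sum_nbij' (fun t => (i - t).toNat) (fun m => i - m) ?_ ?_ ?_ ?_ ?_
  · intro t ht
    simp only [Finset.mem_filter, Finset.mem_range] at ht ⊢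
    omega
  · intro m hm
    simp only [Finset.mem_filter, Finset.mem_range, innovTimes] at hm ⊢
    exact ⟨Finset.mem_image₂.2 ⟨i, hi, m, by simpa using hm, rfl⟩, by omega, by omega⟩
  · intro t ht
    simp only [Finset.mem_filter] at ht
    omega
  · intro m hm; simp
  · intro t ht
    simp only [Finset.mem_filter] at ht
    rw [Int.toNat_of_nonneg ht.2.1, sub_sub_cancel]

variable {a : ℕ → κ → ℝ} {w : ℕ → ℝ} {D : ℝ}

/-- Two times at distance `h` share the innovation entering with orders `m` and `m + h`.
Cauchy–Schwarz in `k` bounds its contribution by `D² w_m w_{m+h}`, and truncation only drops terms,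
so the bound is uniform in `N`. -/
theorem abs_gram_truncCoeff_le_of_le (hw0 : ∀ m, 0 ≤ w m)
    (hw : Summable fun m => w m ^ 2)
    (ha : ∀ m, ∑ k, a m k ^ 2 ≤ (D * w m) ^ 2) {I : Finset ℤ} (N : ℕ) {i i' : ℤ} (hi : i ∈ I)
    (hii : i ≤ i') :
    |∑ t ∈ innovTimes I N, ∑ k, truncCoeff a N (i - t) k * truncCoeff a N (i' - t) k| ≤
      D ^ 2 * autocorr w (i' - i).natAbs := by
  rw [sum_innovTimes_truncCoeff a hi fun t k => truncCoeff a N (i' - t) k]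
  obtain ⟨h, rfl⟩ : ∃ h : ℕ, i' = i + h := ⟨(i' - i).toNat, by omega⟩
  have hd : (i + (h : ℤ) - i).natAbs = h := by omega
  rw [hd]
  have hterm : ∀ m ∈ Finset.range N,
      |∑ k, a m k * truncCoeff a N (i + h - (i - m)) k| ≤ D ^ 2 * (w m * w (m + h)) := by
    intro m _
    have hnn : 0 ≤ D ^ 2 * (w m * w (m + h)) :=
      mul_nonneg (sq_nonneg _) (mul_nonneg (hw0 _) (hw0 _))
    have e : i + (h : ℤ) - (i - m) = ((m + h : ℕ) : ℤ) := by push_cast; ring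
    rw [e]
    by_cases hN : m + h < N
    · have e2 : ∀ k, truncCoeff a N ((m + h : ℕ) : ℤ) k = a (m + h) k := by
        intro k
        rw [truncCoeff, if_pos ⟨by omega, by exact_mod_cast hN⟩, Int.toNat_natCast]
      simp_rw [e2]
      refine abs_le_of_sq_le_sq ?_ hnn
      refine (Finset.sum_mul_sq_le_sq_mul_sq _ _ _).trans ?_
      calc _ ≤ (D * w m) ^ 2 * (D * w (m + h)) ^ 2 :=
            mul_le_mul (ha _) (ha _) (Finset.sum_nonneg fun _ _ => sq_nonneg _) (sq_nonneg _)
        _ = _ := by ring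
    · have e2 : ∀ k, truncCoeff a N ((m + h : ℕ) : ℤ) k = 0 := by
        intro k
        rw [truncCoeff, if_neg]
        rintro ⟨-, h2⟩
        exact hN (by exact_mod_cast h2)
      simpa only [e2, mul_zero, Finset.sum_const_zero, abs_zero] using hnn
  calc _ ≤ ∑ m ∈ Finset.range N, D ^ 2 * (w m * w (m + h)) :=
        (Finset.abs_sum_le_sum_abs _ _).trans (Finset.sum_le_sum hterm)
    _ = D ^ 2 * ∑ m ∈ Finset.range N, w m * w (m + h) := by rw [Finset.mul_sum]
    _ ≤ _ := by
        gcongr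
        exact (summable_autocorr hw h).sum_le_tsum _ fun m _ => mul_nonneg (hw0 _) (hw0 _)

theorem abs_gram_truncCoeff_le (hw0 : ∀ m, 0 ≤ w m)
    (hw : Summable fun m => w m ^ 2)
    (ha : ∀ m, ∑ k, a m k ^ 2 ≤ (D * w m) ^ 2) {I : Finset ℤ} (N : ℕ) {i i' : ℤ} (hi : i ∈ I)
    (hi' : i' ∈ I) :
    |∑ t ∈ innovTimes I N, ∑ k, truncCoeff a N (i - t) k * truncCoeff a N (i' - t) k| ≤
      D ^ 2 * autocorr w (i' - i).natAbs := by
  rcases le_total i i' with h | h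
  · exact abs_gram_truncCoeff_le_of_le hw0 hw ha N hi h
  · have := abs_gram_truncCoeff_le_of_le hw0 hw ha N hi' h
    rw [show (i - i').natAbs = (i' - i).natAbs by omega] at this
    simpa only [mul_comm] using this

theorem sum_truncCoeff_sq {I : Finset ℤ} (N : ℕ) {i : ℤ} (hi : i ∈ I) :
    ∑ t ∈ innovTimes I N, ∑ k, truncCoeff a N (i - t) k ^ 2 =
      ∑ m ∈ Finset.range N, ∑ k, a m k ^ 2 := by
  have h := sum_innovTimes_truncCoeff a (N := N) hi fun t k => truncCoeff a N (i - t) k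
  simp_rw [← sq] at h
  rw [h]
  refine Finset.sum_congr rfl fun m hm => Finset.sum_congr rfl fun k _ => ?_
  rw [truncCoeff, if_pos (by simpa using hm), sq]
  simp

variable {Ω : Type*} [MeasurableSpace Ω] {P : Measure Ω} [IsProbabilityMeasure P]
  {ξ : ℤ → κ → Ω → ℝ} {y : ℤ → Ω → ℝ} {K s τ φ : ℝ}

theorem summable_sq_of_le (hw : Summable fun m => w m ^ 2)
    (ha : ∀ m, ∑ k, a m k ^ 2 ≤ (D * w m) ^ 2) : Summable fun m => ∑ k, a m k ^ 2 :=
  Summable.of_nonneg_of_le (fun _ => Finset.sum_nonneg fun _ _ => sq_nonneg _)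
    (fun m => (ha m).trans_eq (mul_pow _ _ _)) (hw.mul_left (D ^ 2))

theorem lintegral_exp_sum_process_sq_le (hK : 0 < K) (hm : ∀ i k, Measurable (ξ i k))
    (hind : iIndepFun (fun α : ℤ × κ => ξ α.1 α.2) P)
    (hq : ∀ i k, QuadExpBound P K (ξ i k))
    (hw0 : ∀ m, 0 ≤ w m) (hw : Summable fun m => w m ^ 2)
    (ha : ∀ m, ∑ k, a m k ^ 2 ≤ (D * w m) ^ 2)
    (hy : ∀ i, ∀ᵐ ω ∂P, Tendsto (fun N => ∑ m ∈ Finset.range N, ∑ k, a m k * ξ (i - m) k ω)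
      atTop (𝓝 (y i ω)))
    (I : Finset ℤ) (hτ0 : 0 ≤ τ) (hτ : ∀ i ∈ I, ∑ i' ∈ I, autocorr w (i' - i).natAbs ≤ τ)
    (hφ : ∑ i ∈ I, ∑ i' ∈ I, autocorr w (i' - i).natAbs ^ 2 ≤ φ)
    (hs : 8 * K * |s| * (D ^ 2 * τ) ≤ 1) :
    ∫⁻ ω, ENNReal.ofReal (Real.exp (s * ∑ i ∈ I, (y i ω ^ 2 - ∑' m, ∑ k, a m k ^ 2))) ∂P ≤
      ENNReal.ofReal (Real.exp (4 * K * s ^ 2 * (D ^ 4 * φ))) := by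
  set σ := ∑' m, ∑ k, a m k ^ 2 with hσ
  have hsum := summable_sq_of_le hw ha
  refine lintegral_exp_le_of_tendsto
    (f := fun N ω => s * ∑ i ∈ I,
      ((∑ m ∈ Finset.range N, ∑ k, a m k * ξ (i - m) k ω) ^ 2 - σ))
    -- Centring uses the full variance `σ` while the truncated process has only its partial sum; the
    -- second term records this discrepancy and vanishes in the limit.
    (c := fun N => 4 * K * s ^ 2 * (D ^ 4 * φ) +
      s * (I.card * ((∑ m ∈ Finset.range N, ∑ k, a m k ^ 2) - σ)))
    (fun N => by fun_prop) ?_ ?_ fun N => ?_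
  · have : ∀ᵐ ω ∂P, ∀ i, Tendsto
        (fun N => ∑ m ∈ Finset.range N, ∑ k, a m k * ξ (i - m) k ω) atTop (𝓝 (y i ω)) :=
      ae_all_iff.2 hy
    filter_upwards [this] with ω hω
    exact (tendsto_finsetSum _ fun i _ => ((hω i).pow 2).sub_const _).const_mul _
  · have h1 := hsum.hasSum.tendsto_sum_nat
    have h2 := ((h1.sub_const σ).const_mul (I.card : ℝ)).const_mul s
    have h3 := h2.const_add (4 * K * s ^ 2 * (D ^ 4 * φ))
    simpa [← hσ] using h3
  · have hg : ∀ i i' : I, |∑ α ∈ innovTimes I N ×ˢ (Finset.univ : Finset κ),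
        truncCoeff a N (i - α.1) α.2 * truncCoeff a N (i' - α.1) α.2| ≤
        D ^ 2 * autocorr w ((i' : ℤ) - i).natAbs := by
      intro i i'
      rw [Finset.sum_product]
      exact abs_gram_truncCoeff_le hw0 hw ha N i.2 i'.2
    have h := lintegral_exp_sum_sq_le hK (fun α : ℤ × κ => hm α.1 α.2) hind
      (fun α => hq α.1 α.2) (mul_nonneg (sq_nonneg D) hτ0) hs
      (innovTimes I N ×ˢ (Finset.univ : Finset κ))
      (fun α (i : I) => truncCoeff a N (i - α.1) α.2) (by
        intro i
        refine (Finset.sum_le_sum fun i' _ => hg i i').trans ?_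
        rw [← Finset.mul_sum, Finset.sum_coe_sort I (fun i' => autocorr w (i' - i).natAbs)]
        exact mul_le_mul_of_nonneg_left (hτ i i.2) (sq_nonneg D))
    have e1 : ∀ ω, ∑ i : I, (∑ α ∈ innovTimes I N ×ˢ (Finset.univ : Finset κ),
        truncCoeff a N (i - α.1) α.2 * ξ α.1 α.2 ω) ^ 2 =
        ∑ i ∈ I, (∑ m ∈ Finset.range N, ∑ k, a m k * ξ (i - m) k ω) ^ 2 := by
      intro ω
      rw [← Finset.sum_coe_sort I]
      refine Finset.sum_congr rfl fun i _ => ?_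
      rw [Finset.sum_product, sum_innovTimes_truncCoeff a i.2 fun t k => ξ t k ω]
    have e2 : ∑ i : I, ∑ α ∈ innovTimes I N ×ˢ (Finset.univ : Finset κ),
        truncCoeff a N (i - α.1) α.2 ^ 2 =
        I.card * ∑ m ∈ Finset.range N, ∑ k, a m k ^ 2 := by
      have : ∀ i : I, ∑ α ∈ innovTimes I N ×ˢ (Finset.univ : Finset κ),
          truncCoeff a N (i - α.1) α.2 ^ 2 = ∑ m ∈ Finset.range N, ∑ k, a m k ^ 2 := by
        intro i
        rw [Finset.sum_product, sum_truncCoeff_sq N i.2]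
      simp [this]
    have e3 : ∑ i : I, ∑ i' : I, (∑ α ∈ innovTimes I N ×ˢ (Finset.univ : Finset κ),
        truncCoeff a N (i - α.1) α.2 * truncCoeff a N (i' - α.1) α.2) ^ 2 ≤ D ^ 4 * φ := by
      calc _ ≤ ∑ i : I, ∑ i' : I, (D ^ 2 * autocorr w ((i' : ℤ) - i).natAbs) ^ 2 := by
            refine Finset.sum_le_sum fun i _ => Finset.sum_le_sum fun i' _ => ?_
            rw [← sq_abs]
            exact pow_le_pow_left₀ (abs_nonneg _) (hg i i') 2
        _ = D ^ 4 * ∑ i ∈ I, ∑ i' ∈ I, autocorr w (i' - i).natAbs ^ 2 := by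
            rw [← Finset.sum_coe_sort I, Finset.mul_sum]
            refine Finset.sum_congr rfl fun i _ => ?_
            rw [← Finset.sum_coe_sort I, Finset.mul_sum]
            refine Finset.sum_congr rfl fun i' _ => ?_
            ring
        _ ≤ _ := by gcongr
    simp_rw [e1] at h
    rw [e2] at h
    calc _ = ∫⁻ ω, ENNReal.ofReal (Real.exp (-(s * (I.card * σ)))) * ENNReal.ofReal (Real.exp
            (s * ∑ i ∈ I, (∑ m ∈ Finset.range N, ∑ k, a m k * ξ (i - m) k ω) ^ 2)) ∂P := by
          refine lintegral_congr fun ω => ?_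
          rw [← ENNReal.ofReal_mul (Real.exp_pos _).le, ← Real.exp_add]
          congr 2
          rw [Finset.sum_sub_distrib, Finset.sum_const, nsmul_eq_mul]
          ring
      _ ≤ _ := by
          rw [lintegral_const_mul _ (by fun_prop)]
          refine (mul_le_mul_right h _).trans ?_
          rw [← ENNReal.ofReal_mul (Real.exp_pos _).le, ← Real.exp_add]
          apply ENNReal.ofReal_le_ofReal
          rw [Real.exp_le_exp]
          have : 4 * K * s ^ 2 * _ ≤ 4 * K * s ^ 2 * (D ^ 4 * φ) :=
            mul_le_mul_of_nonneg_left e3 (by positivity)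
          linarith

theorem lintegral_exp_sq_sum_process_le (hK : 0 < K) (hm : ∀ i k, Measurable (ξ i k))
    (hind : iIndepFun (fun α : ℤ × κ => ξ α.1 α.2) P)
    (hq : ∀ i k, QuadExpBound P K (ξ i k))
    (hw0 : ∀ m, 0 ≤ w m) (hw : Summable fun m => w m ^ 2)
    (ha : ∀ m, ∑ k, a m k ^ 2 ≤ (D * w m) ^ 2)
    (hy : ∀ i, ∀ᵐ ω ∂P, Tendsto (fun N => ∑ m ∈ Finset.range N, ∑ k, a m k * ξ (i - m) k ω)
      atTop (𝓝 (y i ω)))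
    (I : Finset ℤ) (hτ0 : 0 ≤ τ) (hτ : ∀ i ∈ I, ∑ i' ∈ I, autocorr w (i' - i).natAbs ≤ τ)
    (hs0 : 0 ≤ s) (hs : 8 * K * s * (I.card * (D ^ 2 * τ)) ≤ 1) :
    ∫⁻ ω, ENNReal.ofReal (Real.exp (s * (∑ i ∈ I, y i ω) ^ 2)) ∂P ≤
      ENNReal.ofReal (Real.exp (1 / K)) := by
  refine lintegral_exp_le_of_tendsto
    (f := fun N ω => s * (∑ i ∈ I, ∑ m ∈ Finset.range N, ∑ k, a m k * ξ (i - m) k ω) ^ 2)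
    (c := fun _ => 1 / K) (fun N => by fun_prop) ?_ tendsto_const_nhds fun N => ?_
  · have : ∀ᵐ ω ∂P, ∀ i, Tendsto
        (fun N => ∑ m ∈ Finset.range N, ∑ k, a m k * ξ (i - m) k ω) atTop (𝓝 (y i ω)) :=
      ae_all_iff.2 hy
    filter_upwards [this] with ω hω
    exact ((tendsto_finsetSum _ fun i _ => hω i).pow 2).const_mul _
  · have h := lintegral_exp_sq_sum_le hK (fun α : ℤ × κ => hm α.1 α.2) hind
      (fun α => hq α.1 α.2) hs0 (mul_nonneg (sq_nonneg D) hτ0)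
      (by rwa [Fintype.card_coe])
      (innovTimes I N ×ˢ (Finset.univ : Finset κ))
      (fun α (i : I) => truncCoeff a N (i - α.1) α.2) (by
        intro i
        have hg : ∀ i' : I, |∑ α ∈ innovTimes I N ×ˢ (Finset.univ : Finset κ),
            truncCoeff a N (i - α.1) α.2 * truncCoeff a N (i' - α.1) α.2| ≤
            D ^ 2 * autocorr w ((i' : ℤ) - i).natAbs := by
          intro i'
          rw [Finset.sum_product]
          exact abs_gram_truncCoeff_le hw0 hw ha N i.2 i'.2
        refine (Finset.sum_le_sum fun i' _ => hg i').trans ?_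
        rw [← Finset.mul_sum, Finset.sum_coe_sort I (fun i' => autocorr w (i' - i).natAbs)]
        exact mul_le_mul_of_nonneg_left (hτ i i.2) (sq_nonneg D))
    convert h using 7 with ω
    rw [← Finset.sum_coe_sort I]
    refine Finset.sum_congr rfl fun i _ => ?_
    rw [Finset.sum_product, sum_innovTimes_truncCoeff a i.2 fun t k => ξ t k ω]

theorem lintegral_exp_process_le (hK : 0 < K) (hm : ∀ i k, Measurable (ξ i k))
    (hind : iIndepFun (fun α : ℤ × κ => ξ α.1 α.2) P)
    (hq : ∀ i k, QuadExpBound P K (ξ i k))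
    (hsum : Summable fun m => ∑ k, a m k ^ 2) {i : ℤ}
    (hy : ∀ᵐ ω ∂P, Tendsto (fun N => ∑ m ∈ Finset.range N, ∑ k, a m k * ξ (i - m) k ω)
      atTop (𝓝 (y i ω))) (u : ℝ) :
    ∫⁻ ω, ENNReal.ofReal (Real.exp (u * y i ω)) ∂P ≤
      ENNReal.ofReal (Real.exp (K * u ^ 2 * ∑' m, ∑ k, a m k ^ 2)) := by
  refine lintegral_exp_le_of_tendsto
    (f := fun N ω => u * ∑ m ∈ Finset.range N, ∑ k, a m k * ξ (i - m) k ω)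
    (c := fun N => K * u ^ 2 * ∑ m ∈ Finset.range N, ∑ k, a m k ^ 2) (fun N => by fun_prop)
    ?_ (hsum.hasSum.tendsto_sum_nat.const_mul _) fun N => ?_
  · filter_upwards [hy] with ω hω
    exact hω.const_mul _
  · have h := lintegral_exp_sum_le hK (fun α : ℤ × κ => hm α.1 α.2) hind
      (fun α => hq α.1 α.2) (fun α => truncCoeff a N (i - α.1) α.2) u
      (innovTimes {i} N ×ˢ (Finset.univ : Finset κ))
    rw [Finset.sum_product, sum_truncCoeff_sq N (Finset.mem_singleton_self i)] at h
    convert h using 6 with ω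
    rw [Finset.sum_product, ← sum_innovTimes_truncCoeff a (Finset.mem_singleton_self i)
      fun t k => ξ t k ω]
    exact Finset.sum_congr rfl fun t _ => Finset.sum_congr rfl fun k _ => mul_comm _ _

end Truncation

/-! ### Means read off from Laplace transforms -/

/-- For small `s > 0`, `1 + s E W ≤ E exp (sW) ≤ exp (C s²)` gives `E W ≤ 2Cs`, and `s → 0`. Later
this identifies the mean and variance of the limiting process from its exponential bounds. -/
theorem integrable_and_integral_nonpos_of_lintegral_exp_le {Ω : Type*} [MeasurableSpace Ω]
    {P : Measure Ω} [IsProbabilityMeasure P] {W : Ω → ℝ} (hW : AEMeasurable W P) {c C : ℝ}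
    (hc : 0 < c) (hC : 0 ≤ C)
    (h : ∀ s, |s| ≤ c → ∫⁻ ω, ENNReal.ofReal (Real.exp (s * W ω)) ∂P ≤
      ENNReal.ofReal (Real.exp (C * s ^ 2))) : Integrable W P ∧ ∫ ω, W ω ∂P ≤ 0 := by
  have hint : ∀ s, |s| ≤ c → Integrable (fun ω => Real.exp (s * W ω)) P := by
    intro s hs
    refine ⟨by fun_prop, ?_⟩
    rw [hasFiniteIntegral_iff_ofReal (ae_of_all _ fun ω => (Real.exp_pos _).le)]
    exact (h s hs).trans_lt ENNReal.ofReal_lt_top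
  have hWi : Integrable W P := by
    refine (((hint c (abs_of_pos hc).le).add (hint (-c) (by rw [abs_neg, abs_of_pos hc]))).const_mul
      c⁻¹).mono' hW.aestronglyMeasurable (ae_of_all _ fun ω => ?_)
    rw [Real.norm_eq_abs, inv_mul_eq_div, le_div_iff₀ hc]
    simp only [Pi.add_apply]
    have e1 := Real.add_one_le_exp (c * W ω)
    have e2 := Real.add_one_le_exp (-c * W ω)
    have e3 := Real.exp_pos (c * W ω)
    have e4 := Real.exp_pos (-c * W ω)
    rcases abs_cases (W ω) with ⟨h1, -⟩ | ⟨h1, -⟩ <;> rw [h1] <;> linarith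
  refine ⟨hWi, ?_⟩
  have key : ∀ s, 0 < s → s ≤ c → C * s ^ 2 ≤ 1 → ∫ ω, W ω ∂P ≤ 2 * C * s := by
    intro s hs hsc hs1
    have hs' : |s| ≤ c := by rwa [abs_of_pos hs]
    have e1 : ∫ ω, (1 + s * W ω) ∂P ≤ ∫ ω, Real.exp (s * W ω) ∂P :=
      integral_mono ((integrable_const _).add (hWi.const_mul s)) (hint s hs') fun ω => by
        have := Real.add_one_le_exp (s * W ω)
        simp only; linarith
    rw [integral_add (integrable_const _) (hWi.const_mul s), integral_const_mul] at e1
    have e2 : ∫ ω, Real.exp (s * W ω) ∂P ≤ Real.exp (C * s ^ 2) := by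
      rw [integral_eq_lintegral_of_nonneg_ae (ae_of_all _ fun ω => (Real.exp_pos _).le)
        (hint s hs').1]
      exact ENNReal.toReal_le_of_le_ofReal (Real.exp_pos _).le (h s hs')
    have h0 : 0 ≤ C * s ^ 2 := by positivity
    have e3 := (abs_le.1 (Real.abs_exp_sub_one_sub_id_le
      (show |C * s ^ 2| ≤ 1 by rwa [abs_of_nonneg h0]))).2
    simp only [integral_const, probReal_univ, smul_eq_mul, mul_one] at e1
    have e4 : s * ∫ ω, W ω ∂P ≤ s * (2 * C * s) := by nlinarith
    exact le_of_mul_le_mul_left e4 hs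
  by_contra! hm
  set m := ∫ ω, W ω ∂P
  -- The second entry ensures `C s² ≤ 1`, the third `2Cs < m`, which contradicts `key`.
  set s := min c (min (1 / (C + 1)) (m / (4 * (C + 1)))) with hs
  have hs0 : 0 < s := by positivity
  have hs1 : s ≤ 1 / (C + 1) := (min_le_right _ _).trans (min_le_left _ _)
  have hs2 : s ≤ m / (4 * (C + 1)) := (min_le_right _ _).trans (min_le_right _ _)
  rw [le_div_iff₀ (by positivity)] at hs1 hs2
  have := key s hs0 (min_le_left _ _) (by nlinarith)
  nlinarith

theorem integrable_and_integral_eq_zero_of_lintegral_exp_le {Ω : Type*} [MeasurableSpace Ω]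
    {P : Measure Ω} [IsProbabilityMeasure P] {W : Ω → ℝ} (hW : AEMeasurable W P) {c C : ℝ}
    (hc : 0 < c) (hC : 0 ≤ C)
    (h : ∀ s, |s| ≤ c → ∫⁻ ω, ENNReal.ofReal (Real.exp (s * W ω)) ∂P ≤
      ENNReal.ofReal (Real.exp (C * s ^ 2))) : Integrable W P ∧ ∫ ω, W ω ∂P = 0 := by
  obtain ⟨h1, h2⟩ := integrable_and_integral_nonpos_of_lintegral_exp_le hW hc hC h
  obtain ⟨-, h3⟩ := integrable_and_integral_nonpos_of_lintegral_exp_le (W := fun ω => - W ω)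
    hW.neg hc hC fun s hs => by
      have := h (-s) (by rwa [abs_neg])
      simpa using this
  rw [integral_neg] at h3
  exact ⟨h1, by linarith⟩

/-! ### Power weights and their autocorrelations -/

section PowerSums

/-- The weights `(1 ∨ m)^{-β}`. -/
def powWeight (β : ℝ) (m : ℕ) : ℝ := (max 1 (m : ℝ)) ^ (-β)

theorem powWeight_pos (β : ℝ) (m : ℕ) : 0 < powWeight β m := by unfold powWeight; positivity

theorem powWeight_of_one_le (β : ℝ) {m : ℕ} (hm : 1 ≤ m) : powWeight β m = (m : ℝ) ^ (-β) := by
  rw [powWeight, max_eq_right (by exact_mod_cast hm)]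

theorem powWeight_zero (β : ℝ) : powWeight β 0 = 1 := by simp [powWeight]

theorem powWeight_mul (β γ : ℝ) (m : ℕ) :
    powWeight β m * powWeight γ m = powWeight (β + γ) m := by
  rw [powWeight, powWeight, powWeight, ← Real.rpow_add (by positivity)]
  ring_nf

theorem powWeight_sq (β : ℝ) (m : ℕ) : powWeight β m ^ 2 = powWeight (2 * β) m := by
  rw [sq, powWeight_mul]; ring_nf

theorem powWeight_anti {β : ℝ} (hβ : 0 ≤ β) {m m' : ℕ} (h : m ≤ m') :
    powWeight β m' ≤ powWeight β m := by
  unfold powWeight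
  apply Real.rpow_le_rpow_of_nonpos (by positivity) _ (by linarith)
  gcongr

theorem summable_powWeight {β : ℝ} (hβ : 1 < β) : Summable (powWeight β) := by
  rw [← summable_nat_add_iff 1]
  have h := (summable_nat_add_iff 1).2 (Real.summable_nat_rpow.2 (show -β < -1 by linarith))
  refine h.congr fun m => ?_
  rw [powWeight_of_one_le β (by omega)]

/-- Induction on `n`: Bernoulli's inequality for the concave power `1 - a` shows that the right side
grows by at least the new summand `n^{-a}`. -/
theorem sum_range_powWeight_le {a : ℝ} (ha0 : 0 ≤ a) (ha1 : a < 1) {n : ℕ} (hn : 1 ≤ n) :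
    ∑ m ∈ Finset.range n, powWeight a m ≤ 2 / (1 - a) * (n : ℝ) ^ (1 - a) := by
  have h1a : 0 < 1 - a := by linarith
  induction n, hn using Nat.le_induction with
  | base =>
    simp only [Finset.range_one, Finset.sum_singleton, powWeight_zero, Nat.cast_one,
      Real.one_rpow, mul_one]
    rw [le_div_iff₀ h1a]; linarith
  | succ n hn ih =>
    have hn0 : (1 : ℝ) ≤ n := by exact_mod_cast hn
    rw [Finset.sum_range_succ, powWeight_of_one_le a hn]
    have hstep : (n : ℝ) ^ (1 - a) + (1 - a) / 2 * (n : ℝ) ^ (-a) ≤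
        ((n + 1 : ℕ) : ℝ) ^ (1 - a) := by
      push_cast
      have e1 : (n : ℝ) ^ (1 - a) = ((n : ℝ) + 1) ^ (1 - a) *
          (1 + -(1 / ((n : ℝ) + 1))) ^ (1 - a) := by
        rw [← Real.mul_rpow (by positivity)
          (by rw [← sub_eq_add_neg, sub_nonneg, div_le_one (by positivity)]; linarith)]
        congr 1; field_simp; ring
      have e2 : (1 + -(1 / ((n : ℝ) + 1))) ^ (1 - a) ≤ 1 + (1 - a) * -(1 / ((n : ℝ) + 1)) := by
        apply rpow_one_add_le_one_add_mul_self _ h1a.le (by linarith)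
        rw [neg_le_neg_iff, div_le_one (by positivity)]; linarith
      have e3 : (n : ℝ) ^ (-a) ≤ 2 * (((n : ℝ) + 1) ^ (1 - a) * (1 / ((n : ℝ) + 1))) := by
        have f1 : ((n : ℝ) + 1) ^ (1 - a) * (1 / ((n : ℝ) + 1)) = ((n : ℝ) + 1) ^ (-a) := by
          rw [one_div, ← Real.rpow_neg_one ((n : ℝ) + 1), ← Real.rpow_add (by positivity)]
          ring_nf
        rw [f1]
        have f2 : (2 * (n : ℝ)) ^ (-a) ≤ ((n : ℝ) + 1) ^ (-a) :=
          Real.rpow_le_rpow_of_nonpos (by positivity) (by linarith) (by linarith)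
        rw [Real.mul_rpow (by norm_num) (by positivity)] at f2
        have f3 : (2 : ℝ)⁻¹ ≤ (2 : ℝ) ^ (-a) := by
          rw [← Real.rpow_neg_one]
          exact Real.rpow_le_rpow_of_exponent_le (by norm_num) (by linarith)
        have f4 : 0 < (n : ℝ) ^ (-a) := by positivity
        nlinarith
      have e4 : 0 < ((n : ℝ) + 1) ^ (1 - a) := by positivity
      rw [e1]
      nlinarith [mul_le_mul_of_nonneg_left e2 e4.le]
    calc _ ≤ 2 / (1 - a) * (n : ℝ) ^ (1 - a) + (n : ℝ) ^ (-a) := by gcongr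
      _ = 2 / (1 - a) * ((n : ℝ) ^ (1 - a) + (1 - a) / 2 * (n : ℝ) ^ (-a)) := by field_simp
      _ ≤ _ := by gcongr

/-- Each summand is dominated by a multiple of the telescoping difference `n^{1-a} - (n+1)^{1-a}`;
the factor `2^a` pays for replacing `n + 1` by `2n`. -/
theorem sum_Ico_powWeight_le {a : ℝ} (ha : 1 < a) {h : ℕ} (hh : 1 ≤ h) (N : ℕ) :
    ∑ m ∈ Finset.Ico h N, powWeight a m ≤ 2 ^ a / (a - 1) * powWeight (a - 1) h := by
  have ha1 : 0 < a - 1 := by linarith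
  rcases le_or_gt N h with hN | hN
  · rw [Finset.Ico_eq_empty (by omega)]
    have := powWeight_pos (a - 1) h
    simp only [Finset.sum_empty]; positivity
  suffices ∑ m ∈ Finset.Ico h N, powWeight a m ≤
      2 ^ a / (a - 1) * (powWeight (a - 1) h - powWeight (a - 1) N) by
    refine this.trans ?_
    have := powWeight_pos (a - 1) N
    gcongr; linarith
  induction N, hN.le using Nat.le_induction with
  | base => simp
  | succ n hn ih =>
    have hn1 : 1 ≤ n := hh.trans hn
    have hn0 : (1 : ℝ) ≤ n := by exact_mod_cast hn1
    have ih' : ∑ m ∈ Finset.Ico h n, powWeight a m ≤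
        2 ^ a / (a - 1) * (powWeight (a - 1) h - powWeight (a - 1) n) := by
      rcases eq_or_lt_of_le hn with rfl | hlt
      · simp
      · exact ih hlt
    rw [Finset.sum_Ico_succ_top hn]
    have hstep : (a - 1) / 2 ^ a * powWeight a n ≤ powWeight (a - 1) n - powWeight (a - 1) (n + 1) := by
      rw [powWeight_of_one_le _ hn1, powWeight_of_one_le _ hn1, powWeight_of_one_le _ (by omega)]
      push_cast
      set x : ℝ := (n : ℝ) with hx
      have e1 : x ^ (-(a - 1)) = (x + 1) ^ (-(a - 1)) * Real.exp ((a - 1) * Real.log ((x + 1) / x)) := by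
        rw [Real.rpow_def_of_pos (by positivity), Real.rpow_def_of_pos (by positivity),
          ← Real.exp_add, Real.log_div (by positivity) (by positivity)]
        ring_nf
      have e2 : 1 / (x + 1) ≤ Real.log ((x + 1) / x) := by
        have := Real.one_sub_inv_le_log_of_pos (show 0 < (x + 1) / x by positivity)
        refine le_trans (le_of_eq ?_) this
        field_simp; ring
      have e3 : 1 + (a - 1) * (1 / (x + 1)) ≤ Real.exp ((a - 1) * Real.log ((x + 1) / x)) := by
        have := Real.add_one_le_exp ((a - 1) * Real.log ((x + 1) / x))
        nlinarith
      have e4 : (x + 1) ^ (-(a - 1)) * (1 / (x + 1)) = (x + 1) ^ (-a) := by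
        rw [one_div, ← Real.rpow_neg_one (x + 1), ← Real.rpow_add (by positivity)]
        ring_nf
      have e5 : x ^ (-a) / 2 ^ a ≤ (x + 1) ^ (-a) := by
        rw [div_eq_mul_inv, ← Real.rpow_neg (by norm_num), ← Real.mul_rpow (by positivity)
          (by norm_num)]
        exact Real.rpow_le_rpow_of_nonpos (by positivity) (by linarith) (by linarith)
      have e6 : 0 < (x + 1) ^ (-(a - 1)) := by positivity
      have e7 := mul_le_mul_of_nonneg_left e3 e6.le
      rw [← e1] at e7
      have e8 : (a - 1) / 2 ^ a * x ^ (-a) = (a - 1) * (x ^ (-a) / 2 ^ a) := by ring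
      rw [e8]
      nlinarith [mul_le_mul_of_nonneg_left e5 ha1.le]
    have h2a : (0 : ℝ) < 2 ^ a := by positivity
    have : powWeight a n = 2 ^ a / (a - 1) * ((a - 1) / 2 ^ a * powWeight a n) := by field_simp
    rw [this]
    nlinarith [mul_le_mul_of_nonneg_left hstep (show 0 ≤ 2 ^ a / (a - 1) by positivity)]

/-- The sum is split at `m = h`. Below, `w_{m+h} ≤ w_h` and the weights sum to order `h^{1-β}`;
above, `w_{m+h} ≤ w_m` and the squares have a tail of order `h^{1-2β}`. Both parts have order
`h^{1-2β}`. -/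
theorem autocorr_powWeight_le {β : ℝ} (h0 : 1 / 2 < β) (h1 : β < 1) :
    ∃ C : ℝ, 1 ≤ C ∧ ∀ h, autocorr (powWeight β) h ≤ C * powWeight (2 * β - 1) h := by
  set A := 2 / (1 - β)
  set B := 2 ^ (2 * β) / (2 * β - 1)
  have hA : 0 ≤ A := by have : 0 < 1 - β := by linarith
                        positivity
  have hB : 0 ≤ B := by have : 0 < 2 * β - 1 := by linarith
                        positivity
  refine ⟨max 1 (max (A + B) (autocorr (powWeight β) 0)), le_max_left _ _, fun h => ?_⟩
  rcases Nat.eq_zero_or_pos h with rfl | hh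
  · rw [powWeight_zero, mul_one]
    exact (le_max_right _ _).trans (le_max_right _ _)
  refine le_trans ?_ (mul_le_mul_of_nonneg_right ((le_max_left _ _).trans (le_max_right _ _))
    (powWeight_pos _ _).le)
  refine Real.tsum_le_of_sum_range_le
    (fun m => mul_nonneg (powWeight_pos _ _).le (powWeight_pos _ _).le) fun N => ?_
  have hw := fun m => (powWeight_pos β m).le
  calc ∑ m ∈ Finset.range N, powWeight β m * powWeight β (m + h)
      ≤ ∑ m ∈ Finset.range h ∪ Finset.Ico h N, powWeight β m * powWeight β (m + h) := by
        refine Finset.sum_le_sum_of_subset_of_nonneg (fun m hm => ?_)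
          fun m _ _ => mul_nonneg (hw _) (hw _)
        simp only [Finset.mem_union, Finset.mem_range, Finset.mem_Ico] at hm ⊢
        omega
    _ = ∑ m ∈ Finset.range h, powWeight β m * powWeight β (m + h) +
        ∑ m ∈ Finset.Ico h N, powWeight β m * powWeight β (m + h) := by
        refine Finset.sum_union (Finset.disjoint_left.2 fun m hm hm' => ?_)
        simp only [Finset.mem_range, Finset.mem_Ico] at hm hm'
        omega
    _ ≤ ∑ m ∈ Finset.range h, powWeight β m * powWeight β h +
        ∑ m ∈ Finset.Ico h N, powWeight (2 * β) m := by
        gcongr with m _ m _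
        · exact hw m
        · exact powWeight_anti (by linarith) (by omega)
        · rw [← powWeight_sq, sq]
          exact mul_le_mul_of_nonneg_left (powWeight_anti (by linarith) (by omega)) (hw m)
    _ ≤ A * (h : ℝ) ^ (1 - β) * powWeight β h + B * powWeight (2 * β - 1) h := by
        rw [← Finset.sum_mul]
        gcongr
        · exact hw h
        · exact sum_range_powWeight_le (by linarith) h1 hh
        · exact sum_Ico_powWeight_le (by linarith) hh N
    _ = _ := by
        have : (h : ℝ) ^ (1 - β) * powWeight β h = powWeight (2 * β - 1) h := by
          rw [show (h : ℝ) ^ (1 - β) = powWeight (β - 1) h by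
            rw [powWeight_of_one_le _ hh]; ring_nf, powWeight_mul]
          ring_nf
        rw [mul_assoc, this]; ring

/-- After exchanging the sums, each inner sum over lags is part of `∑ w`. -/
theorem sum_autocorr_le_sq_tsum {w : ℕ → ℝ} (hw0 : ∀ m, 0 ≤ w m) (hw : Summable w)
    (hw2 : Summable fun m => w m ^ 2) (n : ℕ) :
    ∑ h ∈ Finset.range n, autocorr w h ≤ (∑' m, w m) ^ 2 := by
  unfold autocorr
  rw [← Summable.tsum_finsetSum fun h _ => summable_autocorr hw2 h]
  simp_rw [← Finset.mul_sum]
  rw [sq, ← tsum_mul_right]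
  have hle : ∀ m, ∑ h ∈ Finset.range n, w (m + h) ≤ ∑' m, w m := by
    intro m
    rw [← Finset.sum_image (g := fun h => m + h) (f := w) (by intro x _ y _; simp)]
    exact hw.sum_le_tsum _ fun i _ => hw0 i
  refine Summable.tsum_le_tsum (fun m => mul_le_mul_of_nonneg_left (hle m) (hw0 m)) ?_
    (hw.mul_right _)
  exact Summable.of_nonneg_of_le
    (fun m => mul_nonneg (hw0 m) (Finset.sum_nonneg fun _ _ => hw0 _))
    (fun m => mul_le_mul_of_nonneg_left (hle m) (hw0 m)) (hw.mul_right _)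

/-- Every distance from `i` is attained at most twice, once on each side, and all distances are
below `n`. -/
theorem sum_Icc_natAbs_sub_le {f : ℕ → ℝ} (hf : ∀ h, 0 ≤ f h) {n : ℕ} {i : ℤ}
    (hi : i ∈ Finset.Icc (1 : ℤ) n) :
    ∑ i' ∈ Finset.Icc (1 : ℤ) n, f (i' - i).natAbs ≤ 2 * ∑ h ∈ Finset.range n, f h := by
  have key : ∀ T ⊆ Finset.Icc (1 : ℤ) n, Set.InjOn (fun i' => (i' - i).natAbs) T →
      ∑ i' ∈ T, f (i' - i).natAbs ≤ ∑ h ∈ Finset.range n, f h := by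
    intro T hT hinj
    rw [← Finset.sum_image (g := fun i' : ℤ => (i' - i).natAbs) (f := f) hinj]
    refine Finset.sum_le_sum_of_subset_of_nonneg (fun h hh => ?_) fun h _ _ => hf h
    obtain ⟨i', hi', rfl⟩ := Finset.mem_image.1 hh
    have := Finset.mem_Icc.1 (hT hi')
    have := Finset.mem_Icc.1 hi
    rw [Finset.mem_range]; omega
  rw [← Finset.sum_filter_add_sum_filter_not _ (fun i' => i ≤ i'), two_mul]
  refine add_le_add (key _ (Finset.filter_subset _ _) ?_) (key _ (Finset.filter_subset _ _) ?_)
  · intro x hx y hy hxy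
    simp only [Finset.coe_filter, Set.mem_ofPred_eq] at hx hy hxy
    omega
  · intro x hx y hy hxy
    simp only [Finset.coe_filter, Set.mem_ofPred_eq] at hx hy hxy
    omega

end PowerSums

/-! ### The Laplace parameter and the rate in the three regimes -/

theorem half_le_log_natCast {p : ℕ} (hp : 2 ≤ p) : 1 / 2 ≤ Real.log p := by
  have h1 : Real.log 2 ≤ Real.log p :=
    Real.log_le_log (by norm_num) (by exact_mod_cast hp)
  linarith [Real.log_two_gt_d9]

theorem log_div_natCast_rpow_eq {β : ℝ} {n p : ℕ} (hn : 1 ≤ n) :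
    n * (Real.log p / (n : ℝ) ^ (2 * β - 1)) = (n : ℝ) ^ (2 - 2 * β) * Real.log p := by
  have hn0 : (0 : ℝ) < n := by exact_mod_cast hn
  have : (n : ℝ) = (n : ℝ) ^ (2 * β - 1) * (n : ℝ) ^ (2 - 2 * β) := by
    rw [← Real.rpow_add hn0]; ring_nf; rw [Real.rpow_one]
  have h2 : 0 < (n : ℝ) ^ (2 * β - 1) := by positivity
  rw [← mul_div_assoc, div_eq_iff h2.ne']
  nth_rewrite 1 [this]
  ring

/-- Twice the sum of the first `n` autocorrelations of the weights `(1 ∨ m)^{-β}`. -/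
def autocorrSum (β : ℝ) (n : ℕ) : ℝ := 2 * ∑ h ∈ Finset.range n, autocorr (powWeight β) h

/-- Twice the sum of the squares of the first `n` autocorrelations of `(1 ∨ m)^{-β}`. -/
def autocorrSqSum (β : ℝ) (n : ℕ) : ℝ := 2 * ∑ h ∈ Finset.range n, autocorr (powWeight β) h ^ 2

theorem autocorr_powWeight_nonneg (β : ℝ) (h : ℕ) : 0 ≤ autocorr (powWeight β) h :=
  autocorr_nonneg (fun m => (powWeight_pos β m).le) h

theorem autocorrSum_nonneg (β : ℝ) (n : ℕ) : 0 ≤ autocorrSum β n :=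
  mul_nonneg zero_le_two (Finset.sum_nonneg fun _ _ => autocorr_powWeight_nonneg _ _)

theorem summable_powWeight_sq {β : ℝ} (hβ : 1 / 2 < β) : Summable fun m => powWeight β m ^ 2 := by
  simp_rw [powWeight_sq]
  exact summable_powWeight (by linarith)

theorem autocorrSum_bounds_of_one_lt {β : ℝ} (hβ : 1 < β) : ∃ B : ℝ, 1 ≤ B ∧ ∀ n : ℕ,
    autocorrSum β n ≤ B ∧ autocorrSqSum β n ≤ B := by
  have hw0 := fun m => (powWeight_pos β m).le
  have hs := summable_powWeight hβ
  have hs2 := summable_powWeight_sq (β := β) (by linarith)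
  set W := ∑' m, powWeight β m
  have hsum := sum_autocorr_le_sq_tsum hw0 hs hs2
  have hone : ∀ h, autocorr (powWeight β) h ≤ W ^ 2 := fun h => by
    refine le_trans ?_ (hsum (h + 1))
    exact Finset.single_le_sum (f := autocorr (powWeight β))
      (fun i _ => autocorr_nonneg hw0 i) (Finset.self_mem_range_succ h)
  refine ⟨1 + 2 * W ^ 2 + 2 * W ^ 2 * W ^ 2, by nlinarith [sq_nonneg W, sq_nonneg (W ^ 2)],
    fun n => ⟨?_, ?_⟩⟩
  · have := hsum n
    unfold autocorrSum
    nlinarith [sq_nonneg W, sq_nonneg (W ^ 2)]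
  · have h1 : ∑ h ∈ Finset.range n, autocorr (powWeight β) h ^ 2 ≤ W ^ 2 * W ^ 2 := by
      calc _ ≤ ∑ h ∈ Finset.range n, W ^ 2 * autocorr (powWeight β) h := by
            refine Finset.sum_le_sum fun h _ => ?_
            rw [sq (autocorr _ _)]
            exact mul_le_mul_of_nonneg_right (hone h) (autocorr_nonneg hw0 h)
        _ ≤ _ := by
            rw [← Finset.mul_sum]
            exact mul_le_mul_of_nonneg_left (hsum n) (sq_nonneg _)
    unfold autocorrSqSum
    nlinarith [sq_nonneg W, sq_nonneg (W ^ 2)]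

theorem autocorrSum_le_of_lt_one {β : ℝ} (h0 : 1 / 2 < β) (h1 : β < 1) :
    ∃ B : ℝ, 1 ≤ B ∧ ∀ n : ℕ, 1 ≤ n → autocorrSum β n ≤ B * (n : ℝ) ^ (2 - 2 * β) := by
  obtain ⟨C, hC, hg⟩ := autocorr_powWeight_le h0 h1
  have hA : 0 < 2 / (1 - (2 * β - 1)) := div_pos two_pos (by linarith)
  set A := 2 / (1 - (2 * β - 1)) with hAdef
  have hA1 : 1 ≤ A := by rw [hAdef, le_div_iff₀ (by linarith)]; linarith
  refine ⟨2 * (C * A), by nlinarith, fun n hn => ?_⟩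
  have h2 := sum_range_powWeight_le (a := 2 * β - 1) (by linarith) (by linarith) hn
  rw [show 1 - (2 * β - 1) = 2 - 2 * β by ring] at h2
  rw [show 1 - (2 * β - 1) = 2 - 2 * β by ring] at hAdef
  rw [← hAdef] at h2
  calc autocorrSum β n ≤ 2 * ∑ h ∈ Finset.range n, C * powWeight (2 * β - 1) h := by
        unfold autocorrSum
        gcongr with h _
        exact hg h
    _ ≤ 2 * (C * (A * (n : ℝ) ^ (2 - 2 * β))) := by
        rw [← Finset.mul_sum]; gcongr
    _ = _ := by ring

theorem sum_autocorr_sq_le {β : ℝ} (h0 : 1 / 2 < β) (h1 : β < 1) : ∃ C : ℝ, 1 ≤ C ∧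
    ∀ n : ℕ, autocorrSqSum β n ≤ C * ∑ h ∈ Finset.range n, powWeight (4 * β - 2) h := by
  obtain ⟨C, hC, hg⟩ := autocorr_powWeight_le h0 h1
  refine ⟨2 * C ^ 2, by nlinarith, fun n => ?_⟩
  unfold autocorrSqSum
  rw [mul_assoc]
  gcongr
  rw [Finset.mul_sum]
  refine Finset.sum_le_sum fun h _ => ?_
  calc autocorr (powWeight β) h ^ 2 ≤ (C * powWeight (2 * β - 1) h) ^ 2 :=
        pow_le_pow_left₀ (autocorr_powWeight_nonneg β h) (hg h) 2
    _ = _ := by rw [mul_pow, powWeight_sq]; ring_nf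

theorem exists_scale_of_sqrt_le {B T φ τ J L n : ℝ} (hB : 1 ≤ B) (hT : 0 < T) (hn : 0 < n)
    (hL : 0 < L) (hτ : τ ≤ B * T) (hφ : φ ≤ B * n)
    (hJ1 : Real.sqrt (L / n) ≤ J) (hJ2 : T * L ≤ n * J) :
    ∃ s : ℝ, 0 < s ∧ s * τ ≤ 1 ∧ 1 / B * L ≤ n * J * s ∧ s ^ 2 * φ ≤ B * L := by
  have hLn : 0 < L / n := by positivity
  have hsq : 0 < Real.sqrt (L / n) := Real.sqrt_pos.2 hLn
  have hBT : 0 < B * T := by positivity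
  -- The first entry is the Gaussian choice and keeps `s² φ` of order `L`; the second is the largest
  -- value allowed by the constraint on `s τ`. Whichever is active, the matching lower bound on `J`
  -- gives `L ≤ B n J s`.
  set s := min (Real.sqrt (L / n)) (1 / (B * T)) with hs
  have hs0 : 0 < s := by positivity
  refine ⟨s, hs0, ?_, ?_, ?_⟩
  · have h1 : s ≤ 1 / (B * T) := min_le_right _ _
    calc s * τ ≤ s * (B * T) := by gcongr
      _ ≤ 1 / (B * T) * (B * T) := by gcongr
      _ = 1 := by field_simp
  · rcases min_choice (Real.sqrt (L / n)) (1 / (B * T)) with h | h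
    · rw [hs, h]
      have h2 : n * (Real.sqrt (L / n) * Real.sqrt (L / n)) = L := by
        rw [Real.mul_self_sqrt hLn.le]; field_simp
      calc 1 / B * L ≤ 1 * L := by
            gcongr
            rw [div_le_one (by linarith)]; exact hB
        _ = n * Real.sqrt (L / n) * Real.sqrt (L / n) := by rw [mul_assoc, h2, one_mul]
        _ ≤ _ := by gcongr
    · rw [hs, h]
      calc 1 / B * L = T * L * (1 / (B * T)) := by field_simp
        _ ≤ _ := by gcongr
  · have h1 : s ^ 2 ≤ L / n := by
      rw [← Real.sq_sqrt hLn.le]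
      exact pow_le_pow_left₀ hs0.le (min_le_left _ _) 2
    calc s ^ 2 * φ ≤ s ^ 2 * (B * n) := by gcongr
      _ ≤ L / n * (B * n) := by gcongr
      _ = B * L := by field_simp

/-- The scale at which the Laplace transform bounds yield deviations of order `rateJ n p β`. -/
theorem exists_scale {β : ℝ} (h0 : 1 / 2 < β) (h34 : β ≠ 3 / 4) (h1 : β ≠ 1) :
    ∃ B : ℝ, 1 ≤ B ∧ ∀ n p : ℕ, 1 ≤ n → 2 ≤ p → rateJ n p β ≤ 1 →
      ∃ s : ℝ, 0 < s ∧ s * autocorrSum β n ≤ 1 ∧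
        1 / B * Real.log p ≤ n * rateJ n p β * s ∧
        s ^ 2 * (n * autocorrSqSum β n) ≤ B * Real.log p := by
  rcases lt_or_gt_of_ne h1 with hlt | hgt
  · have hnot : ¬ 1 < β := by linarith
    obtain ⟨B, hB, hτ⟩ := autocorrSum_le_of_lt_one h0 hlt
    obtain ⟨C, hC, hφ⟩ := sum_autocorr_sq_le h0 hlt
    rcases lt_or_gt_of_ne h34 with h34 | h34
    · have hnot2 : ¬ 3 / 4 < β := by linarith
      set A := 2 / (1 - (4 * β - 2)) with hA
      have hA0 : 0 < A := div_pos two_pos (by linarith)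
      refine ⟨B + 2 * C * A, by nlinarith [mul_pos (show 0 < C by linarith) hA0],
        fun n p hn hp _ => ?_⟩
      have hn0 : (0 : ℝ) < n := by exact_mod_cast hn
      have hL := half_le_log_natCast hp
      set T := (n : ℝ) ^ (2 - 2 * β) with hT
      have hT0 : 0 < T := by positivity
      have hB0 : 0 < B := by linarith
      have hnφ : n * autocorrSqSum β n ≤ C * A * T ^ 2 := by
        have e1 := sum_range_powWeight_le (a := 4 * β - 2) (by linarith) (by linarith) hn
        have e2 : (n : ℝ) * (n : ℝ) ^ (1 - (4 * β - 2)) = T ^ 2 := by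
          rw [hT, ← Real.rpow_natCast, ← Real.rpow_mul hn0.le]
          nth_rewrite 1 [← Real.rpow_one (n : ℝ)]
          rw [← Real.rpow_add hn0]; push_cast; ring_nf
        calc n * autocorrSqSum β n
            ≤ n * (C * (A * (n : ℝ) ^ (1 - (4 * β - 2)))) := by
              gcongr; exact (hφ n).trans (by gcongr)
          _ = C * A * (n * (n : ℝ) ^ (1 - (4 * β - 2))) := by ring
          _ = _ := by rw [e2]
      -- For `β < 3/4` the constraint on `s τ` is always the binding one: `n J = T log p`, while `n
      -- ∑ g²` is only of order `T²`, so `s² n ∑ g²` is bounded and `log p ≥ 1/2` absorbs it.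
      refine ⟨1 / (B * T), by positivity, ?_, ?_, ?_⟩
      · rw [one_div, inv_mul_le_iff₀ (by positivity), mul_one]
        exact hτ n hn
      · rw [rateJ, if_neg hnot, if_neg hnot2, log_div_natCast_rpow_eq hn, ← hT]
        calc 1 / (B + 2 * C * A) * Real.log p ≤ 1 / B * Real.log p := by
              gcongr
              have : 0 ≤ 2 * C * A := by positivity
              linarith
          _ = _ := by field_simp
      · calc (1 / (B * T)) ^ 2 * (n * autocorrSqSum β n)
            ≤ (1 / (B * T)) ^ 2 * (C * A * T ^ 2) := by gcongr
          _ = C * A / B ^ 2 := by field_simp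
          _ ≤ C * A := div_le_self (by positivity) (by nlinarith)
          _ ≤ 2 * C * A * Real.log p := by
              have : 0 < C * A := by positivity
              nlinarith
          _ ≤ _ := by gcongr; linarith
    · have hsum : Summable (powWeight (4 * β - 2)) := summable_powWeight (by linarith)
      set W := ∑' h, powWeight (4 * β - 2) h
      have hW : 0 ≤ W := tsum_nonneg fun h => (powWeight_pos _ h).le
      refine ⟨B + C * W, by nlinarith [mul_nonneg (show 0 ≤ C by linarith) hW],
        fun n p hn hp _ => ?_⟩
      have hn0 : (0 : ℝ) < n := by exact_mod_cast hn
      have hL := half_le_log_natCast hp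
      have hCW : 0 ≤ C * W := by positivity
      have hJ : rateJ n p β =
          max (Real.sqrt (Real.log p / n)) (Real.log p / (n : ℝ) ^ (2 * β - 1)) := by
        rw [rateJ, if_neg hnot, if_pos h34]
      refine exists_scale_of_sqrt_le (T := (n : ℝ) ^ (2 - 2 * β)) (by linarith) (by positivity)
        hn0 (by linarith) ((hτ n hn).trans (by gcongr; linarith)) ?_
        (by rw [hJ]; exact le_max_left _ _) ?_
      · rw [mul_comm]
        gcongr
        calc _ ≤ C * W := by
              refine (hφ n).trans ?_
              gcongr
              exact hsum.sum_le_tsum _ fun i _ => (powWeight_pos _ i).le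
          _ ≤ _ := by linarith
      · rw [← log_div_natCast_rpow_eq hn, hJ]
        gcongr
        exact le_max_right _ _
  · obtain ⟨B, hB, h⟩ := autocorrSum_bounds_of_one_lt hgt
    refine ⟨B, hB, fun n p hn hp hJ1 => ?_⟩
    have hn0 : (0 : ℝ) < n := by exact_mod_cast hn
    have hL := half_le_log_natCast hp
    have hJ : rateJ n p β = Real.sqrt (Real.log p / n) := by rw [rateJ, if_pos hgt]
    refine exists_scale_of_sqrt_le (T := 1) hB one_pos hn0 (by linarith)
      ((h n).1.trans (by linarith)) ?_ hJ.ge ?_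
    · rw [mul_comm]
      gcongr
      exact (h n).2
    · rw [hJ] at hJ1 ⊢
      -- The only place where `rateJ ≤ 1` enters: for `β > 1` the rate has no separate
      -- sub-exponential term, and this hypothesis makes it superfluous.
      have h2 : Real.log p / n ≤ Real.sqrt (Real.log p / n) := by
        have h3 := Real.sq_sqrt (show 0 ≤ Real.log p / n by positivity)
        nlinarith [Real.sqrt_nonneg (Real.log p / n)]
      calc 1 * Real.log p = n * (Real.log p / n) := by field_simp
        _ ≤ _ := by gcongr

/-! ### Vector and matrix norms -/

section Norms

variable {p : ℕ}

theorem vecNorm_one_eq (v : Fin p → ℝ) : vecNorm 1 v = ∑ j, |v j| := by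
  simp [vecNorm, PiLp.norm_eq_of_nat 1]

theorem vecNorm_nonneg (w : ℝ≥0∞) [Fact (1 ≤ w)] (v : Fin p → ℝ) : 0 ≤ vecNorm w v :=
  norm_nonneg _

theorem abs_le_vecNorm_top (v : Fin p → ℝ) (j : Fin p) : |v j| ≤ vecNorm ∞ v := by
  have := PiLp.norm_apply_le (p := ∞) (WithLp.toLp ∞ v) j
  simpa [vecNorm] using this

theorem vecNorm_top_le {v : Fin p → ℝ} {c : ℝ} (hc : 0 ≤ c) (h : ∀ j, |v j| ≤ c) :
    vecNorm ∞ v ≤ c := by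
  rw [vecNorm, PiLp.norm_toLp]
  exact (pi_norm_le_iff_of_nonneg hc).2 h

theorem vecNorm_top_le_one (v : Fin p → ℝ) : vecNorm ∞ v ≤ vecNorm 1 v := by
  rw [vecNorm_one_eq]
  exact vecNorm_top_le (Finset.sum_nonneg fun _ _ => abs_nonneg _) fun j =>
    Finset.single_le_sum (f := fun j => |v j|) (fun _ _ => abs_nonneg _) (Finset.mem_univ j)

theorem toReal_inv_le_one {w : ℝ≥0∞} (hw : 1 ≤ w) : (w⁻¹).toReal ≤ 1 := by
  have : w⁻¹ ≤ 1 := ENNReal.inv_le_one.2 hw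
  exact ENNReal.toReal_le_of_le_ofReal zero_le_one (by simpa using this)

/-- Summing `|v_j|^w ≤ |v_j| c^{w-1}` gives the finite case. At `w = ∞` the exponent `(w⁻¹).toReal`
is `0`, so the bound is `c`. -/
theorem vecNorm_le_interpolation {w : ℝ≥0∞} (hw : 1 ≤ w) {v : Fin p → ℝ} {a c : ℝ} (hc : 0 ≤ c)
    (h1 : vecNorm 1 v ≤ a) (h2 : ∀ j, |v j| ≤ c) :
    vecNorm w v ≤ a ^ (w⁻¹).toReal * c ^ (1 - (w⁻¹).toReal) := by
  rw [vecNorm_one_eq] at h1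
  have ha : 0 ≤ a := (Finset.sum_nonneg fun _ _ => abs_nonneg _).trans h1
  rcases eq_or_ne w ∞ with rfl | hwt
  · simpa using vecNorm_top_le hc h2
  have hw0 : w ≠ 0 := by rintro rfl; simp at hw
  set r := w.toReal with hr
  have hr1 : 1 ≤ r := by
    rw [hr, ← ENNReal.toReal_one]; exact ENNReal.toReal_mono hwt hw
  have hr0 : 0 < r := by linarith
  rw [ENNReal.toReal_inv, ← hr, vecNorm, PiLp.norm_eq_sum (by simpa [← hr] using hr0), ← hr]
  have hsum : ∑ j, |v j| ^ r ≤ a * c ^ (r - 1) := by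
    calc ∑ j, |v j| ^ r ≤ ∑ j, |v j| * c ^ (r - 1) := by
          refine Finset.sum_le_sum fun j _ => ?_
          have : |v j| ^ r = |v j| * |v j| ^ (r - 1) := by
            nth_rewrite 2 [← Real.rpow_one |v j|]
            rw [← Real.rpow_add_of_nonneg (abs_nonneg _) zero_le_one (by linarith)]
            ring_nf
          rw [this]
          gcongr
          exact h2 j
      _ ≤ _ := by rw [← Finset.sum_mul]; gcongr
  calc (∑ j, ‖v j‖ ^ r) ^ (1 / r) ≤ (a * c ^ (r - 1)) ^ (1 / r) := by
        gcongr
        simpa [Real.norm_eq_abs] using hsum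
    _ = _ := by
        rw [Real.mul_rpow ha (by positivity), ← Real.rpow_mul hc, one_div]
        congr 2
        field_simp

theorem sum_abs_le_matL1Norm (M : Matrix (Fin p) (Fin p) ℝ) (k : Fin p) :
    ∑ j, |M j k| ≤ matL1Norm M :=
  le_ciSup (f := fun k => ∑ j, |M j k|) (Set.finite_range _).bddAbove k

theorem matL1Norm_nonneg (M : Matrix (Fin p) (Fin p) ℝ) : 0 ≤ matL1Norm M :=
  Real.iSup_nonneg fun _ => Finset.sum_nonneg fun _ _ => abs_nonneg _

theorem abs_mulVec_le_of_entry_le {M : Matrix (Fin p) (Fin p) ℝ} {c : ℝ}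
    (hM : ∀ j k, |M j k| ≤ c) (v : Fin p → ℝ) (j : Fin p) :
    |(M *ᵥ v) j| ≤ c * vecNorm 1 v := by
  rw [vecNorm_one_eq, Finset.mul_sum]
  change |∑ k, M j k * v k| ≤ _
  refine (Finset.abs_sum_le_sum_abs _ _).trans (Finset.sum_le_sum fun k _ => ?_)
  rw [abs_mul]
  exact mul_le_mul_of_nonneg_right (hM j k) (abs_nonneg _)

theorem abs_mulVec_le_matL1Norm_of_isSymm {M : Matrix (Fin p) (Fin p) ℝ} (hM : M.IsSymm)
    {v : Fin p → ℝ} {c : ℝ} (hv : ∀ k, |v k| ≤ c) (hc : 0 ≤ c) (j : Fin p) :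
    |(M *ᵥ v) j| ≤ matL1Norm M * c := by
  change |∑ k, M j k * v k| ≤ _
  calc |∑ k, M j k * v k| ≤ ∑ k, |M j k * v k| := Finset.abs_sum_le_sum_abs _ _
    _ ≤ ∑ k, |M k j| * c := by
        refine Finset.sum_le_sum fun k _ => ?_
        rw [abs_mul, hM.apply]
        exact mul_le_mul_of_nonneg_left (hv k) (abs_nonneg _)
    _ ≤ _ := by
        rw [← Finset.sum_mul]
        exact mul_le_mul_of_nonneg_right (sum_abs_le_matL1Norm M j) hc

/-- A diagonal entry of `S S⁻¹ = 1` is expanded. This makes `|S⁻¹|_{L¹} lam` at least `|θ|₁` when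
`lam` is large. -/
theorem one_le_matL1Norm_inv_mul {S : Matrix (Fin p) (Fin p) ℝ} (hS : IsUnit S.det) (hp : 1 ≤ p)
    {σ : ℝ} (hσ : ∀ j k, |S j k| ≤ σ) : 1 ≤ matL1Norm S⁻¹ * σ := by
  have k : Fin p := ⟨0, hp⟩
  have h1 : (S * S⁻¹) k k = 1 := by rw [Matrix.mul_nonsing_inv S hS, Matrix.one_apply_eq]
  have hσ0 : 0 ≤ σ := (abs_nonneg _).trans (hσ k k)
  calc (1 : ℝ) = |∑ j, S k j * S⁻¹ j k| := by rw [← Matrix.mul_apply, h1, abs_one]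
    _ ≤ ∑ j, |S k j * S⁻¹ j k| := Finset.abs_sum_le_sum_abs _ _
    _ ≤ ∑ j, |S⁻¹ j k| * σ := by
        refine Finset.sum_le_sum fun j _ => ?_
        rw [abs_mul, mul_comm]
        exact mul_le_mul_of_nonneg_left (hσ k j) (abs_nonneg _)
    _ ≤ _ := by
        rw [← Finset.sum_mul]
        exact mul_le_mul_of_nonneg_right (sum_abs_le_matL1Norm _ k) hσ0

end Norms

/-! ### Deterministic analysis of the Dantzig-type estimator -/

section Dantzig

variable {p : ℕ} {S Sig : Matrix (Fin p) (Fin p) ℝ} {b bhat θ θhat : Fin p → ℝ} {lam : ℝ}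

theorem isClosed_dantzigFeasible (S : Matrix (Fin p) (Fin p) ℝ) (b : Fin p → ℝ) (lam : ℝ) :
    IsClosed (dantzigFeasible S b lam) := by
  have hcont : Continuous fun η : Fin p → ℝ => vecNorm ∞ (S *ᵥ η - b) := by
    unfold vecNorm
    exact continuous_norm.comp ((PiLp.continuous_toLp ∞ _).comp
      ((Continuous.matrix_mulVec continuous_const continuous_id).sub continuous_const))
  exact isClosed_le hcont continuous_const

theorem dantzigArgmin_nonempty (h : (dantzigFeasible S b lam).Nonempty) :
    (dantzigArgmin S b lam).Nonempty := by
  obtain ⟨η₀, hη₀⟩ := h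
  have hcont : Continuous fun η : Fin p → ℝ => vecNorm 1 η := by
    simp_rw [vecNorm_one_eq]; fun_prop
  set B := Metric.closedBall (0 : Fin p → ℝ) (vecNorm 1 η₀)
  have hmem : ∀ η : Fin p → ℝ, vecNorm 1 η ≤ vecNorm 1 η₀ → η ∈ B := by
    intro η hη
    rw [mem_closedBall_zero_iff]
    refine (pi_norm_le_iff_of_nonneg (vecNorm_nonneg 1 η₀)).2 fun j => ?_
    exact ((abs_le_vecNorm_top η j).trans (vecNorm_top_le_one η)).trans hη
  have hK : IsCompact (B ∩ dantzigFeasible S b lam) :=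
    (isCompact_closedBall _ _).inter_right (isClosed_dantzigFeasible S b lam)
  obtain ⟨η, hη, hmin⟩ := hK.exists_isMinOn ⟨η₀, hmem _ le_rfl, hη₀⟩ hcont.continuousOn
  refine ⟨η, hη.2, fun ζ hζ => ?_⟩
  by_cases hζB : vecNorm 1 ζ ≤ vecNorm 1 η₀
  · exact hmin ⟨hmem _ hζB, hζ⟩
  · exact (hmin ⟨hmem _ le_rfl, hη₀⟩ : vecNorm 1 η ≤ vecNorm 1 η₀).trans (not_le.1 hζB).le

/-- An `ℓ¹`-dominated vector that is uniformly close to `θ` is close to `θ` in `ℓ¹`, with the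
error measured by the smallness of `θ`. -/
theorem vecNorm_one_sub_le_smallness {κ : ℝ} (hκ : 0 ≤ κ)
    (h1 : vecNorm 1 θhat ≤ vecNorm 1 θ) (h2 : ∀ j, |θhat j - θ j| ≤ 2 * κ) :
    vecNorm 1 (θhat - θ) ≤ 6 * smallness θ (5 * κ) := by
  rw [vecNorm_one_eq, vecNorm_one_eq] at h1
  rw [vecNorm_one_eq, smallness, Finset.mul_sum]
  have key : ∀ j, |(θhat - θ) j| ≤ |θhat j| - |θ j| + 6 * min |θ j| (5 * κ) := by
    intro j
    have hj := h2 j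
    simp only [Pi.sub_apply]
    have hsub : |θhat j - θ j| ≤ |θhat j| + |θ j| := by
      have := abs_add_le (θhat j) (-θ j)
      rwa [abs_neg, ← sub_eq_add_neg] at this
    have hrev : |θ j| - |θhat j| ≤ |θhat j - θ j| := by
      rw [abs_sub_comm]; exact abs_sub_abs_le_abs_sub _ _
    have h0 := abs_nonneg (θ j)
    -- Small coordinates: `|θhat_j| + |θ_j| = |θhat_j| - |θ_j| + 2|θ_j|`. Large ones: both the error
    -- and the loss `|θ_j| - |θhat_j|` are at most `2κ`, so `4κ` suffices. Summation then removes
    -- `|θhat_j| - |θ_j|` because `|θhat|₁ ≤ |θ|₁`.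
    rcases le_total |θ j| (5 * κ) with h | h
    · rw [min_eq_left h]
      linarith
    · rw [min_eq_right h]
      linarith
  calc _ ≤ ∑ j, (|θhat j| - |θ j| + 6 * min |θ j| (5 * κ)) := Finset.sum_le_sum fun j _ => key j
    _ ≤ _ := by
      rw [Finset.sum_add_distrib, Finset.sum_sub_distrib]
      linarith

theorem dantzigArgmin_error_of_entry_close {ρ ε : ℝ} (hsymm : Sig.IsSymm)
    (hdet : IsUnit Sig.det) (hθ : θ = Sig⁻¹ *ᵥ b) (hρ : 0 ≤ ρ) (hε : 0 ≤ ε)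
    (hb : vecNorm ∞ (bhat - b) ≤ ρ) (hS : ∀ j k, |S j k - Sig j k| ≤ ε)
    (hlam : ρ + ε * vecNorm 1 θ ≤ lam) :
    (dantzigArgmin S bhat lam).Nonempty ∧ ∀ θhat ∈ dantzigArgmin S bhat lam,
      vecNorm 1 (θhat - θ) ≤ 6 * smallness θ (5 * (matL1Norm Sig⁻¹ * lam)) ∧
      ∀ j, |(θhat - θ) j| ≤ 2 * (matL1Norm Sig⁻¹ * lam) := by
  have hθ1 : 0 ≤ vecNorm 1 θ := vecNorm_nonneg 1 θ
  have hlam0 : 0 ≤ lam := by have := mul_nonneg hε hθ1; linarith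
  have hκ : 0 ≤ matL1Norm Sig⁻¹ * lam := mul_nonneg (matL1Norm_nonneg _) hlam0
  have hSigθ : Sig *ᵥ θ = b := by
    rw [hθ, Matrix.mulVec_mulVec, Matrix.mul_nonsing_inv _ hdet, Matrix.one_mulVec]
  have hbj : ∀ j, |bhat j - b j| ≤ ρ := fun j =>
    (abs_le_vecNorm_top (bhat - b) j).trans hb
  have hdiff : ∀ (v : Fin p → ℝ) j, |(S *ᵥ v) j - (Sig *ᵥ v) j| ≤ ε * vecNorm 1 v := by
    intro v j
    have := abs_mulVec_le_of_entry_le (M := S - Sig) hS v j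
    rwa [Matrix.sub_mulVec] at this
  have hfeas : θ ∈ dantzigFeasible S bhat lam := by
    refine vecNorm_top_le hlam0 fun j => ?_
    have h1 := abs_le.1 (hdiff θ j)
    have h2 := abs_le.1 (hbj j)
    rw [hSigθ] at h1
    rw [Pi.sub_apply, abs_le]
    constructor <;> linarith
  refine ⟨dantzigArgmin_nonempty ⟨θ, hfeas⟩, fun θhat hmem => ?_⟩
  have hle : vecNorm 1 θhat ≤ vecNorm 1 θ := hmem.2 θ hfeas
  have hres : ∀ j, |(Sig *ᵥ (θhat - θ)) j| ≤ 2 * lam := by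
    intro j
    have h1 := abs_le.1 ((hdiff θhat j).trans (mul_le_mul_of_nonneg_left hle hε))
    have h2 := abs_le.1 (hbj j)
    have h3 := abs_le.1 ((abs_le_vecNorm_top (S *ᵥ θhat - bhat) j).trans hmem.1)
    rw [Pi.sub_apply] at h3
    rw [Matrix.mulVec_sub, hSigθ, Pi.sub_apply, abs_le]
    constructor <;> linarith
  have hinf : ∀ j, |(θhat - θ) j| ≤ 2 * (matL1Norm Sig⁻¹ * lam) := by
    intro j
    have hsymm' : (Sig⁻¹).IsSymm := by
      rw [Matrix.IsSymm, Matrix.transpose_nonsing_inv, hsymm]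
    have := abs_mulVec_le_matL1Norm_of_isSymm hsymm' hres (by positivity) j
    rw [Matrix.mulVec_mulVec, Matrix.nonsing_inv_mul _ hdet, Matrix.one_mulVec] at this
    linarith
  exact ⟨vecNorm_one_sub_le_smallness hκ hle hinf, hinf⟩

/-- Nothing is assumed about `S`: since `|b|_∞ ≤ σ |θ|₁`, the zero vector is feasible and is the
only minimizer, and `θ` itself is within the claimed error. -/
theorem dantzigArgmin_error_of_large {ρ σ : ℝ} (hp : 1 ≤ p)
    (hdet : IsUnit Sig.det) (hθ : θ = Sig⁻¹ *ᵥ b) (hρ : 0 ≤ ρ)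
    (hb : vecNorm ∞ (bhat - b) ≤ ρ) (hσ : ∀ j k, |Sig j k| ≤ σ)
    (hlam : ρ + σ * vecNorm 1 θ ≤ lam) :
    (dantzigArgmin S bhat lam).Nonempty ∧ ∀ θhat ∈ dantzigArgmin S bhat lam,
      vecNorm 1 (θhat - θ) ≤ 6 * smallness θ (5 * (matL1Norm Sig⁻¹ * lam)) ∧
      ∀ j, |(θhat - θ) j| ≤ 2 * (matL1Norm Sig⁻¹ * lam) := by
  have hθ1 : 0 ≤ vecNorm 1 θ := vecNorm_nonneg 1 θ
  have hσ0 : 0 ≤ σ := (abs_nonneg _).trans (hσ ⟨0, hp⟩ ⟨0, hp⟩)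
  have hlam0 : 0 ≤ lam := by have := mul_nonneg hσ0 hθ1; linarith
  have hSigθ : Sig *ᵥ θ = b := by
    rw [hθ, Matrix.mulVec_mulVec, Matrix.mul_nonsing_inv _ hdet, Matrix.one_mulVec]
  have hfeas : (0 : Fin p → ℝ) ∈ dantzigFeasible S bhat lam := by
    refine vecNorm_top_le hlam0 fun j => ?_
    have h1 := abs_le.1 (abs_mulVec_le_of_entry_le hσ θ j)
    have h2 := abs_le.1 ((abs_le_vecNorm_top (bhat - b) j).trans hb)
    rw [hSigθ] at h1
    rw [Pi.sub_apply] at h2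
    rw [Matrix.mulVec_zero, Pi.sub_apply, Pi.zero_apply, abs_le]
    constructor <;> linarith
  have hκ : vecNorm 1 θ ≤ matL1Norm Sig⁻¹ * lam := by
    calc vecNorm 1 θ ≤ (matL1Norm Sig⁻¹ * σ) * vecNorm 1 θ :=
          le_mul_of_one_le_left hθ1 (one_le_matL1Norm_inv_mul hdet hp hσ)
      _ = matL1Norm Sig⁻¹ * (σ * vecNorm 1 θ) := by ring
      _ ≤ _ := mul_le_mul_of_nonneg_left (by linarith) (matL1Norm_nonneg _)
  refine ⟨dantzigArgmin_nonempty ⟨0, hfeas⟩, fun θhat hmem => ?_⟩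
  have hle := hmem.2 0 hfeas
  have hzero : θhat = 0 := by
    funext j
    have h0 : vecNorm 1 (0 : Fin p → ℝ) = 0 := by simp [vecNorm_one_eq]
    have := (abs_le_vecNorm_top θhat j).trans ((vecNorm_top_le_one θhat).trans (hle.trans h0.le))
    simpa using this
  have hθj : ∀ j, |(θhat - θ) j| ≤ 2 * (matL1Norm Sig⁻¹ * lam) := by
    intro j
    have := (abs_le_vecNorm_top θ j).trans (vecNorm_top_le_one θ)
    rw [hzero, zero_sub, Pi.neg_apply, abs_neg]
    linarith
  refine ⟨vecNorm_one_sub_le_smallness (hθ1.trans hκ) ?_ hθj, hθj⟩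
  rw [hzero]
  simpa [vecNorm_one_eq] using hθ1

theorem vecNorm_one_le_of_mem_sparseClass {r ν M : ℝ} (hr : r < 1)
    (hν : 0 ≤ ν) (hθ : θ ∈ sparseClass r ν M) : vecNorm 1 θ ≤ ν ^ (1 - r) * M := by
  rw [vecNorm_one_eq]
  calc ∑ j, |θ j| ≤ ∑ j, ν ^ (1 - r) * (if θ j = 0 then 0 else |θ j| ^ r) := by
        refine Finset.sum_le_sum fun j _ => ?_
        split_ifs with h
        · simp [h]
        · have h0 : 0 < |θ j| := abs_pos.2 h
          calc |θ j| = |θ j| ^ (1 - r) * |θ j| ^ r := by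
                rw [← Real.rpow_add h0]; simp
            _ ≤ _ := by
                gcongr
                exact hθ.1 j
    _ ≤ _ := by
        rw [← Finset.mul_sum]
        exact mul_le_mul_of_nonneg_left hθ.2 (by positivity)

/-- With `t = |θ_j| ∧ u`, write `t = t^r t^{1-r} ≤ |θ_j|^r u^{1-r}`. Zero coordinates are split off
to respect the convention `0^0 = 0`. -/
theorem smallness_le_of_mem_sparseClass {r ν M u : ℝ} (hr0 : 0 ≤ r) (hr : r < 1) (hu : 0 ≤ u)
    (hθ : θ ∈ sparseClass r ν M) : smallness θ u ≤ M * u ^ (1 - r) := by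
  calc smallness θ u ≤ ∑ j, (if θ j = 0 then 0 else |θ j| ^ r) * u ^ (1 - r) := by
        refine Finset.sum_le_sum fun j _ => ?_
        split_ifs with h
        · simp [h, hu]
        · rcases eq_or_lt_of_le hu with rfl | hu0
          · rw [Real.zero_rpow (by linarith), mul_zero]
            exact min_le_right _ _
          have h0 : 0 < |θ j| := abs_pos.2 h
          have hm : 0 < min |θ j| u := lt_min h0 hu0
          calc min |θ j| u = min |θ j| u ^ r * min |θ j| u ^ (1 - r) := by
                rw [← Real.rpow_add hm]; simp
            _ ≤ _ := by
                gcongr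
                · exact min_le_left _ _
                · exact min_le_right _ _
    _ ≤ _ := by
        rw [← Finset.sum_mul]
        exact mul_le_mul_of_nonneg_right hθ.2 (by positivity)

/-- The constant of the error bound over sparsity classes. -/
def sparseConst (r ν : ℝ) (w : ℝ≥0∞) (C₁ c : ℝ) : ℝ :=
  60 * (1 + |c| + |C₁| * |ν| ^ (1 - r)) ^ (1 - r * (w⁻¹).toReal)

theorem sparseConst_pos (r ν : ℝ) (w : ℝ≥0∞) (C₁ c : ℝ) : 0 < sparseConst r ν w C₁ c := by
  unfold sparseConst; positivity

theorem vecNorm_le_of_mem_sparseClass {r ν M L C₁ c J ρ : ℝ} {w : ℝ≥0∞} (hw : 1 ≤ w)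
    (hr0 : 0 ≤ r) (hr : r < 1) (hν : 0 ≤ ν) (hL : 0 ≤ L) (hJ : 0 ≤ J) (hρ : 0 ≤ ρ) (hc : 0 ≤ c)
    (hC₁ : 0 ≤ C₁) (hM : 0 ≤ M)
    (hθ : θ ∈ sparseClass r ν M) {h : Fin p → ℝ} (hlam : lam = c * ρ + C₁ * ν ^ (1 - r) * M * J)
    (h1 : vecNorm 1 h ≤ 6 * smallness θ (5 * (L * lam))) (h2 : ∀ j, |h j| ≤ 2 * (L * lam)) :
    vecNorm w h ≤ sparseConst r ν w C₁ c * M ^ (w⁻¹).toReal *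
      (L * (M * J + ρ)) ^ (1 - r * (w⁻¹).toReal) := by
  set e := (w⁻¹).toReal with he
  have he0 : 0 ≤ e := ENNReal.toReal_nonneg
  have he1 : e ≤ 1 := toReal_inv_le_one hw
  have hlam0 : 0 ≤ lam := by rw [hlam]; positivity
  set κ := L * lam with hκdef
  have hκ : 0 ≤ κ := mul_nonneg hL hlam0
  have hD : 6 * smallness θ (5 * κ) ≤ 6 * (M * (5 * κ) ^ (1 - r)) := by
    gcongr
    exact smallness_le_of_mem_sparseClass hr0 hr (by positivity) hθ
  have hre : 0 ≤ 1 - r * e := by nlinarith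
  set F := 1 + |c| + |C₁| * |ν| ^ (1 - r) with hF
  have hF1 : 0 ≤ F := by positivity
  have hκF : κ ≤ F * (L * (M * J + ρ)) := by
    have : lam ≤ F * (M * J + ρ) := by
      rw [hlam, hF, abs_of_nonneg hc, abs_of_nonneg hC₁, abs_of_nonneg hν]
      have e1 : 0 ≤ M * J := by positivity
      have e2 : 0 ≤ C₁ * ν ^ (1 - r) := by positivity
      nlinarith [mul_nonneg e2 hρ, mul_nonneg hc e1]
    calc κ ≤ L * (F * (M * J + ρ)) := by rw [hκdef]; gcongr
      _ = _ := by ring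
  -- The numerical factor 60 is `(6 · 5) · 2`, with every exponent at most 1.
  have hconst : (6 * 5 ^ (1 - r) : ℝ) ^ e * 2 ^ (1 - e) ≤ 60 := by
    have e1 : (5 : ℝ) ^ (1 - r) ≤ 5 := by
      calc (5 : ℝ) ^ (1 - r) ≤ 5 ^ (1 : ℝ) :=
            Real.rpow_le_rpow_of_exponent_le (by norm_num) (by linarith)
        _ = 5 := Real.rpow_one _
    have e2 : (6 * 5 ^ (1 - r) : ℝ) ^ e ≤ 30 := by
      calc (6 * 5 ^ (1 - r) : ℝ) ^ e ≤ 30 ^ e := by gcongr; linarith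
        _ ≤ 30 ^ (1 : ℝ) := Real.rpow_le_rpow_of_exponent_le (by norm_num) he1
        _ = 30 := Real.rpow_one _
    have e3 : (2 : ℝ) ^ (1 - e) ≤ 2 := by
      calc (2 : ℝ) ^ (1 - e) ≤ 2 ^ (1 : ℝ) :=
            Real.rpow_le_rpow_of_exponent_le (by norm_num) (by linarith)
        _ = 2 := Real.rpow_one _
    calc _ ≤ (30 : ℝ) * 2 := by gcongr
      _ = 60 := by norm_num
  calc vecNorm w h ≤ (6 * (M * (5 * κ) ^ (1 - r))) ^ e * (2 * κ) ^ (1 - e) :=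
        vecNorm_le_interpolation hw (by positivity) (h1.trans hD) h2
    _ = ((6 * 5 ^ (1 - r)) ^ e * 2 ^ (1 - e)) * M ^ e * κ ^ (1 - r * e) := by
        have e1 : 6 * (M * (5 * κ) ^ (1 - r)) = (6 * 5 ^ (1 - r)) * (M * κ ^ (1 - r)) := by
          rw [Real.mul_rpow (by norm_num) hκ]; ring
        have e2 : κ ^ (1 - r * e) = (κ ^ (1 - r)) ^ e * κ ^ (1 - e) := by
          rw [← Real.rpow_mul hκ, ← Real.rpow_add_of_nonneg hκ
            (mul_nonneg (by linarith) he0) (by linarith)]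
          ring_nf
        rw [e1, e2, Real.mul_rpow (by positivity) (by positivity),
          Real.mul_rpow hM (by positivity), Real.mul_rpow (by norm_num) hκ]
        ring
    _ ≤ 60 * M ^ e * (F * (L * (M * J + ρ))) ^ (1 - r * e) := by gcongr
    _ = _ := by
        rw [Real.mul_rpow hF1 (by positivity), sparseConst]
        ring

end Dantzig

/-! ### Chernoff bounds and moments for scalar linear processes -/

theorem measureReal_ge_le_exp_of_lintegral_exp_le {Ω : Type*} [MeasurableSpace Ω] {P : Measure Ω}
    [IsProbabilityMeasure P] {W : Ω → ℝ} (hW : AEMeasurable W P) {B t : ℝ}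
    (h : ∫⁻ ω, ENNReal.ofReal (Real.exp (W ω)) ∂P ≤ ENNReal.ofReal (Real.exp B)) :
    P.real {ω | t ≤ W ω} ≤ Real.exp (B - t) := by
  have h1 := mul_meas_ge_le_lintegral₀ (μ := P)
    (f := fun ω => ENNReal.ofReal (Real.exp (W ω))) (by fun_prop) (ENNReal.ofReal (Real.exp t))
  have h2 : {ω | ENNReal.ofReal (Real.exp t) ≤ ENNReal.ofReal (Real.exp (W ω))} =
      {ω | t ≤ W ω} := by
    ext ω
    simp [ENNReal.ofReal_le_ofReal_iff (Real.exp_pos _).le]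
  rw [h2] at h1
  have h3 := ENNReal.toReal_le_of_le_ofReal (Real.exp_pos _).le (h1.trans h)
  rw [ENNReal.toReal_mul, ENNReal.toReal_ofReal (Real.exp_pos _).le] at h3
  rw [Real.exp_sub, le_div_iff₀ (Real.exp_pos _), mul_comm]
  exact h3

/-- Independent innovations with a uniform quadratic exponential bound. -/
structure IsQuadExpInnovation {Ω κ : Type*} [MeasurableSpace Ω] (P : Measure Ω) (K : ℝ)
    (ξ : ℤ → κ → Ω → ℝ) : Prop where
  measurable : ∀ i k, Measurable (ξ i k)
  indep : iIndepFun (fun α : ℤ × κ => ξ α.1 α.2) P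
  bound : ∀ i k, QuadExpBound P K (ξ i k)

/-- A centred scalar linear process `y_i = ∑_m ⟨a_m, ξ_{i-m}⟩` with `|a_m| ≤ D (1 ∨ m)^{-β}`. -/
structure IsScalarLinearProcess {Ω κ : Type*} [MeasurableSpace Ω] [Fintype κ] (P : Measure Ω)
    (D β : ℝ) (a : ℕ → κ → ℝ) (ξ : ℤ → κ → Ω → ℝ) (y : ℤ → Ω → ℝ) : Prop where
  coeff_le : ∀ m, ∑ k, a m k ^ 2 ≤ (D * powWeight β m) ^ 2
  tendsto : ∀ i, ∀ᵐ ω ∂P, Tendsto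
    (fun N => ∑ m ∈ Finset.range N, ∑ k, a m k * ξ (i - m) k ω) atTop (𝓝 (y i ω))

section Scalar

variable {Ω κ : Type*} [MeasurableSpace Ω] [Fintype κ] {P : Measure Ω}
  {K D β : ℝ} {a : ℕ → κ → ℝ} {ξ : ℤ → κ → Ω → ℝ} {y : ℤ → Ω → ℝ}

theorem IsScalarLinearProcess.aemeasurable (hξ : IsQuadExpInnovation P K ξ)
    (hy : IsScalarLinearProcess P D β a ξ y) (i : ℤ) : AEMeasurable (y i) P := by
  have := hξ.measurable
  exact aemeasurable_of_tendsto_metrizable_ae atTop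
    (f := fun N ω => ∑ m ∈ Finset.range N, ∑ k, a m k * ξ (i - m) k ω)
    (fun N => by fun_prop) (hy.tendsto i)

theorem IsScalarLinearProcess.tsum_le (hβ : 1 / 2 < β)
    (hy : IsScalarLinearProcess P D β a ξ y) :
    ∑' m, ∑ k, a m k ^ 2 ≤ D ^ 2 * autocorr (powWeight β) 0 := by
  have hw := summable_powWeight_sq hβ
  have h1 : autocorr (powWeight β) 0 = ∑' m, powWeight β m ^ 2 := by
    simp [autocorr, sq]
  rw [h1, ← tsum_mul_left]
  exact Summable.tsum_le_tsum (fun m => (hy.coeff_le m).trans_eq (mul_pow _ _ _))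
    (summable_sq_of_le hw hy.coeff_le) (hw.mul_left _)

variable [IsProbabilityMeasure P]

theorem IsScalarLinearProcess.integral_eq_zero (hβ : 1 / 2 < β) (hK : 0 < K)
    (hξ : IsQuadExpInnovation P K ξ) (hy : IsScalarLinearProcess P D β a ξ y) (i : ℤ) :
    Integrable (y i) P ∧ ∫ ω, y i ω ∂P = 0 := by
  have hsum := summable_sq_of_le (summable_powWeight_sq hβ) hy.coeff_le
  have h0 : 0 ≤ ∑' m, ∑ k, a m k ^ 2 :=
    tsum_nonneg fun _ => Finset.sum_nonneg fun _ _ => sq_nonneg _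
  refine integrable_and_integral_eq_zero_of_lintegral_exp_le (hy.aemeasurable hξ i) one_pos
    (C := K * ∑' m, ∑ k, a m k ^ 2) (by positivity) fun s _ => ?_
  have := lintegral_exp_process_le hK hξ.measurable hξ.indep hξ.bound hsum (hy.tendsto i) s
  rwa [mul_right_comm] at this

/-- The Laplace bound for the sum of squares, used at the single time `i`, forces `y_i² - σ` to have
mean zero. -/
theorem IsScalarLinearProcess.integral_sq (hβ : 1 / 2 < β) (hK : 0 < K)
    (hξ : IsQuadExpInnovation P K ξ) (hy : IsScalarLinearProcess P D β a ξ y) (i : ℤ) :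
    Integrable (fun ω => y i ω ^ 2) P ∧ ∫ ω, y i ω ^ 2 ∂P = ∑' m, ∑ k, a m k ^ 2 := by
  set σ := ∑' m, ∑ k, a m k ^ 2 with hσ
  set g := autocorr (powWeight β) 0
  have hg : 0 ≤ g := autocorr_powWeight_nonneg β 0
  have hmeas := hy.aemeasurable hξ i
  have hden : 0 < 8 * K * (D ^ 2 * g) + 1 := by positivity
  obtain ⟨h1, h2⟩ := integrable_and_integral_eq_zero_of_lintegral_exp_le
    (W := fun ω => y i ω ^ 2 - σ) (P := P) (by fun_prop)
    (c := 1 / (8 * K * (D ^ 2 * g) + 1)) (C := 4 * K * (D ^ 4 * g ^ 2)) (by positivity)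
    (by positivity) fun s hs => by
      have h := lintegral_exp_sum_process_sq_le (s := s) (τ := g) (φ := g ^ 2) hK hξ.measurable
        hξ.indep hξ.bound
        (fun m => (powWeight_pos β m).le) (summable_powWeight_sq hβ) hy.coeff_le hy.tendsto {i}
        hg (by simp [g]) (by simp [g]) (by
          rw [le_div_iff₀ hden] at hs
          nlinarith [abs_nonneg s])
      simp only [Finset.sum_singleton] at h
      refine h.trans_eq ?_
      congr 2; ring
  have h3 : Integrable (fun ω => y i ω ^ 2) P := by
    have := h1.add (integrable_const σ)
    refine this.congr (ae_of_all _ fun ω => ?_)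
    simp
  refine ⟨h3, ?_⟩
  rw [integral_sub h3 (integrable_const σ)] at h2
  simp only [integral_const, probReal_univ, smul_eq_mul, one_mul] at h2
  linarith

theorem IsScalarLinearProcess.measureReal_sum_sq_ge_le (hβ : 1 / 2 < β) (hK : 0 < K)
    (hξ : IsQuadExpInnovation P K ξ) (hy : IsScalarLinearProcess P D β a ξ y) (n : ℕ) {s : ℝ}
    (hs : 8 * K * |s| * (D ^ 2 * autocorrSum β n) ≤ 1) (t : ℝ) :
    P.real {ω | t ≤ s * ∑ i ∈ Finset.Icc (1 : ℤ) n, (y i ω ^ 2 - ∑' m, ∑ k, a m k ^ 2)} ≤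
      Real.exp (4 * K * s ^ 2 * (D ^ 4 * (n * autocorrSqSum β n)) - t) := by
  have hmeas := hy.aemeasurable hξ
  refine measureReal_ge_le_exp_of_lintegral_exp_le (by fun_prop) ?_
  refine lintegral_exp_sum_process_sq_le hK hξ.measurable hξ.indep hξ.bound
    (fun m => (powWeight_pos β m).le) (summable_powWeight_sq hβ) hy.coeff_le hy.tendsto _
    (autocorrSum_nonneg β n) (fun i hi => ?_) ?_ hs
  · exact sum_Icc_natAbs_sub_le (autocorr_powWeight_nonneg β) hi
  · calc _ ≤ ∑ i ∈ Finset.Icc (1 : ℤ) n, autocorrSqSum β n := by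
          refine Finset.sum_le_sum fun i hi => ?_
          exact sum_Icc_natAbs_sub_le (f := fun h => autocorr (powWeight β) h ^ 2)
            (fun _ => sq_nonneg _) hi
      _ = _ := by simp

theorem IsScalarLinearProcess.measureReal_sq_sum_ge_le (hβ : 1 / 2 < β) (hK : 0 < K)
    (hξ : IsQuadExpInnovation P K ξ) (hy : IsScalarLinearProcess P D β a ξ y) (n : ℕ) {s : ℝ}
    (hs0 : 0 ≤ s) (hs : 8 * K * s * (n * (D ^ 2 * autocorrSum β n)) ≤ 1) (t : ℝ) :
    P.real {ω | t ≤ s * (∑ i ∈ Finset.Icc (1 : ℤ) n, y i ω) ^ 2} ≤ Real.exp (1 / K - t) := by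
  have hmeas := hy.aemeasurable hξ
  refine measureReal_ge_le_exp_of_lintegral_exp_le (by fun_prop) ?_
  refine lintegral_exp_sq_sum_process_le hK hξ.measurable hξ.indep hξ.bound
    (fun m => (powWeight_pos β m).le) (summable_powWeight_sq hβ) hy.coeff_le hy.tendsto _
    (autocorrSum_nonneg β n) (fun i hi => ?_) hs0 (by simpa using hs)
  exact sum_Icc_natAbs_sub_le (autocorr_powWeight_nonneg β) hi

/-- Tail bound for the centred sum of squares of a scalar linear process. -/
theorem IsScalarLinearProcess.measureReal_abs_sum_sq_ge_le (hβ : 1 / 2 < β) (hK : 0 < K)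
    (hξ : IsQuadExpInnovation P K ξ) (hy : IsScalarLinearProcess P D β a ξ y) (n : ℕ) {s : ℝ}
    (hs0 : 0 < s) (hs : 8 * K * s * (D ^ 2 * autocorrSum β n) ≤ 1) (t : ℝ) :
    P.real {ω | t ≤ |∑ i ∈ Finset.Icc (1 : ℤ) n, (y i ω ^ 2 - ∑' m, ∑ k, a m k ^ 2)|} ≤
      2 * Real.exp (4 * K * s ^ 2 * (D ^ 4 * (n * autocorrSqSum β n)) - s * t) := by
  have h1 := hy.measureReal_sum_sq_ge_le hβ hK hξ n (s := s) (by rwa [abs_of_pos hs0]) (s * t)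
  have h2 := hy.measureReal_sum_sq_ge_le hβ hK hξ n (s := -s)
    (by rwa [abs_neg, abs_of_pos hs0]) (s * t)
  rw [neg_sq] at h2
  set F : Ω → ℝ := fun ω => ∑ i ∈ Finset.Icc (1 : ℤ) n, (y i ω ^ 2 - ∑' m, ∑ k, a m k ^ 2)
  have hsub : {ω | t ≤ |F ω|} ⊆ {ω | s * t ≤ s * F ω} ∪ {ω | s * t ≤ -s * F ω} := by
    intro ω hω
    rcases le_abs.1 (show t ≤ |F ω| from hω) with h | h
    · exact Or.inl (mul_le_mul_of_nonneg_left h hs0.le)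
    · refine Or.inr ?_
      have := mul_le_mul_of_nonneg_left h hs0.le
      change s * t ≤ -s * F ω
      linarith
  calc _ ≤ P.real ({ω | s * t ≤ s * F ω} ∪ {ω | s * t ≤ -s * F ω}) := measureReal_mono hsub
    _ ≤ _ := measureReal_union_le _ _
    _ ≤ _ := by linarith

end Scalar

/-! ### The vector process and its covariance by polarization -/

section Vector

variable {Ω : Type*} [MeasurableSpace Ω] {P : Measure Ω} {p : ℕ}
  {K C₀ β : ℝ} {μ : Fin p → ℝ} {A : ℕ → Matrix (Fin p) (Fin p) ℝ} {ξ : ℤ → Fin p → Ω → ℝ}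
  {x : ℤ → Ω → Fin p → ℝ}

theorem CoeffDecay.sum_sq_le (hA : CoeffDecay C₀ β A) (m : ℕ) (j : Fin p) :
    ∑ k, A m j k ^ 2 ≤ (C₀ * powWeight β m) ^ 2 := by
  have h0 : 0 ≤ ∑ k, A m j k ^ 2 := Finset.sum_nonneg fun _ _ => sq_nonneg _
  rw [← Real.sq_sqrt h0]
  exact pow_le_pow_left₀ (Real.sqrt_nonneg _) (hA m j) 2

/-- Linear combinations `(x_{ij} - μ_j) + c (x_{ik} - μ_k)` with `c² ≤ 1`. -/
theorem IsVectorLinearProcess.isScalarLinearProcess (hA : CoeffDecay C₀ β A)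
    (hx : IsVectorLinearProcess P μ A ξ x) (j k : Fin p) {c : ℝ} (hc : c ^ 2 ≤ 1) :
    IsScalarLinearProcess P (2 * C₀) β (fun m l => A m j l + c * A m k l) ξ
      (fun i ω => (x i ω j - μ j) + c * (x i ω k - μ k)) where
  coeff_le m := by
    have h1 := hA.sum_sq_le m j
    have h2 := hA.sum_sq_le m k
    calc ∑ l, (A m j l + c * A m k l) ^ 2 ≤ ∑ l, (2 * A m j l ^ 2 + 2 * A m k l ^ 2) := by
          refine Finset.sum_le_sum fun l _ => ?_
          nlinarith [sq_nonneg (A m j l - c * A m k l),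
            mul_le_mul_of_nonneg_right hc (sq_nonneg (A m k l))]
      _ = 2 * ∑ l, A m j l ^ 2 + 2 * ∑ l, A m k l ^ 2 := by
          rw [Finset.sum_add_distrib, Finset.mul_sum, Finset.mul_sum]
      _ ≤ _ := by
          have : (2 * C₀ * powWeight β m) ^ 2 = 4 * (C₀ * powWeight β m) ^ 2 := by ring
          linarith
  tendsto i := by
    filter_upwards [hx i] with ω hω
    have hcoord : ∀ j, Tendsto (fun N => ∑ m ∈ Finset.range N, ∑ l, A m j l * ξ (i - m) l ω)
        atTop (𝓝 (x i ω j - μ j)) := by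
      intro j
      have h := ((tendsto_pi_nhds.1 hω) j).sub_const (μ j)
      refine h.congr fun N => ?_
      simp [Finset.sum_apply, Matrix.mulVec, dotProduct]
    refine ((hcoord j).add ((hcoord k).const_mul c)).congr fun N => ?_
    simp only [Finset.mul_sum, ← Finset.sum_add_distrib]
    refine Finset.sum_congr rfl fun m _ => Finset.sum_congr rfl fun l _ => ?_
    ring

/-- The variance of `(x_{ij} - μ_j) + c (x_{ik} - μ_k)`. -/
def combVariance (A : ℕ → Matrix (Fin p) (Fin p) ℝ) (j k : Fin p) (c : ℝ) : ℝ :=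
  ∑' m, ∑ l, (A m j l + c * A m k l) ^ 2

theorem isSymm_covMatrix (X : Ω → Fin p → ℝ) : (covMatrix P X).IsSymm := by
  ext j k
  simp only [covMatrix, Matrix.transpose_apply, Matrix.of_apply]
  exact covariance_comm _ _

variable [IsProbabilityMeasure P]

theorem covMatrix_apply_eq (hβ : 1 / 2 < β) (hK : 0 < K) (hξ : IsQuadExpInnovation P K ξ)
    (hA : CoeffDecay C₀ β A) (hx : IsVectorLinearProcess P μ A ξ x) (i : ℤ) (j k : Fin p) :
    covMatrix P (x i) j k = (combVariance A j k 1 - combVariance A j k (-1)) / 4 := by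
  have hmean : ∀ j, ∫ ω, x i ω j ∂P = μ j := by
    intro j
    have h := (hx.isScalarLinearProcess hA j j (c := 0) (by norm_num)).integral_eq_zero hβ hK hξ i
    simp only [zero_mul, add_zero] at h
    have h2 : Integrable (fun ω => x i ω j) P := by
      refine (h.1.add (integrable_const (μ j))).congr (ae_of_all _ fun ω => ?_)
      simp
    have h3 := h.2
    rw [integral_sub h2 (integrable_const _)] at h3
    simp only [integral_const, probReal_univ, smul_eq_mul, one_mul] at h3
    linarith
  obtain ⟨i1, e1⟩ := (hx.isScalarLinearProcess hA j k (c := 1) (by norm_num)).integral_sq hβ hK hξ i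
  obtain ⟨i2, e2⟩ :=
    (hx.isScalarLinearProcess hA j k (c := -1) (by norm_num)).integral_sq hβ hK hξ i
  rw [combVariance, combVariance, ← e1, ← e2, ← integral_sub i1 i2, ← integral_div]
  rw [covMatrix, Matrix.of_apply, covariance, hmean, hmean]
  refine integral_congr_ae (ae_of_all _ fun ω => ?_)
  simp only
  ring

theorem abs_covMatrix_apply_le (hβ : 1 / 2 < β) (hK : 0 < K) (hξ : IsQuadExpInnovation P K ξ)
    (hA : CoeffDecay C₀ β A) (hx : IsVectorLinearProcess P μ A ξ x) (i : ℤ) (j k : Fin p) :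
    |covMatrix P (x i) j k| ≤ C₀ ^ 2 * autocorr (powWeight β) 0 := by
  have hle : ∀ c : ℝ, c ^ 2 ≤ 1 →
      0 ≤ combVariance A j k c ∧
        combVariance A j k c ≤ 4 * (C₀ ^ 2 * autocorr (powWeight β) 0) := by
    intro c hc
    refine ⟨tsum_nonneg fun _ => Finset.sum_nonneg fun _ _ => sq_nonneg _, ?_⟩
    refine ((hx.isScalarLinearProcess hA j k hc).tsum_le hβ).trans_eq ?_
    ring
  have h1 := hle 1 (by norm_num)
  have h2 := hle (-1) (by norm_num)
  rw [covMatrix_apply_eq hβ hK hξ hA hx, abs_le]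
  constructor <;> linarith [h1.1, h1.2, h2.1, h2.2]

end Vector

/-! ### Algebra of the sample covariance -/

section SampleCov

variable {p n : ℕ}

theorem sampleCov_apply (c : Fin p → ℝ) (y : ℤ → Fin p → ℝ) (j k : Fin p) :
    sampleCov n c y j k =
      (n : ℝ)⁻¹ * ∑ i ∈ Finset.Icc (1 : ℤ) n, (y i j - c j) * (y i k - c k) := by
  simp [sampleCov, Matrix.sum_apply, Matrix.vecMulVec_apply]

theorem sampleCov_sampleMean_apply (hn : 1 ≤ n) (μ : Fin p → ℝ) (y : ℤ → Fin p → ℝ)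
    (j k : Fin p) :
    sampleCov n (sampleMean n y) y j k = sampleCov n μ y j k -
      ((n : ℝ)⁻¹ * ∑ i ∈ Finset.Icc (1 : ℤ) n, (y i j - μ j)) *
        ((n : ℝ)⁻¹ * ∑ i ∈ Finset.Icc (1 : ℤ) n, (y i k - μ k)) := by
  have hn0 : (n : ℝ) ≠ 0 := by positivity
  have hmean : ∀ j, sampleMean n y j - μ j =
      (n : ℝ)⁻¹ * ∑ i ∈ Finset.Icc (1 : ℤ) n, (y i j - μ j) := by
    intro j
    simp only [sampleMean, Pi.smul_apply, Finset.sum_apply, smul_eq_mul, Finset.sum_sub_distrib,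
      Finset.sum_const, Int.card_Icc, add_sub_cancel_right, Int.toNat_natCast, nsmul_eq_mul]
    field_simp
  rw [sampleCov_apply, sampleCov_apply, ← hmean, ← hmean]
  have hsum : ∀ j, ∑ i ∈ Finset.Icc (1 : ℤ) n, (y i j - μ j) = n * (sampleMean n y j - μ j) := by
    intro j; rw [hmean]; field_simp
  set m := sampleMean n y
  have e : ∀ i, (y i j - m j) * (y i k - m k) = (y i j - μ j) * (y i k - μ k) -
      (m k - μ k) * (y i j - μ j) - (m j - μ j) * (y i k - μ k) + (m j - μ j) * (m k - μ k) := by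
    intro i; ring
  simp_rw [e]
  rw [Finset.sum_add_distrib, Finset.sum_sub_distrib, Finset.sum_sub_distrib, ← Finset.mul_sum,
    ← Finset.mul_sum, hsum, hsum]
  simp only [Finset.sum_const, Int.card_Icc, add_sub_cancel_right, Int.toNat_natCast, nsmul_eq_mul]
  field_simp
  ring

end SampleCov

/-! ### Entrywise concentration of the sample covariance -/

theorem rateJ_nonneg (n p : ℕ) (β : ℝ) : 0 ≤ rateJ n p β := by
  have h : 0 ≤ Real.log p := Real.log_natCast_nonneg p
  unfold rateJ
  split_ifs
  · positivity
  · exact le_max_of_le_left (Real.sqrt_nonneg _)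
  · positivity

/-- The count of the union bound: `p²` pairs with two signs and two tails each, plus `p` sample
means, every event of order `p^{-6}`. -/
theorem four_sq_mul_exp_add_le {p : ℕ} (hp : 2 ≤ p) :
    ((p : ℝ) * p) * (2 * (2 * Real.exp (-6 * Real.log p))) + p * Real.exp (-6 * Real.log p) ≤
      2 * (p : ℝ) ^ (-1 : ℝ) := by
  have hp2 : (2 : ℝ) ≤ p := by exact_mod_cast hp
  have hp0 : (0 : ℝ) < p := by linarith
  have e1 : Real.exp (-6 * Real.log p) = ((p : ℝ) ^ 6)⁻¹ := by
    rw [mul_comm, ← Real.rpow_def_of_pos hp0, Real.rpow_neg hp0.le]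
    norm_cast
  rw [e1, Real.rpow_neg_one, ← sub_nonneg]
  have e2 : 2 * (p : ℝ)⁻¹ - (p * p * (2 * (2 * ((p : ℝ) ^ 6)⁻¹)) + p * ((p : ℝ) ^ 6)⁻¹) =
      (2 * (p : ℝ) ^ 5 - 4 * p ^ 2 - p) / p ^ 6 := by
    field_simp
    ring
  rw [e2]
  apply div_nonneg _ (by positivity)
  have h3 : 8 * (p : ℝ) ^ 2 ≤ p ^ 5 := by
    have : (2 : ℝ) ^ 3 ≤ p ^ 3 := by gcongr
    nlinarith [mul_le_mul_of_nonneg_right this (sq_nonneg (p : ℝ))]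
  nlinarith

/-- Polarization: deviations of `y_j ± y_k` control the sample covariance of `y_j` and `y_k`. -/
theorem abs_sampleCov_sub_le {p n : ℕ} (hn : 1 ≤ n) {μ : Fin p → ℝ} {y : ℤ → Fin p → ℝ}
    {j k : Fin p} {u v T : ℝ}
    (hu : |∑ i ∈ Finset.Icc (1 : ℤ) n, (((y i j - μ j) + 1 * (y i k - μ k)) ^ 2 - u)| ≤ n * T)
    (hv : |∑ i ∈ Finset.Icc (1 : ℤ) n, (((y i j - μ j) + -1 * (y i k - μ k)) ^ 2 - v)| ≤ n * T)
    (hj : ((n : ℝ)⁻¹ * ∑ i ∈ Finset.Icc (1 : ℤ) n, (y i j - μ j)) ^ 2 ≤ T)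
    (hk : ((n : ℝ)⁻¹ * ∑ i ∈ Finset.Icc (1 : ℤ) n, (y i k - μ k)) ^ 2 ≤ T) :
    |sampleCov n μ y j k - (u - v) / 4| ≤ 2 * T ∧
      |sampleCov n (sampleMean n y) y j k - (u - v) / 4| ≤ 2 * T := by
  have hn0 : (0 : ℝ) < n := by exact_mod_cast hn
  have hT : 0 ≤ T := (sq_nonneg _).trans hj
  have hdecomp : sampleCov n μ y j k - (u - v) / 4 = (4 * (n : ℝ))⁻¹ *
      (∑ i ∈ Finset.Icc (1 : ℤ) n, (((y i j - μ j) + 1 * (y i k - μ k)) ^ 2 - u) -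
        ∑ i ∈ Finset.Icc (1 : ℤ) n, (((y i j - μ j) + -1 * (y i k - μ k)) ^ 2 - v)) := by
    rw [sampleCov_apply, ← Finset.sum_sub_distrib]
    have e : ∀ i, (y i j - μ j) * (y i k - μ k) =
        ((((y i j - μ j) + 1 * (y i k - μ k)) ^ 2 - u) -
          (((y i j - μ j) + -1 * (y i k - μ k)) ^ 2 - v)) / 4 + (u - v) / 4 := by
      intro i; ring
    rw [Finset.sum_congr rfl fun i _ => e i, Finset.sum_add_distrib, ← Finset.sum_div]
    simp only [Finset.sum_const, Int.card_Icc, add_sub_cancel_right, Int.toNat_natCast,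
      nsmul_eq_mul]
    field_simp
    ring
  have hknown : |sampleCov n μ y j k - (u - v) / 4| ≤ T := by
    rw [hdecomp, abs_mul, abs_of_pos (by positivity), inv_mul_le_iff₀ (by positivity)]
    have hCJ : 0 ≤ n * T := by positivity
    refine (abs_sub _ _).trans ?_
    linarith
  refine ⟨hknown.trans (by linarith), ?_⟩
  rw [sampleCov_sampleMean_apply hn μ]
  set mj := (n : ℝ)⁻¹ * ∑ i ∈ Finset.Icc (1 : ℤ) n, (y i j - μ j)
  set mk := (n : ℝ)⁻¹ * ∑ i ∈ Finset.Icc (1 : ℤ) n, (y i k - μ k)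
  have h1 := abs_le.1 hknown
  rw [abs_le]
  constructor <;> nlinarith [sq_nonneg (mj - mk), sq_nonneg (mj + mk)]

/-- Entrywise concentration of the sample covariance matrix at rate `rateJ n p β`. -/
theorem exists_sampleCov_concentration {β C₀ K : ℝ} (h0 : 1 / 2 < β) (h34 : β ≠ 3 / 4)
    (h1 : β ≠ 1) (hC₀ : 0 < C₀) (hK : 1 ≤ K) : ∃ C : ℝ, 0 < C ∧
    ∀ (Ω : Type*) [MeasurableSpace Ω] (P : Measure Ω) [IsProbabilityMeasure P] (p n : ℕ)
      (μ : Fin p → ℝ) (A : ℕ → Matrix (Fin p) (Fin p) ℝ) (ξ : ℤ → Fin p → Ω → ℝ)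
      (x : ℤ → Ω → Fin p → ℝ), 2 ≤ p → 1 ≤ n → IsQuadExpInnovation P K ξ → CoeffDecay C₀ β A →
      IsVectorLinearProcess P μ A ξ x → rateJ n p β ≤ 1 →
      ∃ Bad : Set Ω, P.real Bad ≤ 2 * (p : ℝ) ^ (-1 : ℝ) ∧ ∀ ω ∉ Bad, ∀ j k,
        |sampleCov n μ (fun i => x i ω) j k - covMatrix P (x 0) j k| ≤ C * rateJ n p β ∧
        |sampleCov n (sampleMean n fun i => x i ω) (fun i => x i ω) j k -
          covMatrix P (x 0) j k| ≤ C * rateJ n p β := by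
  obtain ⟨B, hB, hscale⟩ := exists_scale h0 h34 h1
  have hK0 : 0 < K := by linarith
  have hB0 : 0 < B := by linarith
  -- The combinations `x_j ± x_k` have coefficient bound `2 C₀`, and `8 K ε (2 C₀)² = 1` makes `ε s`
  -- admissible in the tail bounds.
  set ε : ℝ := 1 / (32 * K * C₀ ^ 2) with hε
  have hε0 : 0 < ε := by positivity
  set V : ℝ := 4 * K * ε ^ 2 * ((2 * C₀) ^ 4 * B) with hV
  have hV0 : 0 < V := by positivity
  -- The Frobenius term costs `V L`, so deviations of size `C J` leave an exponent `-8 L`. For the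
  -- sample means the cost is `1/K ≤ 1 ≤ 2 L` instead, which still leaves `-6 L`.
  set C : ℝ := B / ε * (8 + V) with hC
  have hC0 : 0 < C := by positivity
  refine ⟨2 * C, by positivity, fun Ω _ P _ p n μ A ξ x hp hn hξ hA hx hJ1 => ?_⟩
  obtain ⟨s, hs0, hsτ, hsJ, hsφ⟩ := hscale n p hn hp hJ1
  have hn0 : (0 : ℝ) < n := by exact_mod_cast hn
  have hL := half_le_log_natCast hp
  set J := rateJ n p β with hJ
  have hJ0 : 0 ≤ J := rateJ_nonneg n p β
  set L := Real.log p with hLdef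
  have hdev : (8 + V) * L ≤ ε * s * (n * (C * J)) := by
    calc (8 + V) * L = B * (8 + V) * (1 / B * L) := by field_simp
      _ ≤ B * (8 + V) * (n * J * s) := by gcongr
      _ = _ := by rw [hC]; field_simp
  have hετ : 8 * K * (ε * s) * ((2 * C₀) ^ 2 * autocorrSum β n) ≤ 1 := by
    calc 8 * K * (ε * s) * ((2 * C₀) ^ 2 * autocorrSum β n)
        = (32 * K * C₀ ^ 2 * ε) * (s * autocorrSum β n) := by ring
      _ = s * autocorrSum β n := by rw [hε]; field_simp
      _ ≤ 1 := hsτ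
  set y : Fin p → Fin p → ℝ → ℤ → Ω → ℝ :=
    fun j k c i ω => (x i ω j - μ j) + c * (x i ω k - μ k) with hy
  set E : Fin p → Fin p → ℝ → Set Ω := fun j k c => {ω | n * (C * J) ≤
    |∑ i ∈ Finset.Icc (1 : ℤ) n, (y j k c i ω ^ 2 - combVariance A j k c)|} with hE
  have hEprob : ∀ j k c, c ^ 2 ≤ 1 → P.real (E j k c) ≤ 2 * Real.exp (-6 * L) := by
    intro j k c hc
    refine ((hx.isScalarLinearProcess hA j k hc).measureReal_abs_sum_sq_ge_le h0 hK0 hξ n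
      (s := ε * s) (by positivity) hετ (n * (C * J))).trans ?_
    gcongr
    have e1 : 4 * K * (ε * s) ^ 2 * ((2 * C₀) ^ 4 * (n * autocorrSqSum β n)) ≤ V * L := by
      calc _ = 4 * K * ε ^ 2 * (2 * C₀) ^ 4 * (s ^ 2 * (n * autocorrSqSum β n)) := by ring
        _ ≤ 4 * K * ε ^ 2 * (2 * C₀) ^ 4 * (B * L) := by gcongr
        _ = _ := by rw [hV]; ring
    linarith
  set G : Fin p → Set Ω := fun j => {ω | ε * s * (n * (C * J)) ≤
    ε * s / n * (∑ i ∈ Finset.Icc (1 : ℤ) n, (x i ω j - μ j)) ^ 2} with hG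
  have hGprob : ∀ j, P.real (G j) ≤ Real.exp (-6 * L) := by
    intro j
    have h := (hx.isScalarLinearProcess hA j j (c := 0) (by norm_num)).measureReal_sq_sum_ge_le
      h0 hK0 hξ n (s := ε * s / n) (by positivity)
      (by refine le_trans (le_of_eq ?_) hετ; field_simp) (ε * s * (n * (C * J)))
    simp only [zero_mul, add_zero] at h
    refine h.trans ?_
    gcongr
    have e1 : 1 / K ≤ 1 := by rw [div_le_one hK0]; exact hK
    nlinarith [mul_pos hV0 (show 0 < L by linarith)]
  set Bad : Set Ω := (⋃ q : Fin p × Fin p, (E q.1 q.2 1 ∪ E q.1 q.2 (-1))) ∪ ⋃ j, G j with hBad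
  refine ⟨Bad, ?_, fun ω hω j k => ?_⟩
  · have b1 : P.real (⋃ q : Fin p × Fin p, (E q.1 q.2 1 ∪ E q.1 q.2 (-1))) ≤
        (p * p) * (2 * (2 * Real.exp (-6 * L))) := by
      calc _ ≤ ∑ q : Fin p × Fin p, P.real (E q.1 q.2 1 ∪ E q.1 q.2 (-1)) :=
            measureReal_iUnion_fintype_le _
        _ ≤ ∑ q : Fin p × Fin p, 2 * (2 * Real.exp (-6 * L)) := by
            refine Finset.sum_le_sum fun q _ => (measureReal_union_le _ _).trans ?_
            linarith [hEprob q.1 q.2 1 (by norm_num), hEprob q.1 q.2 (-1) (by norm_num)]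
        _ = _ := by simp
    have b2 : P.real (⋃ j, G j) ≤ p * Real.exp (-6 * L) := by
      calc _ ≤ ∑ j, P.real (G j) := measureReal_iUnion_fintype_le _
        _ ≤ ∑ j : Fin p, Real.exp (-6 * L) := Finset.sum_le_sum fun j _ => hGprob j
        _ = _ := by simp
    refine (measureReal_union_le _ _).trans ((add_le_add b1 b2).trans ?_)
    exact four_sq_mul_exp_add_le hp
  · simp only [hBad, Set.mem_union, Set.mem_iUnion, not_or, not_exists] at hω
    obtain ⟨hωE, hωG⟩ := hω
    have d1 := (hωE (j, k)).1
    have d2 := (hωE (j, k)).2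
    simp only [hE, Set.mem_ofPred_eq, not_le] at d1 d2
    have hG2 : ∀ j, ((n : ℝ)⁻¹ * ∑ i ∈ Finset.Icc (1 : ℤ) n, (x i ω j - μ j)) ^ 2 ≤ C * J := by
      intro j
      have h := hωG j
      simp only [hG, Set.mem_ofPred_eq, not_le] at h
      set Z := ∑ i ∈ Finset.Icc (1 : ℤ) n, (x i ω j - μ j)
      have hεs : 0 < ε * s := by positivity
      have h2 : ε * s * ((n : ℝ)⁻¹ * Z ^ 2) < ε * s * (n * (C * J)) := by
        refine lt_of_eq_of_lt ?_ h; ring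
      have h3 := lt_of_mul_lt_mul_left h2 hεs.le
      calc ((n : ℝ)⁻¹ * Z) ^ 2 = (n : ℝ)⁻¹ * ((n : ℝ)⁻¹ * Z ^ 2) := by ring
        _ ≤ (n : ℝ)⁻¹ * (n * (C * J)) := by gcongr
        _ = _ := by field_simp
    rw [covMatrix_apply_eq h0 hK0 hξ hA hx]
    have h := abs_sampleCov_sub_le hn d1.le d2.le (hG2 j) (hG2 k)
    rwa [← mul_assoc] at h

/-! ### Good events and the final assembly -/

theorem IsSubGaussianInnovation.isQuadExpInnovation {Ω : Type*} [MeasurableSpace Ω] {p : ℕ}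
    {P : Measure Ω} {Cξ K : ℝ} {ξ : ℤ → Fin p → Ω → ℝ}
    (hξ : IsSubGaussianInnovation P Cξ ξ)
    (hK : ∀ X : Ω → ℝ, Measurable X → ∫ ω, X ω ∂P = 0 → variance X P = 1 →
      (∀ q : ℝ, 1 ≤ q →
        eLpNorm X (ENNReal.ofReal q) P ≤ ENNReal.ofReal (Cξ * q ^ (1 / 2 : ℝ))) →
      QuadExpBound P K X) : IsQuadExpInnovation P K ξ where
  measurable := hξ.measurable
  indep := hξ.indep
  bound i k := hK _ (hξ.measurable i k) (hξ.mean_zero i k) (hξ.variance_one i k) (hξ.moment_le i k)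

/-- The exceptional set need not be measurable; the good event is the complement of its measurable
hull, which has the same measure. -/
theorem HoldsWithProbAtLeast.of_measureReal_le {Ω : Type*} [MeasurableSpace Ω] {P : Measure Ω}
    [IsProbabilityMeasure P] {Bad : Set Ω} {E : Ω → Prop} {δ q : ℝ} (hBad : P.real Bad ≤ δ)
    (hE : ∀ ω ∉ Bad, E ω) (hq : q ≤ 1 - δ) : HoldsWithProbAtLeast P q E := by
  refine ⟨(toMeasurable P Bad)ᶜ, (measurableSet_toMeasurable P Bad).compl,
    fun ω hω => hE ω fun h => hω (subset_toMeasurable P Bad h), ?_⟩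
  rw [probReal_compl_eq_one_sub (measurableSet_toMeasurable P Bad), measureReal_def,
    measure_toMeasurable, ← measureReal_def]
  linarith

theorem HoldsWithProbAtLeast.of_nonpos {Ω : Type*} [MeasurableSpace Ω] {P : Measure Ω}
    {E : Ω → Prop} {q : ℝ} (hq : q ≤ 0) : HoldsWithProbAtLeast P q E :=
  ⟨∅, MeasurableSet.empty, by simp, by simpa using hq⟩

theorem HoldsWithProbAtLeast.mono {Ω : Type*} [MeasurableSpace Ω] {P : Measure Ω}
    {E F : Ω → Prop} {q : ℝ} (h : HoldsWithProbAtLeast P q E) (hEF : ∀ ω, E ω → F ω) :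
    HoldsWithProbAtLeast P q F :=
  let ⟨G, hG, hE, hq⟩ := h
  ⟨G, hG, fun ω hω => hEF ω (hE ω hω), hq⟩

/-- The error bounds for the Dantzig-type estimator in `ℓ¹` and `ℓ^∞`. -/
theorem exists_dantzigArgmin_error {β C₀ Cξ : ℝ} (h0 : 1 / 2 < β) (h34 : β ≠ 3 / 4)
    (h1 : β ≠ 1) (hC₀ : 0 < C₀) (hCξ : 0 < Cξ) : ∃ C₁ : ℝ, 1 < C₁ ∧
    ∀ (Ω : Type*) [MeasurableSpace Ω] (P : Measure Ω) [IsProbabilityMeasure P] (p n : ℕ)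
      (μ : Fin p → ℝ) (A : ℕ → Matrix (Fin p) (Fin p) ℝ) (ξ : ℤ → Fin p → Ω → ℝ)
      (x : ℤ → Ω → Fin p → ℝ), 1 ≤ p → 1 ≤ n → IsSubGaussianInnovation P Cξ ξ →
      CoeffDecay C₀ β A → IsVectorLinearProcess P μ A ξ x →
      IsUnit (covMatrix P (x 0)).det →
      ∀ (b : Fin p → ℝ) (bhat : Ω → Fin p → ℝ) (ρ δ : ℝ), 0 ≤ ρ → 0 ≤ δ →
      P.real {ω | ρ < vecNorm ∞ (bhat ω - b)} ≤ δ →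
      ∀ centre : Ω → Fin p → ℝ,
      (centre = (fun _ => μ) ∨ centre = fun ω => sampleMean n (fun i => x i ω)) →
      ∀ lam : ℝ,
      ρ + C₁ * vecNorm 1 ((covMatrix P (x 0))⁻¹ *ᵥ b) * rateJ n p β ≤ lam →
      HoldsWithProbAtLeast P (1 - δ - 2 * (p : ℝ) ^ (-1 : ℝ)) fun ω =>
        (dantzigArgmin (sampleCov n (centre ω) (fun i => x i ω)) (bhat ω) lam).Nonempty ∧
        ∀ θhat ∈ dantzigArgmin (sampleCov n (centre ω) (fun i => x i ω)) (bhat ω) lam,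
          vecNorm 1 (θhat - (covMatrix P (x 0))⁻¹ *ᵥ b) ≤
            6 * smallness ((covMatrix P (x 0))⁻¹ *ᵥ b)
              (5 * (matL1Norm (covMatrix P (x 0))⁻¹ * lam)) ∧
          ∀ j, |(θhat - (covMatrix P (x 0))⁻¹ *ᵥ b) j| ≤
            2 * (matL1Norm (covMatrix P (x 0))⁻¹ * lam) := by
  obtain ⟨K, hK, hquad⟩ := exists_quadExpBound hCξ
  obtain ⟨C, hC, hconc⟩ := exists_sampleCov_concentration h0 h34 h1 hC₀ hK
  set σ := C₀ ^ 2 * autocorr (powWeight β) 0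
  have hσ0 : 0 ≤ σ := mul_nonneg (sq_nonneg _) (autocorr_powWeight_nonneg β 0)
  have hK0 : 0 < K := by linarith
  -- `C` serves the concentration case, `σ` (a bound for the entries of the covariance) the case
  -- `rateJ > 1`, and `2` makes the constant exceed 1.
  refine ⟨C + σ + 2, by linarith, fun Ω _ P _ p n μ A ξ x hp hn hξ' hA hx hdet b bhat ρ δ hρ hδ
    hb centre hcentre lam hlam => ?_⟩
  have hξ := hξ'.isQuadExpInnovation (hquad Ω P)
  have hJ0 := rateJ_nonneg n p β
  set θ := (covMatrix P (x 0))⁻¹ *ᵥ b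
  have hθ1 : 0 ≤ vecNorm 1 θ := vecNorm_nonneg 1 θ
  -- For `p = 1` the claimed probability is at most `1 - 2 < 0`, so the empty event will do.
  rcases eq_or_lt_of_le hp with rfl | hp2
  · refine HoldsWithProbAtLeast.of_nonpos ?_
    simp only [Nat.cast_one, Real.one_rpow]; linarith
  rcases le_or_gt (rateJ n p β) 1 with hJ1 | hJ1
  · obtain ⟨Bad, hBad, hgood⟩ := hconc Ω P p n μ A ξ x hp2 hn hξ hA hx hJ1
    refine HoldsWithProbAtLeast.of_measureReal_le
      (Bad := {ω | ρ < vecNorm ∞ (bhat ω - b)} ∪ Bad)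
      ((measureReal_union_le _ _).trans (add_le_add hb hBad)) (fun ω hω => ?_) (by linarith)
    rw [Set.mem_union, not_or] at hω
    refine dantzigArgmin_error_of_entry_close (isSymm_covMatrix _) hdet rfl hρ
      (ε := C * rateJ n p β) (by positivity) (not_lt.1 hω.1) (fun j k => ?_) (le_trans ?_ hlam)
    · rcases hcentre with rfl | rfl
      · exact (hgood ω hω.2 j k).1
      · exact (hgood ω hω.2 j k).2
    · have : 0 ≤ (σ + 2) * (vecNorm 1 θ * rateJ n p β) := by positivity
      nlinarith
  · refine HoldsWithProbAtLeast.of_measureReal_le hb (fun ω hω => ?_)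
      (by have : 0 ≤ (p : ℝ) ^ (-1 : ℝ) := by positivity
          linarith)
    refine dantzigArgmin_error_of_large hp hdet rfl hρ (not_lt.1 hω)
      (abs_covMatrix_apply_le h0 hK0 hξ hA hx 0) (le_trans ?_ hlam)
    have e1 : σ * vecNorm 1 θ ≤ (C + σ + 2) * vecNorm 1 θ := by gcongr; linarith
    have e2 : (C + σ + 2) * vecNorm 1 θ * 1 ≤ (C + σ + 2) * vecNorm 1 θ * rateJ n p β := by
      gcongr
    linarith

theorem negPow_nonneg (p : ℕ) (C : ℝ≥0∞) : 0 ≤ negPow p C := by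
  unfold negPow; split_ifs <;> positivity

end

theorem theorem1 :
    -- `C₃ r ν w C₁ c_b` depends on these five arguments only
    ∃ C₃ : ℝ → ℝ → ℝ≥0∞ → ℝ → ℝ → ℝ, (∀ r ν w C₁ c_b, 0 < C₃ r ν w C₁ c_b) ∧
    ∀ β C₀ Cξ : ℝ, 1 / 2 < β → β ≠ 3 / 4 → β ≠ 1 → 0 < C₀ → 0 < Cξ →
    -- `C₁` and `C₂` depend on `β`, `C₀`, `Cξ` only
    ∃ C₁ C₂ : ℝ, 1 < C₁ ∧ 0 < C₂ ∧
    ∀ (Ω : Type*) [MeasurableSpace Ω] (P : Measure Ω) [IsProbabilityMeasure P]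
      (p n : ℕ) (_ : 1 ≤ p) (_ : 1 ≤ n)
      -- the linear process
      (μ : Fin p → ℝ) (A : ℕ → Matrix (Fin p) (Fin p) ℝ)
      (ξ : ℤ → Fin p → Ω → ℝ) (x : ℤ → Ω → Fin p → ℝ)
      (_ : IsSubGaussianInnovation P Cξ ξ) (_ : CoeffDecay C₀ β A)
      (_ : IsVectorLinearProcess P μ A ξ x)
      -- its covariance matrix and the linear functional
      (Sig : Matrix (Fin p) (Fin p) ℝ) (_ : Sig = covMatrix P (x 0)) (_ : IsUnit Sig.det)
      (b θ : Fin p → ℝ) (_ : θ = Sig⁻¹ *ᵥ b)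
      -- the estimator of `b` and its rate (`C_b = ∞` is allowed)
      (bhat : Ω → Fin p → ℝ) (_ : AEMeasurable bhat P)
      (c_b r_b : ℝ) (C_b : ℝ≥0∞) (_ : 0 < c_b) (_ : 0 ≤ r_b) (_ : 0 < C_b)
      (_ : P.real {ω | c_b * r_b < vecNorm ∞ (bhat ω - b)} ≤ 2 * negPow p C_b)
      -- the sample covariance matrix, centred at the known mean or at the sample mean
      (centre : Ω → Fin p → ℝ)
      (_ : centre = (fun _ => μ) ∨ centre = fun ω => sampleMean n (fun i => x i ω))
      (Shat : Ω → Matrix (Fin p) (Fin p) ℝ)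
      (_ : Shat = fun ω => sampleCov n (centre ω) (fun i => x i ω)),
      (∀ lam : ℝ, c_b * r_b + C₁ * vecNorm 1 θ * rateJ n p β ≤ lam →
        HoldsWithProbAtLeast P (1 - 2 * negPow p C_b - 2 * (p : ℝ) ^ (-C₂)) fun ω =>
          (dantzigArgmin (Shat ω) (bhat ω) lam).Nonempty ∧
          ∀ θhat ∈ dantzigArgmin (Shat ω) (bhat ω) lam, ∀ w : ℝ≥0∞, 1 ≤ w →
            vecNorm w (θhat - θ) ≤
              (6 * smallness θ (5 * matL1Norm Sig⁻¹ * lam)) ^ (w⁻¹).toReal *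
                (2 * matL1Norm Sig⁻¹ * lam) ^ (1 - (w⁻¹).toReal)) ∧
      (∀ r ν M lam : ℝ, 0 ≤ r → r < 1 → 0 ≤ ν → θ ∈ sparseClass r ν M →
        lam = c_b * r_b + C₁ * ν ^ (1 - r) * M * rateJ n p β →
        ∀ w : ℝ≥0∞, 1 ≤ w →
        HoldsWithProbAtLeast P (1 - 2 * negPow p C_b - 2 * (p : ℝ) ^ (-C₂)) fun ω =>
          (dantzigArgmin (Shat ω) (bhat ω) lam).Nonempty ∧
          ∀ θhat ∈ dantzigArgmin (Shat ω) (bhat ω) lam,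
            vecNorm w (θhat - θ) ≤
              C₃ r ν w C₁ c_b * M ^ (w⁻¹).toReal *
                (matL1Norm Sig⁻¹ * (M * rateJ n p β + r_b)) ^ (1 - r * (w⁻¹).toReal)) := by
  refine ⟨sparseConst, sparseConst_pos, fun β C₀ Cξ h0 h34 h1 hC₀ hCξ => ?_⟩
  obtain ⟨C₁, hC₁, hmain⟩ := exists_dantzigArgmin_error h0 h34 h1 hC₀ hCξ
  refine ⟨C₁, 1, hC₁, one_pos, ?_⟩
  intro Ω _ P _ p n hp hn μ A ξ x hξ hA hx Sig hSig hdet b θ hθ bhat _ c_b r_b C_b hc_b hr_b _ hb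
    centre hcentre Shat hShat
  subst hSig hθ hShat
  have hρ : 0 ≤ c_b * r_b := mul_nonneg hc_b.le hr_b
  have hJ0 := rateJ_nonneg n p β
  have hgood := hmain Ω P p n μ A ξ x hp hn hξ hA hx hdet b bhat (c_b * r_b) (2 * negPow p C_b) hρ
    (mul_nonneg zero_le_two (negPow_nonneg p C_b)) hb centre hcentre
  refine ⟨fun lam hlam => (hgood lam hlam).mono fun ω hω => ⟨hω.1, fun θhat hmem w hw => ?_⟩,
    fun r ν M lam hr0 hr hν hmemθ hlam w hw => ?_⟩
  · obtain ⟨e1, e2⟩ := hω.2 θhat hmem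
    have hlam0 : 0 ≤ lam := by
      refine le_trans ?_ hlam
      have := mul_nonneg (mul_nonneg (by linarith : 0 ≤ C₁)
        (vecNorm_nonneg 1 ((covMatrix P (x 0))⁻¹ *ᵥ b))) hJ0
      linarith
    rw [mul_assoc 5, mul_assoc 2]
    exact vecNorm_le_interpolation hw
      (mul_nonneg zero_le_two (mul_nonneg (matL1Norm_nonneg _) hlam0)) e1 e2
  · have hM : 0 ≤ M := by
      refine le_trans (Finset.sum_nonneg fun j _ => ?_) hmemθ.2
      split_ifs <;> positivity
    -- On the sparsity class `|θ|₁ ≤ ν^{1-r} M`, so this `lam` is admissible in the general bound.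
    have hle : c_b * r_b + C₁ * vecNorm 1 ((covMatrix P (x 0))⁻¹ *ᵥ b) * rateJ n p β ≤ lam := by
      rw [hlam, mul_assoc C₁ (ν ^ (1 - r)) M]
      have := vecNorm_one_le_of_mem_sparseClass hr hν hmemθ
      gcongr
    refine (hgood lam hle).mono fun ω hω => ⟨hω.1, fun θhat hmem => ?_⟩
    obtain ⟨e1, e2⟩ := hω.2 θhat hmem
    exact vecNorm_le_of_mem_sparseClass hw hr0 hr hν (matL1Norm_nonneg _) hJ0 hr_b hc_b.le
      (by linarith) hM hmemθ hlam e1 e2
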